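/- **Setting.** Let $L>0$, $\Omega=[0,L]^3$ with periodic boundary conditions, $\lambda_1=4\pi^2/L^2$. For $s=0,1,2$ let $\dot V_s$ be the space of real, mean-free, divergence-free vector fields $u=\sum_{K\in\mathbb Z^3\setminus\{0\}}\hat u_Ke^{2\pi iK\cdot x/L}$ with $\sum_K|K|^{2s}|\hat u_K|^2<\infty$; $H=\dot V_0$, $V=\dot V_1$, $D(A)=\dot V_2$. Write $\|\cdot\|,(\cdot,\cdot)$ for the $L^2$ norm and inner product, $\mathcal P$ for the Leray projection, $A=-\Delta$, $B(u,v)=\mathcal P[(u\cdot\nabla)v]$, and $P_Nu=\sum_{0<|K|<N}\hat u_Ke^{2\pi iK\cdot x/L}$. A *solution* on a time interval $I$ of $$\tfrac{dv}{dt}+\nu Av+B(u,u)=F,\qquad v=u+\alpha^2Au \tag{E$_{\alpha,F}$}$$ is a function $u\in C(I;V)\cap L^2_{loc}(I;D(A))$ satisfying the equation in the dual of $D(A)$. There are constants $c>0$ such that $\|g\|_{L^3}\le c\|g\|^{1/2}\|\nabla g\|^{1/2}$, $\|g\|_{L^4}\le c\|g\|^{1/4}\|\nabla g\|^{3/4}$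 and $\|g\|_{L^6}\le c\|\nabla g\|$ for all $g\in V$; fix any such $c$. Let $\nu>0$, $f\in L^\infty([0,\infty);H)$, $F_\infty=\sup_{s\ge0}\|f(s)\|$ (essential supremum), let $\alpha_0,\alpha_1,M_A,M_B,M_C>0$, $\alpha_0\le\alpha\le\alpha_1$, and let $u$ be a solution of (E$_{\alpha,f}$) on $[0,\infty)$ with $u(0)\in\dot V_2$, $\|u(0)\|\le M_A$, $\|\nabla u(0)\|\le M_B$, $\|\Delta u(0)\|\le M_C$. Put $$M_1^2(t)=e^{-\nu\lambda_1t}(M_A^2+\alpha_1^2M_B^2)+\tfrac{F_\infty^2}{\lambda_1^2\nu^2},$$ $$M_2^2(t)=e^{-\nu\lambda_1t}(M_B^2+\alpha_1^2M_C^2)+\tfrac{2c^4}{\alpha_0^5\nu^2\lambda_1}e^{-\nu\lambda_1t}(M_A^2+\alpha_1^2M_B^2)^2+\tfrac{F_\infty^2}{\nu^2\lambda_1}+\tfrac{2c^4F_\infty^4}{\alpha_0^5\nu^6\lambda_1^5},$$ $$M_3(t)=\tfrac{\nu}{\alpha_0}M_2(t)+\tfrac{c^2}{\alpha_0^4\lambda_1^{3/4}}M_1^2(t)+F_\infty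 .$$ **The algorithm.** Let $w_0\in\dot V_2$, $0<\varepsilon<\alpha_0^2$, $\beta_1\in[\alpha_0,\alpha_1]$, $t_1=0$. Suppose that for every $n\ge1$ there are $\tilde N_n,N_n\in\mathbb N$, $\eta_n>0$, and times $t_n\le\hat t_n<t_{n+1}$ with $$\zeta_n:=\frac1{t_{n+1}-\hat t_n}\int_{\hat t_n}^{t_{n+1}}\|\nabla P_{\tilde N_n}(u_t-\nu\Delta u)\|^2ds>0,$$ and a solution $w_n$ of (E$_{\beta_n,F_n}$) on $[t_n,t_{n+1}]$ (with $w_n$ in place of $u$), $F_n=f-\eta_n(I+\beta_n^2A)\mathcal P(P_{N_n}w_n-P_{N_n}u)$, with $w_1(0)=w_0$ and $w_{n+1}(t_{n+1})=w_n(t_{n+1})$. Put $g_n=w_n-u$, $h_n=P_{N_n}(u_t+\nu Au)$, $\delta_n=\int_{\hat t_n}^{t_{n+1}}\|\nabla h_n\|^2ds$, and let $\beta_{n+1}\ge0$ be given by $$\begin{aligned}\beta_{n+1}^2=\beta_n^2+\frac1{\delta_n}\int_{\hat t_n}^{t_{n+1}}\Big[&(\tfrac d{dt}P_{N_n}g_n,h_n)+\beta_n^2(\tfrac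 d{dt}\nabla P_{N_n}g_n,\nabla h_n)+\nu(\nabla P_{N_n}g_n,\nabla h_n)+\nu\beta_n^2(\nabla AP_{N_n}g_n,\nabla h_n)\\&+(P_{N_n}B(w_n,w_n)-P_{N_n}B(w_n-P_{N_n}g_n,w_n-P_{N_n}g_n),h_n)\\&+\eta_n(P_{N_n}g_n,h_n)+\beta_n^2\eta_n(\nabla P_{N_n}g_n,\nabla h_n)\Big]ds\end{aligned}$$ (with $\beta_{n+1}=0$ if the right-hand side were negative; the conclusion $\beta_{n+1}>0$ shows that this does not occur). Let $$M_{4,n}^2(t)=e^{-\frac{\eta_n}2(t-t_n)}\big(\|w_n(t_n)\|^2+\beta_n^2\|\nabla w_n(t_n)\|^2\big)+\tfrac4{\eta_n^2}F_\infty^2+2\big(2+\tfrac{\beta_n^2}{\alpha_0^2}\big)M_1^2(t_n),$$ $$R_n=\frac{M_1(\hat t_n)}{\alpha_0}+\frac{M_{4,n}(\hat t_n)}{\beta_n},\quad S_n=\frac{M_3(t_n)}{\nu^{1/2}}+\frac{\nu^{1/2}M_2(t_n)}{\alpha_0},\quad \mu_n=\max\Big\{1,\frac{\sqrt\varepsilon+\alpha_1}{\beta_n}\Big\},$$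 $\chi(1)=1$, $\chi(n)=0$ for $n\ge2$, and assume for all $n\ge1$: $$\tilde N_n\le N_n,\qquad \frac{\eta_n}{N_n^2}\le\frac{\nu\lambda_1}2,\qquad \frac{27c^4M_1^4(t_n)}{8\nu^3\alpha_0^4}\le\eta_n,\qquad \mu_nS_n\frac{16}{\beta_n}\le\eta_n^{1/2}\nu\lambda_1^{3/4},$$ $$\frac{8c^2\lambda_1^{-1/4}}{\eta_n^{1/2}\beta_n^2\zeta_n^{1/2}N_n^{1/2}}R_nS_n\le\frac{\varepsilon}{4|\alpha_1^2-\alpha_0^2|\chi(n)+4\varepsilon},\qquad \mu_ne^{-\frac{\eta_n}4(t_{n+1}-t_n)}\le\frac18,$$ $$\frac{4c^2}{\zeta_n^{1/2}N_n^{1/2}\beta_n}R_ne^{-\frac{\eta_n}4(\hat t_n-t_n)}\le\frac1{4\nu\lambda_1^{1/2}},$$ $$\frac{8c^2\lambda_1^{-1/4}}{\beta_n\zeta_n^{1/2}N_n^{1/2}}R_ne^{-\frac{\eta_n}4(\hat t_n-t_n)}\Big[\Big(1+\frac{\beta_n}{\alpha_0}\Big)M_1(t_n)+M_{4,n}(t_n)\Big]\le\frac\varepsilon2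 .$$ **Theorem.** Then for all $n\ge0$ one has $\beta_{n+1}>0$, $$|\beta_{n+1}^2-\alpha^2|\le\frac{\nu^{-1}\lambda_1^{-3/4}(\|g_1(0)\|+\beta_1\|\nabla g_1(0)\|)+|\beta_1^2-\alpha^2|}{2^n},$$ $$\|g_{n+1}(t_{n+1})\|+\beta_{n+1}\|\nabla g_{n+1}(t_{n+1})\|\le\frac{\|g_1(0)\|+\beta_1\|\nabla g_1(0)\|+\nu\lambda_1^{3/4}|\beta_1^2-\alpha^2|}{2^n}.$$ In particular $\beta_n\to\alpha$ in $\mathbb R$ and $w_n(t_n)-u(t_n)\to0$ in $V$ exponentially: there is $C$ with $|\beta_{n+1}-\alpha|\le C2^{-n}$ and $\|\nabla g_{n+1}(t_{n+1})\|\le C2^{-n}$ for all $n\ge0$. -/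

import Mathlib

open Real Set Filter Topology MeasureTheory

noncomputable section

namespace Bardina

/-! Vector fields on the torus `[0,L]³` are handled through their Fourier coefficients,
`u(x) = ∑_K u K · exp(2πi K·x/L)`, with `u K ∈ ℂ³`. -/

/-- A (formal) Fourier series with coefficients in `ℂ³`, indexed by wavevectors `K ∈ ℤ³`. -/
abbrev Coeff : Type := (Fin 3 → ℤ) → EuclideanSpace ℂ (Fin 3)

/-- `|K|²`. -/
def kSq (K : Fin 3 → ℤ) : ℝ := ∑ i, (K i : ℝ) ^ 2

/-- The eigenvalue `4π²|K|²/L²` of `-Δ`. -/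
def lam (L : ℝ) (K : Fin 3 → ℤ) : ℝ := 4 * π ^ 2 * kSq K / L ^ 2

/-- The smallest eigenvalue `λ₁ = 4π²/L²`. -/
def lam1 (L : ℝ) : ℝ := 4 * π ^ 2 / L ^ 2

/-- `u` belongs to the space `V_s` of real, mean-free, divergence-free fields with
`∑ |K|^{2s} |u K|² < ∞`. So `H = V_0`, `V = V_1`, `D(A) = V_2`. -/
def MemV (s : ℕ) (u : Coeff) : Prop :=
  u 0 = 0 ∧
  (∀ K i, u (-K) i = (starRingEnd ℂ) (u K i)) ∧
  (∀ K, ∑ i, (K i : ℂ) * u K i = 0) ∧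
  Summable fun K => kSq K ^ s * ‖u K‖ ^ 2

/-- The norm of `V_s`: `‖u‖` for `s = 0`, `‖∇u‖` for `s = 1`, `‖Au‖ = ‖Δu‖` for `s = 2`. -/
def normV (L : ℝ) (s : ℕ) (u : Coeff) : ℝ :=
  √(L ^ 3 * ∑' K, lam L K ^ s * ‖u K‖ ^ 2)

/-- The inner product of `V_s`: `(u,v)` for `s = 0`, `(∇u,∇v)` for `s = 1`. -/
def innerV (L : ℝ) (s : ℕ) (u v : Coeff) : ℝ :=
  L ^ 3 * ∑' K, lam L K ^ s * (inner ℂ (v K) (u K)).re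

/-- The Stokes operator `A = -Δ`. -/
def stokes (L : ℝ) (u : Coeff) : Coeff := fun K => (lam L K : ℂ) • u K

/-- The Helmholtz-Leray projection, also removing the mean. -/
def leray (u : Coeff) : Coeff := fun K =>
  if K = 0 then 0
  else u K - ((∑ i, (K i : ℂ) * u K i) / (kSq K : ℂ)) • WithLp.toLp 2 (fun i => (K i : ℂ))

/-- The projection `P_N` onto the Fourier modes with `0 < |K| < N`. -/
def proj (N : ℕ) (u : Coeff) : Coeff := fun K =>
  if 0 < kSq K ∧ kSq K < (N : ℝ) ^ 2 then u K else 0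

/-- `(u·∇)v`, whose `K`-th coefficient is the convolution `∑_J (u_J · 2πi(K-J)/L) v_{K-J}`. -/
def advect (L : ℝ) (u v : Coeff) : Coeff := fun K =>
  ∑' J : Fin 3 → ℤ,
    (∑ i, u J i * (2 * π * Complex.I * ((K i - J i : ℤ) : ℂ) / (L : ℂ))) • v (K - J)

/-- `B(u,v) = 𝒫[(u·∇)v]`. -/
def bilin (L : ℝ) (u v : Coeff) : Coeff := leray (advect L u v)

/-- `u + α² A u`. -/
def filtered (L α : ℝ) (u : Coeff) : Coeff := u + α ^ 2 • stokes L u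

/-- The time derivative of a time dependent field, mode by mode. -/
def timeDeriv (u : ℝ → Coeff) (t : ℝ) : Coeff := fun K => deriv (fun s => u s K) t

/-- `f ∈ L^∞([0,∞);H)`. (Strong measurability into the separable space `H` is measurability
of every coefficient.) -/
def IsForcing (L : ℝ) (f : ℝ → Coeff) : Prop :=
  (∀ K, AEStronglyMeasurable (fun t => f t K) (volume.restrict (Ici 0))) ∧
  (∀ᵐ t ∂(volume.restrict (Ici (0 : ℝ))), MemV 0 (f t)) ∧
  ∃ C : ℝ, ∀ᵐ t ∂(volume.restrict (Ici (0 : ℝ))), normV L 0 (f t) ≤ C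

/-- The (essential) supremum `sup_{s ≥ 0} ‖f(s)‖`. -/
def supNorm (L : ℝ) (f : ℝ → Coeff) : ℝ :=
  essSup (fun t => normV L 0 (f t)) (volume.restrict (Ici (0 : ℝ)))

/-- `u` is a (weak) solution on the time interval `I` of
`dv/dt + ν A v + B(u,u) = F`, `v = u + α² A u`:
`u ∈ C(I;V) ∩ L²_loc(I;D(A))`, and the equation holds in the dual of `D(A)`, that is, it holds,
integrated in time, when tested against every Fourier mode. -/
structure IsSolution (L ν α : ℝ) (F : ℝ → Coeff) (I : Set ℝ) (u : ℝ → Coeff) : Prop where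
  memV : ∀ t ∈ I, MemV 1 (u t)
  continuous : ∀ t ∈ I, Tendsto (fun s => normV L 1 (u s - u t)) (𝓝[I] t) (𝓝 0)
  memDA : ∀ᵐ t ∂(volume.restrict I), MemV 2 (u t)
  sqIntegrable : LocallyIntegrableOn (fun t => normV L 2 (u t) ^ 2) I volume
  equation : ∀ s ∈ I, ∀ t ∈ I, s ≤ t → ∀ K,
    filtered L α (u t) K - filtered L α (u s) K =
      ∫ r in s..t, (F r K - ν • stokes L (filtered L α (u r)) K - bilin L (u r) (u r) K)

/-- The right-hand side `f - η (I + β²A) 𝒫 (P_N w - P_N u)` of the nudged system. -/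
def nudgedForcing (L β η : ℝ) (N : ℕ) (f u w : ℝ → Coeff) : ℝ → Coeff := fun t =>
  f t - η • filtered L β (leray (proj N (w t) - proj N (u t)))

/-- The cube `[0,L]³`. -/
def cube (L : ℝ) : Set (Fin 3 → ℝ) := Icc 0 (fun _ => L)

/-- The square integrable real vector field `φ` on `[0,L]³` has the Fourier coefficients `g`. -/
def Realizes (L : ℝ) (φ : (Fin 3 → ℝ) → EuclideanSpace ℝ (Fin 3)) (g : Coeff) : Prop :=
  MemLp φ 2 (volume.restrict (cube L)) ∧
  ∀ K i, g K i = (1 / (L : ℂ) ^ 3) * ∫ x in cube L,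
    (φ x i : ℂ) * Complex.exp (-(2 * π * Complex.I * (∑ j, (K j : ℂ) * (x j : ℂ)) / (L : ℂ)))

/-- `c` is an admissible constant in the Gagliardo-Nirenberg inequalities
`‖g‖_{L³} ≤ c ‖g‖^{1/2} ‖∇g‖^{1/2}`, `‖g‖_{L⁴} ≤ c ‖g‖^{1/4} ‖∇g‖^{3/4}`, `‖g‖_{L⁶} ≤ c ‖∇g‖`
for `g ∈ V`. -/
def IsGNConstant (L c : ℝ) : Prop :=
  0 < c ∧ ∀ g : Coeff, MemV 1 g → ∀ φ, Realizes L φ g →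
    eLpNorm φ 3 (volume.restrict (cube L)) ≤
      ENNReal.ofReal (c * normV L 0 g ^ (1 / 2 : ℝ) * normV L 1 g ^ (1 / 2 : ℝ)) ∧
    eLpNorm φ 4 (volume.restrict (cube L)) ≤
      ENNReal.ofReal (c * normV L 0 g ^ (1 / 4 : ℝ) * normV L 1 g ^ (3 / 4 : ℝ)) ∧
    eLpNorm φ 6 (volume.restrict (cube L)) ≤ ENNReal.ofReal (c * normV L 1 g)

/-- The known real constants: period, viscosity, Gagliardo-Nirenberg constant, bounds
`α₀ ≤ α ≤ α₁`, and the bounds `MA, MB, MC` on `‖u(0)‖, ‖∇u(0)‖, ‖Δu(0)‖`. -/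
structure Constants where
  L : ℝ
  ν : ℝ
  c : ℝ
  α₀ : ℝ
  α₁ : ℝ
  MA : ℝ
  MB : ℝ
  MC : ℝ

namespace Constants

variable (p : Constants) (f : ℝ → Coeff)

/-- `λ₁`. -/
def l1 : ℝ := lam1 p.L

/-- `M₁(t)²`. -/
def M1sq (t : ℝ) : ℝ :=
  exp (-(p.ν * p.l1 * t)) * (p.MA ^ 2 + p.α₁ ^ 2 * p.MB ^ 2)
    + 1 / (p.l1 ^ 2 * p.ν ^ 2) * supNorm p.L f ^ 2

/-- `M₁(t)`. -/
def M1 (t : ℝ) : ℝ := √(p.M1sq f t)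

/-- `M₂(t)²`. -/
def M2sq (t : ℝ) : ℝ :=
  exp (-(p.ν * p.l1 * t)) * (p.MB ^ 2 + p.α₁ ^ 2 * p.MC ^ 2)
    + 2 * p.c ^ 4 / (p.α₀ ^ 5 * p.ν ^ 2 * p.l1) * exp (-(p.ν * p.l1 * t))
        * (p.MA ^ 2 + p.α₁ ^ 2 * p.MB ^ 2) ^ 2
    + 1 / (p.ν ^ 2 * p.l1) * supNorm p.L f ^ 2
    + 2 * p.c ^ 4 / (p.α₀ ^ 5 * p.ν ^ 6 * p.l1 ^ 5) * supNorm p.L f ^ 4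

/-- `M₂(t)`. -/
def M2 (t : ℝ) : ℝ := √(p.M2sq f t)

/-- `M₃(t)`. -/
def M3 (t : ℝ) : ℝ :=
  p.ν / p.α₀ * p.M2 f t + p.c ^ 2 / (p.α₀ ^ 4 * p.l1 ^ (3 / 4 : ℝ)) * p.M1 f t ^ 2
    + supNorm p.L f

/-- `M₄(t,η)²` for a step that starts at time `tn` in the state `wn`, with parameter `β`. -/
def M4sq (wn : Coeff) (tn β t η : ℝ) : ℝ :=
  exp (-(η / 2 * (t - tn))) * (normV p.L 0 wn ^ 2 + β ^ 2 * normV p.L 1 wn ^ 2)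
    + 4 / η ^ 2 * supNorm p.L f ^ 2
    + 2 * (2 + β ^ 2 / p.α₀ ^ 2) * p.M1 f tn ^ 2

/-- `M₄(t,η)`. -/
def M4 (wn : Coeff) (tn β t η : ℝ) : ℝ := √(p.M4sq f wn tn β t η)

end Constants

/-- `P_N (u_t + ν A u)(s) = P_N (u_t - ν Δu)(s)`. -/
def observed (L ν : ℝ) (N : ℕ) (u : ℝ → Coeff) (s : ℝ) : Coeff :=
  proj N (timeDeriv u s + ν • stokes L (u s))

/-- `∫_{a}^{b} ‖∇ P_N (u_t - ν Δu)‖² ds`. -/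
def observedEnergy (L ν : ℝ) (N : ℕ) (u : ℝ → Coeff) (a b : ℝ) : ℝ :=
  ∫ s in a..b, normV L 1 (observed L ν N u s) ^ 2

/-- `P_N g`, with `g = w - u`. -/
def projDiff (N : ℕ) (u w : ℝ → Coeff) (s : ℝ) : Coeff := proj N (w s - u s)

/-- The right-hand side of the update formula for `β²`. -/
def updatedSq (L ν : ℝ) (u w : ℝ → Coeff) (N : ℕ) (β η a b : ℝ) : ℝ :=
  β ^ 2 + 1 / observedEnergy L ν N u a b *
    ∫ s in a..b,
      (innerV L 0 (timeDeriv (projDiff N u w) s) (observed L ν N u s)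
      + β ^ 2 * innerV L 1 (timeDeriv (projDiff N u w) s) (observed L ν N u s)
      + ν * innerV L 1 (projDiff N u w s) (observed L ν N u s)
      + ν * β ^ 2 * innerV L 1 (stokes L (projDiff N u w s)) (observed L ν N u s)
      + innerV L 0
          (proj N (bilin L (w s) (w s))
            - proj N (bilin L (w s - projDiff N u w s) (w s - projDiff N u w s)))
          (observed L ν N u s)
      + η * innerV L 0 (projDiff N u w s) (observed L ν N u s)
      + β ^ 2 * η * innerV L 1 (projDiff N u w s) (observed L ν N u s))

/-- The size conditions on `η` and `N` at one step on `[tn, tn1]`, with averaging window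
`[th, tn1]`, observation level `Nt`, initial state `wn`, current parameter `β`, average observed
energy `ζ`, and `χ = 1` at the first step, `χ = 0` later. -/
structure StepConditions (p : Constants) (f : ℝ → Coeff) (ε χ : ℝ) (wn : Coeff)
    (tn th tn1 β η ζ : ℝ) (Nt N : ℕ) : Prop where
  level : Nt ≤ N
  nudge_le : η / (N : ℝ) ^ 2 ≤ p.ν * p.l1 / 2
  nudge_ge : 27 * p.c ^ 4 * p.M1 f tn ^ 4 / (8 * p.ν ^ 3 * p.α₀ ^ 4) ≤ η
  nudge_ge' : max 1 ((√ε + p.α₁) / β)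
      * (1 / p.ν ^ (1 / 2 : ℝ) * p.M3 f tn + p.ν ^ (1 / 2 : ℝ) / p.α₀ * p.M2 f tn) * (16 / β)
    ≤ η ^ (1 / 2 : ℝ) * p.ν * p.l1 ^ (3 / 4 : ℝ)
  modes : 8 * p.c ^ 2 * p.l1 ^ (-1 / 4 : ℝ)
        / (η ^ (1 / 2 : ℝ) * β ^ 2 * ζ ^ (1 / 2 : ℝ) * (N : ℝ) ^ (1 / 2 : ℝ))
      * (p.M1 f th / p.α₀ + p.M4 f wn tn β th η / β)
      * (p.ν ^ (1 / 2 : ℝ) * p.M2 f tn / p.α₀ + p.M3 f tn / p.ν ^ (1 / 2 : ℝ))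
    ≤ ε / (4 * |p.α₁ ^ 2 - p.α₀ ^ 2| * χ + 4 * ε)
  decay : max 1 ((√ε + p.α₁) / β) * exp (-(η / 4 * (tn1 - tn))) ≤ 1 / 8
  decay_modes : 4 * p.c ^ 2 / (ζ ^ (1 / 2 : ℝ) * (N : ℝ) ^ (1 / 2 : ℝ) * β)
      * (p.M1 f th / p.α₀ + p.M4 f wn tn β th η / β) * exp (-(η / 4 * (th - tn)))
    ≤ 1 / (4 * p.ν * p.l1 ^ (1 / 2 : ℝ))
  decay_modes' : 8 * p.c ^ 2 * p.l1 ^ (-1 / 4 : ℝ)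
        / (β * ζ ^ (1 / 2 : ℝ) * (N : ℝ) ^ (1 / 2 : ℝ))
      * (p.M1 f th / p.α₀ + p.M4 f wn tn β th η / β) * exp (-(η / 4 * (th - tn)))
      * ((1 + β / p.α₀) * p.M1 f tn + p.M4 f wn tn β tn η)
    ≤ ε / 2

/-- `‖g‖ + β ‖∇g‖` for `g = w - u`. -/
def errNorm (L β : ℝ) (w u : Coeff) : ℝ := normV L 0 (w - u) + β * normV L 1 (w - u)

end Bardina

end

noncomputable section

namespace Bardina

section

/-! ### Wavenumbers -/

/-! Fix one step with parameter β and put g = w - u, D = β² - α². Writing both equations with the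
filter I + β²A and subtracting gives (I + β²A) g_t = -η (I + β²A) P_N g - νA(I + β²A) g - [B(w,w) -
B(u,u)] - D·A(u_t + νAu) (`filtered_rate_sub`). The wrong parameter acts only as a force
proportional to D. Two estimates follow.

State error. Nudging damps the modes below N, and viscosity damps the others at least as fast
because η/N² ≤ νλ₁/2. The one nonlinear term that survives, (B(g,u),g), is absorbed when η is large.
Hence the square root of ‖g‖² + β²‖∇g‖² decays like exp(-η(t - t_n)/4), up to a remainder of order
|D|/(β√η) (`energy_diff_le`, `Step.sqrt_energy_diff_le`). The force is controlled because (I +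
α²A)(u_t + νAu) = f - B(u,u), which bounds u_t + νAu in L² (`normV_proj_transported_le`).

Parameter error. The update is the difference equation tested against h = P_N(u_t + νAu) and
integrated over the window. Every linear term cancels, leaving β_{n+1}² - α² = δ⁻¹ ∫ (B(u,u) -
B(v,v), h) with v = w - P_N g (`updateIntegrand_eq`). Since v - u = (I - P_N)g has only high modes,
the right side is linear in the state error with a factor N^{-1/2} (`abs_innerV_bilin_sub_le`,
`abs_updatedSq_sub_le`).

The size conditions turn these estimates into a contraction of `totalError`, the sum of the state
error and νλ₁^{3/4}|D|: one step leaves at most 1/4 of it in the state and 1/8 in the parameter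
(`Step.errNorm_le`, `Step.parameter_le`). A separate a priori bound |β_{n+1}² - α²| ≤ ε < α₀² keeps
β positive and bounded (`Step.parameter_le_eps`). `Run.invariant` carries both through the
induction.

Solutions are weak, so energy identities are derived for the truncations P_M z, whose finitely many
coordinates are absolutely continuous. Truncation errors are controlled by ‖∇(z - P_M z)‖ and vanish
as M → ∞ (`Evolves.energy_le`). Estimates of the trilinear form are proved for trigonometric
polynomials in physical space and passed to the limit.

One constant needs care. The lower bound on η carries c⁴, whereas two uses of the L⁴ inequality
would produce c⁸. For large c an explicit Ladyzhenskaya inequality on the torus is used instead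
(`exists_abs_tri_repeated_le`); the same argument serves to show that admissible constants exist. -/

lemma kSq_nonneg (K : Fin 3 → ℤ) : 0 ≤ kSq K := Finset.sum_nonneg fun _ _ => sq_nonneg _

lemma kSq_neg (K : Fin 3 → ℤ) : kSq (-K) = kSq K := by simp [kSq]

lemma kSq_zero : kSq 0 = 0 := by simp [kSq]

lemma one_le_kSq {K : Fin 3 → ℤ} (hK : K ≠ 0) : 1 ≤ kSq K := by
  obtain ⟨i, hi⟩ := Function.ne_iff.mp hK
  have h1 : (1 : ℝ) ≤ (K i : ℝ) ^ 2 := by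
    have : (1 : ℤ) ≤ K i ^ 2 := by
      have := sq_pos_of_ne_zero (a := K i) (by simpa using hi)
      omega
    exact_mod_cast this
  exact h1.trans (Finset.single_le_sum (f := fun i => (K i : ℝ) ^ 2)
    (fun _ _ => sq_nonneg _) (Finset.mem_univ i))

lemma kSq_pos_iff {K : Fin 3 → ℤ} : 0 < kSq K ↔ K ≠ 0 := by
  constructor
  · rintro h rfl
    simp [kSq_zero] at h
  · intro h
    linarith [one_le_kSq h]

lemma lam_eq (L : ℝ) (K : Fin 3 → ℤ) : lam L K = lam1 L * kSq K := by
  unfold lam lam1; ring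

lemma lam1_pos {L : ℝ} (hL : 0 < L) : 0 < lam1 L := by unfold lam1; positivity

lemma lam1_nonneg (L : ℝ) : 0 ≤ lam1 L := by unfold lam1; positivity

lemma lam_nonneg (L : ℝ) (K : Fin 3 → ℤ) : 0 ≤ lam L K := by
  rw [lam_eq]; exact mul_nonneg (lam1_nonneg L) (kSq_nonneg K)

lemma lam_neg (L : ℝ) (K : Fin 3 → ℤ) : lam L (-K) = lam L K := by simp [lam_eq, kSq_neg]

lemma lam1_le_lam {L : ℝ} {K : Fin 3 → ℤ} (hK : K ≠ 0) : lam1 L ≤ lam L K := by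
  rw [lam_eq]; exact le_mul_of_one_le_right (lam1_nonneg L) (one_le_kSq hK)

lemma finite_modes (N : ℕ) : {K : Fin 3 → ℤ | 0 < kSq K ∧ kSq K < (N : ℝ) ^ 2}.Finite := by
  refine (Finset.finite_toSet (Fintype.piFinset fun _ : Fin 3 => Finset.Icc (-(N : ℤ)) N)).subset ?_
  rintro K ⟨-, hK⟩
  simp only [Finset.mem_coe, Fintype.mem_piFinset, Finset.mem_Icc]
  intro i
  have h1 : (K i : ℝ) ^ 2 ≤ kSq K := Finset.single_le_sum (f := fun i => (K i : ℝ) ^ 2)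
    (fun _ _ => sq_nonneg _) (Finset.mem_univ i)
  have h2 : |(K i : ℝ)| ≤ N := abs_le_of_sq_le_sq (h1.trans hK.le) (by positivity)
  have h3 := abs_le.mp h2
  exact ⟨by exact_mod_cast h3.1, by exact_mod_cast h3.2⟩

/-- The wavevectors with `0 < |K| < N`. -/
def modes (N : ℕ) : Finset (Fin 3 → ℤ) := (finite_modes N).toFinset

lemma mem_modes {N : ℕ} {K : Fin 3 → ℤ} : K ∈ modes N ↔ 0 < kSq K ∧ kSq K < (N : ℝ) ^ 2 := by
  simp [modes]

lemma mem_modes' {N : ℕ} {K : Fin 3 → ℤ} : K ∈ modes N ↔ K ≠ 0 ∧ kSq K < (N : ℝ) ^ 2 := by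
  rw [mem_modes, kSq_pos_iff]

lemma neg_mem_modes {N : ℕ} {K : Fin 3 → ℤ} : -K ∈ modes N ↔ K ∈ modes N := by
  simp [mem_modes, kSq_neg]

lemma modes_mono {M N : ℕ} (h : M ≤ N) : modes M ⊆ modes N := by
  intro K
  simp only [mem_modes]
  rintro ⟨h1, h2⟩
  exact ⟨h1, h2.trans_le (by gcongr)⟩

lemma eventually_mem_modes {K : Fin 3 → ℤ} (hK : K ≠ 0) : ∀ᶠ N in atTop, K ∈ modes N := by
  obtain ⟨n, hn⟩ := exists_nat_gt (kSq K)
  filter_upwards [eventually_ge_atTop (n + 1)] with N hN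
  rw [mem_modes']
  refine ⟨hK, ?_⟩
  have h1 : (n : ℝ) + 1 ≤ N := by exact_mod_cast hN
  have : (0 : ℝ) ≤ n := by positivity
  nlinarith

lemma proj_of_mem {N : ℕ} {K : Fin 3 → ℤ} (h : K ∈ modes N) (u : Coeff) : proj N u K = u K := by
  simp [proj, mem_modes.mp h]

lemma proj_of_notMem {N : ℕ} {K : Fin 3 → ℤ} (h : K ∉ modes N) (u : Coeff) : proj N u K = 0 := by
  rw [mem_modes] at h
  simp [proj, h]

lemma proj_sub (N : ℕ) (u v : Coeff) : proj N (u - v) = proj N u - proj N v := by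
  ext1 K; by_cases h : K ∈ modes N <;> simp [proj_of_mem, proj_of_notMem, h]

/-! ### Real, mean-free, divergence-free fields -/

/-- `u` is a formal real, mean-free, divergence-free field. -/
def IsField (u : Coeff) : Prop :=
  u 0 = 0 ∧ (∀ K i, u (-K) i = (starRingEnd ℂ) (u K i)) ∧ ∀ K, ∑ i, (K i : ℂ) * u K i = 0

lemma memV_iff {s : ℕ} {u : Coeff} :
    MemV s u ↔ IsField u ∧ Summable fun K => kSq K ^ s * ‖u K‖ ^ 2 := by
  unfold MemV IsField; tauto

lemma MemV.isField {s : ℕ} {u : Coeff} (h : MemV s u) : IsField u := (memV_iff.mp h).1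

lemma MemV.summable {s : ℕ} {u : Coeff} (h : MemV s u) :
    Summable fun K => kSq K ^ s * ‖u K‖ ^ 2 := (memV_iff.mp h).2

lemma IsField.add {u v : Coeff} (hu : IsField u) (hv : IsField v) : IsField (u + v) := by
  refine ⟨by simp [hu.1, hv.1], fun K i => by simp [hu.2.1, hv.2.1], fun K => ?_⟩
  simp [mul_add, Finset.sum_add_distrib, hu.2.2, hv.2.2]

lemma IsField.neg {u : Coeff} (hu : IsField u) : IsField (-u) := by
  refine ⟨by simp [hu.1], fun K i => by simp [hu.2.1], fun K => ?_⟩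
  simp [hu.2.2]

lemma IsField.sub {u v : Coeff} (hu : IsField u) (hv : IsField v) : IsField (u - v) := by
  rw [sub_eq_add_neg]; exact hu.add hv.neg

/-- A real even Fourier multiplier preserves fields. -/
lemma IsField.mult {u : Coeff} (hu : IsField u) {m : (Fin 3 → ℤ) → ℝ} (hm : ∀ K, m (-K) = m K) :
    IsField fun K => m K • u K := by
  refine ⟨by simp [hu.1], fun K i => by simp [hu.2.1, hm], fun K => ?_⟩
  have := hu.2.2 K
  simp only [PiLp.smul_apply, Complex.real_smul]
  calc ∑ i, (K i : ℂ) * ((m K : ℂ) * u K i) = (m K : ℂ) * ∑ i, (K i : ℂ) * u K i := by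
        rw [Finset.mul_sum]; exact Finset.sum_congr rfl fun i _ => by ring
    _ = 0 := by rw [this, mul_zero]

lemma IsField.smul {u : Coeff} (hu : IsField u) (a : ℝ) : IsField (a • u) :=
  hu.mult (m := fun _ => a) fun _ => rfl

lemma IsField.stokes {u : Coeff} (hu : IsField u) (L : ℝ) : IsField (stokes L u) := by
  have : Bardina.stokes L u = fun K => lam L K • u K := by
    ext K i; simp [Bardina.stokes]
  rw [this]
  exact hu.mult (lam_neg L)

lemma IsField.proj {u : Coeff} (hu : IsField u) (N : ℕ) : IsField (proj N u) := by
  have : Bardina.proj N u = fun K => (if K ∈ modes N then (1 : ℝ) else 0) • u K := by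
    ext1 K; by_cases h : K ∈ modes N <;> simp [proj_of_mem, proj_of_notMem, h]
  rw [this]
  exact hu.mult fun K => by simp [neg_mem_modes]

lemma MemV.mono {s : ℕ} {u v : Coeff} (hu : MemV s u) (hv : IsField v)
    (h : ∀ K, ‖v K‖ ≤ ‖u K‖) : MemV s v := by
  refine memV_iff.mpr ⟨hv, hu.summable.of_nonneg_of_le
    (fun K => mul_nonneg (pow_nonneg (kSq_nonneg K) s) (sq_nonneg _)) fun K => ?_⟩
  exact mul_le_mul_of_nonneg_left (by gcongr; exact h K) (pow_nonneg (kSq_nonneg K) s)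

lemma norm_proj_le (N : ℕ) (u : Coeff) (K : Fin 3 → ℤ) : ‖proj N u K‖ ≤ ‖u K‖ := by
  by_cases h : K ∈ modes N <;> simp [proj_of_mem, proj_of_notMem, h]

lemma norm_sub_proj_le (N : ℕ) (u : Coeff) (K : Fin 3 → ℤ) : ‖(u - proj N u) K‖ ≤ ‖u K‖ := by
  by_cases h : K ∈ modes N <;> simp [proj_of_mem, proj_of_notMem, h]

lemma MemV.proj {s : ℕ} {u : Coeff} (hu : MemV s u) (N : ℕ) : MemV s (proj N u) :=
  hu.mono (hu.isField.proj N) (norm_proj_le N u)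

lemma MemV.sub_proj {s : ℕ} {u : Coeff} (hu : MemV s u) (N : ℕ) : MemV s (u - Bardina.proj N u) :=
  hu.mono (hu.isField.sub (hu.isField.proj N)) (norm_sub_proj_le N u)

lemma MemV.add {s : ℕ} {u v : Coeff} (hu : MemV s u) (hv : MemV s v) : MemV s (u + v) := by
  refine memV_iff.mpr ⟨hu.isField.add hv.isField, ((hu.summable.mul_left 2).add
    (hv.summable.mul_left 2)).of_nonneg_of_le
    (fun K => mul_nonneg (pow_nonneg (kSq_nonneg K) s) (sq_nonneg _)) fun K => ?_⟩
  have h1 : ‖(u + v) K‖ ^ 2 ≤ 2 * ‖u K‖ ^ 2 + 2 * ‖v K‖ ^ 2 := by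
    have := norm_add_le (u K) (v K)
    have h0 : ‖(u + v) K‖ ≤ ‖u K‖ + ‖v K‖ := this
    nlinarith [sq_nonneg (‖u K‖ - ‖v K‖), norm_nonneg ((u + v) K)]
  have h2 := mul_le_mul_of_nonneg_left h1 (pow_nonneg (kSq_nonneg K) s)
  linarith

lemma MemV.neg {s : ℕ} {u : Coeff} (hu : MemV s u) : MemV s (-u) :=
  hu.mono hu.isField.neg fun K => by simp

lemma MemV.sub {s : ℕ} {u v : Coeff} (hu : MemV s u) (hv : MemV s v) : MemV s (u - v) := by
  rw [sub_eq_add_neg]; exact hu.add hv.neg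

lemma MemV.of_one {u : Coeff} (hu : MemV 1 u) : MemV 0 u := by
  refine memV_iff.mpr ⟨hu.isField, hu.summable.of_nonneg_of_le
    (fun K => mul_nonneg (pow_nonneg (kSq_nonneg K) 0) (sq_nonneg _)) fun K => ?_⟩
  by_cases hK : K = 0
  · simp [hK, hu.1]
  · have := one_le_kSq hK
    simp only [pow_zero, pow_one]
    gcongr

/-! ### Trigonometric polynomials -/

/-- `d` is a field whose modes satisfy `0 < |K| < M`. -/
def IsTrig (M : ℕ) (d : Coeff) : Prop := IsField d ∧ ∀ K, K ∉ modes M → d K = 0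

lemma IsField.isTrig_proj {u : Coeff} (hu : IsField u) (N : ℕ) : IsTrig N (Bardina.proj N u) :=
  ⟨hu.proj N, fun _ hK => proj_of_notMem hK u⟩

lemma IsTrig.mono {M N : ℕ} {d : Coeff} (hd : IsTrig M d) (h : M ≤ N) : IsTrig N d :=
  ⟨hd.1, fun K hK => hd.2 K fun hK' => hK (modes_mono h hK')⟩

lemma IsTrig.memV {M : ℕ} {d : Coeff} (hd : IsTrig M d) (s : ℕ) : MemV s d :=
  memV_iff.mpr ⟨hd.1, summable_of_ne_finset_zero (s := modes M) fun K hK => by simp [hd.2 K hK]⟩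

lemma IsTrig.proj_eq {M : ℕ} {d : Coeff} (hd : IsTrig M d) : proj M d = d := by
  ext1 K
  by_cases h : K ∈ modes M
  · exact proj_of_mem h d
  · rw [proj_of_notMem h, hd.2 K h]

lemma IsTrig.mult {M : ℕ} {d : Coeff} (hd : IsTrig M d) {m : (Fin 3 → ℤ) → ℝ}
    (hm : ∀ K, m (-K) = m K) : IsTrig M fun K => m K • d K :=
  ⟨hd.1.mult hm, fun K hK => by simp [hd.2 K hK]⟩

/-! ### Norms -/

lemma summable_lam {s : ℕ} {u : Coeff} (L : ℝ) (hu : MemV s u) :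
    Summable fun K => lam L K ^ s * ‖u K‖ ^ 2 := by
  refine (hu.summable.mul_left (lam1 L ^ s)).congr fun K => ?_
  rw [lam_eq]; ring

lemma lam_term_nonneg (L : ℝ) (s : ℕ) (u : Coeff) (K : Fin 3 → ℤ) :
    0 ≤ lam L K ^ s * ‖u K‖ ^ 2 := mul_nonneg (pow_nonneg (lam_nonneg L K) s) (sq_nonneg _)

lemma normV_nonneg (L : ℝ) (s : ℕ) (u : Coeff) : 0 ≤ normV L s u := Real.sqrt_nonneg _

lemma normV_sq {L : ℝ} (hL : 0 < L) (s : ℕ) (u : Coeff) :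
    normV L s u ^ 2 = L ^ 3 * ∑' K, lam L K ^ s * ‖u K‖ ^ 2 := by
  unfold normV
  rw [Real.sq_sqrt]
  exact mul_nonneg (by positivity) (tsum_nonneg (lam_term_nonneg L s u))

lemma normV_sq_of_support {L : ℝ} (hL : 0 < L) {M : ℕ} (s : ℕ) {u : Coeff}
    (hu : ∀ K, K ∉ modes M → u K = 0) :
    normV L s u ^ 2 = L ^ 3 * ∑ K ∈ modes M, lam L K ^ s * ‖u K‖ ^ 2 := by
  rw [normV_sq hL, tsum_eq_sum (s := modes M)]
  intro K hK
  simp [hu K hK]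

lemma normV_proj_sq {L : ℝ} (hL : 0 < L) (M s : ℕ) (u : Coeff) :
    normV L s (proj M u) ^ 2 = L ^ 3 * ∑ K ∈ modes M, lam L K ^ s * ‖u K‖ ^ 2 := by
  rw [normV_sq_of_support hL s fun K hK => proj_of_notMem hK u]
  congr 1
  exact Finset.sum_congr rfl fun K hK => by rw [proj_of_mem hK]

lemma normV_mono {L : ℝ} (hL : 0 < L) {s : ℕ} {u v : Coeff} (hu : MemV s u)
    (h : ∀ K, ‖v K‖ ≤ ‖u K‖) : normV L s v ≤ normV L s u := by
  unfold normV
  have h1 : ∀ K, lam L K ^ s * ‖v K‖ ^ 2 ≤ lam L K ^ s * ‖u K‖ ^ 2 := fun K =>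
    mul_le_mul_of_nonneg_left (by gcongr; exact h K) (pow_nonneg (lam_nonneg L K) s)
  exact Real.sqrt_le_sqrt (mul_le_mul_of_nonneg_left (((summable_lam L hu).of_nonneg_of_le
    (lam_term_nonneg L s v) h1).tsum_le_tsum h1 (summable_lam L hu)) (by positivity))

lemma normV_proj_le {L : ℝ} (hL : 0 < L) {s : ℕ} {u : Coeff} (hu : MemV s u) (N : ℕ) :
    normV L s (proj N u) ≤ normV L s u := normV_mono hL hu (norm_proj_le N u)

lemma normV_sub_proj_le {L : ℝ} (hL : 0 < L) {s : ℕ} {u : Coeff} (hu : MemV s u) (N : ℕ) :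
    normV L s (u - proj N u) ≤ normV L s u := normV_mono hL hu (norm_sub_proj_le N u)

lemma normV_neg (L : ℝ) (s : ℕ) (u : Coeff) : normV L s (-u) = normV L s u := by
  simp [normV]

lemma normV_zero (L : ℝ) (s : ℕ) : normV L s 0 = 0 := by simp [normV]

/-- The weighted coefficients, an element of `ℓ²` whose norm is `normV`. -/
def weighted (L : ℝ) (s : ℕ) (u : Coeff) : Coeff := fun K => √(L ^ 3 * lam L K ^ s) • u K

lemma norm_weighted_sq {L : ℝ} (hL : 0 < L) (s : ℕ) (u : Coeff) (K : Fin 3 → ℤ) :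
    ‖weighted L s u K‖ ^ 2 = L ^ 3 * (lam L K ^ s * ‖u K‖ ^ 2) := by
  have : 0 ≤ L ^ 3 * lam L K ^ s := mul_nonneg (by positivity) (pow_nonneg (lam_nonneg L K) s)
  rw [weighted, norm_smul, mul_pow, Real.norm_eq_abs, sq_abs, Real.sq_sqrt this]; ring

lemma memℓp_weighted {L : ℝ} (hL : 0 < L) {s : ℕ} {u : Coeff} (hu : MemV s u) :
    Memℓp (weighted L s u) 2 := by
  rw [memℓp_gen_iff (by norm_num)]
  refine ((summable_lam L hu).mul_left (L ^ 3)).congr fun K => ?_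
  rw [← norm_weighted_sq hL]
  norm_num

lemma norm_toLp_weighted {L : ℝ} (hL : 0 < L) {s : ℕ} {u : Coeff} (h : Memℓp (weighted L s u) 2) :
    ‖(⟨weighted L s u, h⟩ : lp (fun _ : Fin 3 → ℤ => EuclideanSpace ℂ (Fin 3)) 2)‖
      = normV L s u := by
  rw [lp.norm_eq_tsum_rpow (by norm_num), normV, Real.sqrt_eq_rpow, ← tsum_mul_left]
  norm_num
  congr 1
  exact tsum_congr fun K => norm_weighted_sq hL s u K

/-- Minkowski's inequality, read off from the ℓ² norm of the weighted coefficients. -/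
lemma normV_add_le {L : ℝ} (hL : 0 < L) {s : ℕ} {u v : Coeff} (hu : MemV s u) (hv : MemV s v) :
    normV L s (u + v) ≤ normV L s u + normV L s v := by
  have h : weighted L s (u + v) = weighted L s u + weighted L s v := by
    ext1 K; simp [weighted]
  rw [← norm_toLp_weighted hL (memℓp_weighted hL hu), ← norm_toLp_weighted hL (memℓp_weighted hL hv),
    ← norm_toLp_weighted hL (memℓp_weighted hL (hu.add hv))]
  refine le_trans (le_of_eq ?_) (norm_add_le _ _)
  congr 1
  exact Subtype.ext h

lemma normV_sub_le {L : ℝ} (hL : 0 < L) {s : ℕ} {u v : Coeff} (hu : MemV s u) (hv : MemV s v) :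
    normV L s (u - v) ≤ normV L s u + normV L s v := by
  rw [sub_eq_add_neg, ← normV_neg L s v]
  exact normV_add_le hL hu hv.neg

lemma abs_normV_sub_le {L : ℝ} (hL : 0 < L) {s : ℕ} {u v : Coeff} (hu : MemV s u)
    (hv : MemV s v) : |normV L s u - normV L s v| ≤ normV L s (u - v) := by
  have h1 := normV_add_le hL (hu.sub hv) hv
  have h2 := normV_add_le hL (hv.sub hu) hu
  rw [sub_add_cancel] at h1 h2
  rw [show v - u = -(u - v) by abel, normV_neg] at h2
  rw [abs_le]
  constructor <;> linarith

lemma norm_coeff_le {L : ℝ} (hL : 0 < L) {s : ℕ} {u : Coeff} (hu : MemV s u) (K : Fin 3 → ℤ) :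
    √(L ^ 3 * lam L K ^ s) * ‖u K‖ ≤ normV L s u := by
  have h := lp.norm_apply_le_norm (by norm_num)
    (⟨weighted L s u, memℓp_weighted hL hu⟩ : lp (fun _ : Fin 3 → ℤ => EuclideanSpace ℂ (Fin 3)) 2) K
  rw [norm_toLp_weighted hL] at h
  refine le_trans (le_of_eq ?_) h
  simp [weighted, norm_smul, abs_of_nonneg]

lemma tendsto_normV_sub_proj (L : ℝ) {s : ℕ} {u : Coeff} (hu : MemV s u) :
    Tendsto (fun N => normV L s (u - proj N u)) atTop (𝓝 0) := by
  have h : Tendsto (fun N : ℕ => ∑' K, lam L K ^ s * ‖(u - proj N u) K‖ ^ 2) atTop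
      (𝓝 (∑' _ : Fin 3 → ℤ, (0 : ℝ))) := by
    refine tendsto_tsum_of_dominated_convergence (summable_lam L hu) (fun K => ?_) ?_
    · refine tendsto_const_nhds.congr' ?_
      by_cases hK : K = 0
      · refine Eventually.of_forall fun N => ?_
        have : u K = 0 := hK ▸ hu.isField.1
        simp [proj, this]
      · filter_upwards [eventually_mem_modes hK] with N hN
        simp [proj_of_mem hN]
    · refine Eventually.of_forall fun N K => ?_
      rw [Real.norm_of_nonneg (lam_term_nonneg L s _ K)]
      exact mul_le_mul_of_nonneg_left (by gcongr; exact norm_sub_proj_le N u K)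
        (pow_nonneg (lam_nonneg L K) s)
  have h2 := (h.const_mul (L ^ 3)).sqrt
  simpa [normV] using h2

/-- Poincaré's inequality. -/
lemma poincare {L : ℝ} (hL : 0 < L) {s : ℕ} {u : Coeff} (hu : MemV (s + 1) u) :
    lam1 L * normV L s u ^ 2 ≤ normV L (s + 1) u ^ 2 := by
  have h1 : ∀ K, lam1 L * (lam L K ^ s * ‖u K‖ ^ 2) ≤ lam L K ^ (s + 1) * ‖u K‖ ^ 2 := fun K => by
    by_cases hK : K = 0
    · simp [hK, hu.isField.1]
    · rw [pow_succ (lam L K), mul_comm (lam L K ^ s) (lam L K), mul_assoc]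
      exact mul_le_mul_of_nonneg_right (lam1_le_lam hK) (lam_term_nonneg L s u K)
  have h2 : Summable fun K => lam1 L * (lam L K ^ s * ‖u K‖ ^ 2) :=
    (summable_lam L hu).of_nonneg_of_le
      (fun K => mul_nonneg (lam1_nonneg L) (lam_term_nonneg L s u K)) h1
  rw [normV_sq hL, normV_sq hL, mul_left_comm, ← tsum_mul_left]
  exact mul_le_mul_of_nonneg_left (h2.tsum_le_tsum h1 (summable_lam L hu)) (by positivity)

/-- Above the cutoff λ_K ≥ λ₁N², a Poincaré inequality improved by N². It drives both the damping of
the unobserved modes and the smallness of the update error. -/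
lemma normV_high_modes {L : ℝ} (hL : 0 < L) {s : ℕ} {u : Coeff} (hu : MemV (s + 1) u) (N : ℕ) :
    lam1 L * N ^ 2 * normV L s (u - proj N u) ^ 2 ≤ normV L (s + 1) (u - proj N u) ^ 2 := by
  have hv := hu.sub_proj N
  set v := u - proj N u with hvdef
  have h1 : ∀ K, lam1 L * N ^ 2 * (lam L K ^ s * ‖v K‖ ^ 2) ≤ lam L K ^ (s + 1) * ‖v K‖ ^ 2 :=
    fun K => by
    by_cases hK : K = 0
    · simp [hK, hv.isField.1]
    by_cases hN : K ∈ modes N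
    · simp [hvdef, proj_of_mem hN]
    · have hk : (N : ℝ) ^ 2 ≤ kSq K := by
        by_contra h
        exact hN (mem_modes'.mpr ⟨hK, not_le.mp h⟩)
      rw [pow_succ (lam L K), mul_comm (lam L K ^ s) (lam L K), mul_assoc (lam L K), lam_eq]
      refine mul_le_mul_of_nonneg_right (mul_le_mul_of_nonneg_left hk (lam1_nonneg L)) ?_
      rw [← lam_eq]
      exact lam_term_nonneg L s v K
  have h2 : Summable fun K => lam1 L * N ^ 2 * (lam L K ^ s * ‖v K‖ ^ 2) :=
    (summable_lam L hv).of_nonneg_of_le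
      (fun K => mul_nonneg (mul_nonneg (lam1_nonneg L) (sq_nonneg _)) (lam_term_nonneg L s v K)) h1
  rw [normV_sq hL, normV_sq hL, mul_left_comm, ← tsum_mul_left]
  exact mul_le_mul_of_nonneg_left (h2.tsum_le_tsum h1 (summable_lam L hv)) (by positivity)

/-! ### Inner products with trigonometric polynomials -/

lemma innerV_eq_sum (L : ℝ) (s : ℕ) {M : ℕ} (u : Coeff) {d : Coeff} (hd : ∀ K, K ∉ modes M → d K = 0) :
    innerV L s u d = L ^ 3 * ∑ K ∈ modes M, lam L K ^ s * (inner ℂ (d K) (u K)).re := by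
  rw [innerV, tsum_eq_sum (s := modes M)]
  intro K hK
  simp [hd K hK]

lemma innerV_add_left (L : ℝ) (s : ℕ) {M : ℕ} (u v : Coeff) {d : Coeff} (hd : IsTrig M d) :
    innerV L s (u + v) d = innerV L s u d + innerV L s v d := by
  simp only [innerV_eq_sum L s _ hd.2, ← mul_add, ← Finset.sum_add_distrib]
  simp [mul_add]

lemma innerV_sub_left (L : ℝ) (s : ℕ) {M : ℕ} (u v : Coeff) {d : Coeff} (hd : IsTrig M d) :
    innerV L s (u - v) d = innerV L s u d - innerV L s v d := by
  simp only [innerV_eq_sum L s _ hd.2, ← mul_sub, ← Finset.sum_sub_distrib]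
  simp [mul_sub]

lemma innerV_smul_left (L : ℝ) (s : ℕ) {M : ℕ} (a : ℝ) (u : Coeff) {d : Coeff} (hd : IsTrig M d) :
    innerV L s (a • u) d = a * innerV L s u d := by
  simp only [innerV_eq_sum L s _ hd.2, Finset.mul_sum]
  refine Finset.sum_congr rfl fun K _ => ?_
  have : (inner ℂ (d K) ((a • u) K)).re = a * (inner ℂ (d K) (u K)).re := by
    rw [Pi.smul_apply, ← Complex.coe_smul, inner_smul_right]
    simp
  rw [this]; ring

lemma innerV_self {L : ℝ} (hL : 0 < L) (s : ℕ) (u : Coeff) : innerV L s u u = normV L s u ^ 2 := by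
  rw [normV_sq hL, innerV]
  congr 1
  refine tsum_congr fun K => ?_
  rw [inner_self_eq_norm_sq_to_K]
  norm_cast

lemma innerV_proj_left (L : ℝ) (s : ℕ) {M N : ℕ} (h : M ≤ N) (u : Coeff) {d : Coeff}
    (hd : IsTrig M d) : innerV L s (proj N u) d = innerV L s u d := by
  simp only [innerV_eq_sum L s _ hd.2]
  congr 1
  exact Finset.sum_congr rfl fun K hK => by rw [proj_of_mem (modes_mono h hK)]

lemma innerV_stokes (L : ℝ) (s : ℕ) {M : ℕ} (u : Coeff) {d : Coeff} (hd : IsTrig M d) :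
    innerV L s (stokes L u) d = innerV L (s + 1) u d := by
  simp only [innerV_eq_sum L _ _ hd.2]
  congr 1
  refine Finset.sum_congr rfl fun K _ => ?_
  rw [stokes, inner_smul_right, Complex.re_ofReal_mul]; ring

lemma abs_innerV_le {L : ℝ} (hL : 0 < L) (s : ℕ) {M : ℕ} {u d : Coeff} (hu : MemV s u)
    (hd : IsTrig M d) : |innerV L s u d| ≤ normV L s u * normV L s d := by
  have h1 := normV_proj_le hL hu M
  refine le_trans ?_ (mul_le_mul_of_nonneg_right h1 (normV_nonneg L s d))
  refine abs_le_of_sq_le_sq ?_ (mul_nonneg (normV_nonneg _ _ _) (normV_nonneg _ _ _))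
  rw [mul_pow, normV_proj_sq hL, normV_sq_of_support hL s hd.2, innerV_eq_sum L s u hd.2, mul_pow]
  have h2 : (∑ K ∈ modes M, lam L K ^ s * (inner ℂ (d K) (u K)).re) ^ 2 ≤
      (∑ K ∈ modes M, lam L K ^ s * ‖u K‖ ^ 2) * ∑ K ∈ modes M, lam L K ^ s * ‖d K‖ ^ 2 := by
    refine Finset.sum_sq_le_sum_mul_sum_of_sq_le_mul _ (fun K _ => lam_term_nonneg L s u K)
      (fun K _ => lam_term_nonneg L s d K) fun K _ => ?_
    have h3 : |(inner ℂ (d K) (u K)).re| ≤ ‖d K‖ * ‖u K‖ :=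
      (Complex.abs_re_le_norm _).trans (norm_inner_le_norm _ _)
    have h4 : (inner ℂ (d K) (u K)).re ^ 2 ≤ (‖d K‖ * ‖u K‖) ^ 2 := by
      rw [← sq_abs]; gcongr
    have := mul_le_mul_of_nonneg_left h4 (sq_nonneg (lam L K ^ s))
    nlinarith
  have h5 : 0 ≤ (L ^ 3) ^ 2 := by positivity
  nlinarith [mul_le_mul_of_nonneg_left h2 h5]

end

section

/-! ### The nonlinear term -/

/-- The symbol `2πi z·K/L` of the directional derivative `z·∇`. -/
def symb (L : ℝ) (z : EuclideanSpace ℂ (Fin 3)) (K : Fin 3 → ℤ) : ℂ :=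
  ∑ i, z i * (2 * π * Complex.I * ((K i : ℤ) : ℂ) / (L : ℂ))

lemma advect_eq (L : ℝ) (u v : Coeff) (K : Fin 3 → ℤ) :
    advect L u v K = ∑' J, symb L (u J) (K - J) • v (K - J) := rfl

lemma symb_eq (L : ℝ) (z : EuclideanSpace ℂ (Fin 3)) (K : Fin 3 → ℤ) :
    symb L z K = 2 * π * Complex.I / L * ∑ i, (K i : ℂ) * z i := by
  rw [symb, Finset.mul_sum]
  exact Finset.sum_congr rfl fun i _ => by ring

lemma symb_neg (L : ℝ) (z : EuclideanSpace ℂ (Fin 3)) (K : Fin 3 → ℤ) :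
    symb L z (-K) = -symb L z K := by
  simp [symb_eq]

lemma symb_add (L : ℝ) (y z : EuclideanSpace ℂ (Fin 3)) (K : Fin 3 → ℤ) :
    symb L (y + z) K = symb L y K + symb L z K := by
  simp [symb_eq, mul_add, Finset.sum_add_distrib]

/-- Divergence-freeness, J·a_J = 0. This is the Fourier form of div a = 0 that makes the trilinear
form antisymmetric. -/
lemma symb_sub_self {L : ℝ} {a : Coeff} (ha : IsField a) (K J : Fin 3 → ℤ) :
    symb L (a J) (K - J) = symb L (a J) K := by
  simp [symb_eq, sub_mul, Finset.sum_sub_distrib, ha.2.2 J]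

lemma norm_dot_le (z : EuclideanSpace ℂ (Fin 3)) (K : Fin 3 → ℤ) :
    ‖∑ i, (K i : ℂ) * z i‖ ≤ √(kSq K) * ‖z‖ := by
  refine (norm_sum_le _ _).trans ?_
  rw [EuclideanSpace.norm_eq, kSq]
  have h := Real.sum_mul_le_sqrt_mul_sqrt Finset.univ (fun i => |(K i : ℝ)|) (fun i => ‖z i‖)
  simpa using h

lemma norm_symb_le {L : ℝ} (hL : 0 < L) (z : EuclideanSpace ℂ (Fin 3)) (K : Fin 3 → ℤ) :
    ‖symb L z K‖ ≤ ‖z‖ * √(lam L K) := by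
  have h : √(lam L K) = 2 * π / L * √(kSq K) := by
    rw [lam, show 4 * π ^ 2 * kSq K / L ^ 2 = (2 * π / L) ^ 2 * kSq K by ring,
      Real.sqrt_mul (sq_nonneg _), Real.sqrt_sq (by positivity)]
  have h2 : ‖2 * (π : ℂ) * Complex.I / L‖ = 2 * π / L := by
    simp [abs_of_pos hL, abs_of_pos Real.pi_pos]
  rw [symb_eq, norm_mul, h, h2]
  calc 2 * π / L * ‖∑ i, (K i : ℂ) * z i‖ ≤ 2 * π / L * (√(kSq K) * ‖z‖) := by
        gcongr; exact norm_dot_le z K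
    _ = _ := by ring

lemma summable_sq_left {a : Coeff} (ha : MemV 0 a) : Summable fun J => ‖a J‖ ^ 2 := by
  simpa using ha.summable

lemma summable_sq_right (L : ℝ) {b : Coeff} (hb : MemV 1 b) (K : Fin 3 → ℤ) :
    Summable fun J => (√(lam L (K - J)) * ‖b (K - J)‖) ^ 2 := by
  have h := (Equiv.subLeft K).summable_iff.mpr (summable_lam L hb)
  refine h.congr fun J => ?_
  simp [mul_pow, Real.sq_sqrt (lam_nonneg L _)]

lemma tsum_sq_right (L : ℝ) (b : Coeff) (K : Fin 3 → ℤ) :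
    ∑' J, (√(lam L (K - J)) * ‖b (K - J)‖) ^ 2 = ∑' J, lam L J ^ 1 * ‖b J‖ ^ 2 := by
  rw [← (Equiv.subLeft K).tsum_eq]
  refine tsum_congr fun J => ?_
  simp [mul_pow, Real.sq_sqrt (lam_nonneg L _)]

lemma norm_advect_term_le {L : ℝ} (hL : 0 < L) (a b : Coeff) (K J : Fin 3 → ℤ) :
    ‖symb L (a J) (K - J) • b (K - J)‖ ≤ ‖a J‖ * (√(lam L (K - J)) * ‖b (K - J)‖) := by
  rw [norm_smul, ← mul_assoc]
  exact mul_le_mul_of_nonneg_right (norm_symb_le hL _ _) (norm_nonneg _)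

lemma summable_advect_bound (L : ℝ) {a b : Coeff} (ha : MemV 0 a) (hb : MemV 1 b)
    (K : Fin 3 → ℤ) : Summable fun J => ‖a J‖ * (√(lam L (K - J)) * ‖b (K - J)‖) := by
  refine ((summable_sq_left ha).add (summable_sq_right L hb K)).of_nonneg_of_le
    (fun J => by positivity) fun J => ?_
  nlinarith [sq_nonneg (‖a J‖ - √(lam L (K - J)) * ‖b (K - J)‖), sq_nonneg ‖a J‖,
    sq_nonneg (√(lam L (K - J)) * ‖b (K - J)‖)]

lemma summable_advect {L : ℝ} (hL : 0 < L) {a b : Coeff} (ha : MemV 0 a) (hb : MemV 1 b)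
    (K : Fin 3 → ℤ) : Summable fun J => symb L (a J) (K - J) • b (K - J) :=
  Summable.of_norm_bounded (summable_advect_bound L ha hb K) (norm_advect_term_le hL a b K)

/-- Cauchy–Schwarz for the convolution. The bound is crude but uniform in K, and suffices for
continuity of single modes; the sharp estimates are made in physical space. -/
lemma norm_advect_le {L : ℝ} (hL : 0 < L) {a b : Coeff} (ha : MemV 0 a) (hb : MemV 1 b)
    (K : Fin 3 → ℤ) : ‖advect L a b K‖ ≤ (L ^ 3)⁻¹ * (normV L 0 a * normV L 1 b) := by
  rw [advect_eq]
  refine (tsum_of_norm_bounded (summable_advect_bound L ha hb K).hasSum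
    (norm_advect_term_le hL a b K)).trans ?_
  have h := Real.inner_le_Lp_mul_Lq_tsum_of_nonneg (p := 2) (q := 2) (f := fun J => ‖a J‖)
    (g := fun J => √(lam L (K - J)) * ‖b (K - J)‖) Real.HolderConjugate.two_two
    (fun J => norm_nonneg (a J)) (fun J => by positivity)
    (by simpa using summable_sq_left ha) (by simpa using summable_sq_right L hb K)
  refine h.trans (le_of_eq ?_)
  have e1 : ∑' J, (√(lam L (K - J)) * ‖b (K - J)‖) ^ (2 : ℝ) = ∑' J, lam L J ^ 1 * ‖b J‖ ^ 2 := by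
    rw [← tsum_sq_right L b K]; exact tsum_congr fun J => by norm_num
  have e2 : ∑' J, ‖a J‖ ^ (2 : ℝ) = ∑' J, lam L J ^ 0 * ‖a J‖ ^ 2 := tsum_congr fun J => by norm_num
  rw [e1, e2, ← Real.sqrt_eq_rpow, ← Real.sqrt_eq_rpow, normV, normV,
    Real.sqrt_mul (by positivity : (0 : ℝ) ≤ L ^ 3), Real.sqrt_mul (by positivity : (0 : ℝ) ≤ L ^ 3)]
  have h3 : √(L ^ 3) * √(L ^ 3) = L ^ 3 := Real.mul_self_sqrt (by positivity)
  have h4 : L ^ 3 ≠ 0 := by positivity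
  calc _ = (L ^ 3)⁻¹ * (L ^ 3) * (√(∑' J, lam L J ^ 0 * ‖a J‖ ^ 2)
        * √(∑' J, lam L J ^ 1 * ‖b J‖ ^ 2)) := by rw [inv_mul_cancel₀ h4, one_mul]
    _ = (L ^ 3)⁻¹ * (√(L ^ 3) * √(L ^ 3)) * (√(∑' J, lam L J ^ 0 * ‖a J‖ ^ 2)
        * √(∑' J, lam L J ^ 1 * ‖b J‖ ^ 2)) := by rw [h3]
    _ = _ := by ring

lemma advect_add_left {L : ℝ} (hL : 0 < L) {a a' b : Coeff} (ha : MemV 0 a) (ha' : MemV 0 a')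
    (hb : MemV 1 b) : advect L (a + a') b = advect L a b + advect L a' b := by
  ext1 K
  rw [Pi.add_apply, advect_eq, advect_eq, advect_eq,
    ← (summable_advect hL ha hb K).tsum_add (summable_advect hL ha' hb K)]
  exact tsum_congr fun J => by rw [Pi.add_apply, symb_add, add_smul]

lemma advect_add_right {L : ℝ} (hL : 0 < L) {a b b' : Coeff} (ha : MemV 0 a) (hb : MemV 1 b)
    (hb' : MemV 1 b') : advect L a (b + b') = advect L a b + advect L a b' := by
  ext1 K
  rw [Pi.add_apply, advect_eq, advect_eq, advect_eq,
    ← (summable_advect hL ha hb K).tsum_add (summable_advect hL ha hb' K)]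
  exact tsum_congr fun J => by rw [Pi.add_apply, smul_add]

lemma leray_add (u v : Coeff) : leray (u + v) = leray u + leray v := by
  ext1 K
  by_cases hK : K = 0
  · simp [leray, hK]
  · simp only [leray, hK, if_false, Pi.add_apply, PiLp.add_apply, mul_add, Finset.sum_add_distrib,
      add_div, add_smul]
    abel

lemma norm_leray_le (u : Coeff) (K : Fin 3 → ℤ) : ‖leray u K‖ ≤ 2 * ‖u K‖ := by
  by_cases hK : K = 0
  · simp [leray, hK]
  · have hk : 0 < kSq K := kSq_pos_iff.mpr hK
    have hn : ‖(WithLp.toLp 2 (fun i => (K i : ℂ)) : EuclideanSpace ℂ (Fin 3))‖ = √(kSq K) := by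
      rw [EuclideanSpace.norm_eq, kSq]; simp
    simp only [leray, hK, if_false]
    refine (norm_sub_le _ _).trans ?_
    rw [norm_smul, norm_div, hn, Complex.norm_real, Real.norm_of_nonneg hk.le]
    have h1 := norm_dot_le (u K) K
    have h2 : ‖∑ i, (K i : ℂ) * u K i‖ / kSq K * √(kSq K) ≤ ‖u K‖ := by
      have h3 := Real.mul_self_sqrt hk.le
      rw [div_mul_eq_mul_div, div_le_iff₀ hk]
      calc _ ≤ √(kSq K) * ‖u K‖ * √(kSq K) := by gcongr
        _ = ‖u K‖ * (√(kSq K) * √(kSq K)) := by ring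
        _ ≤ _ := by rw [h3]
    linarith

lemma leray_eq_self {u : Coeff} (hu : IsField u) : leray u = u := by
  ext1 K
  by_cases hK : K = 0
  · simp [leray, hK, hu.1]
  · simp [leray, hK, hu.2.2 K]

lemma bilin_add_left {L : ℝ} (hL : 0 < L) {a a' b : Coeff} (ha : MemV 0 a) (ha' : MemV 0 a')
    (hb : MemV 1 b) : bilin L (a + a') b = bilin L a b + bilin L a' b := by
  rw [bilin, advect_add_left hL ha ha' hb, leray_add]; rfl

lemma bilin_add_right {L : ℝ} (hL : 0 < L) {a b b' : Coeff} (ha : MemV 0 a) (hb : MemV 1 b)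
    (hb' : MemV 1 b') : bilin L a (b + b') = bilin L a b + bilin L a b' := by
  rw [bilin, advect_add_right hL ha hb hb', leray_add]; rfl

lemma bilin_sub_left {L : ℝ} (hL : 0 < L) {a a' b : Coeff} (ha : MemV 0 a) (ha' : MemV 0 a')
    (hb : MemV 1 b) : bilin L (a - a') b = bilin L a b - bilin L a' b := by
  rw [eq_sub_iff_add_eq, ← bilin_add_left hL (ha.sub ha') ha' hb, sub_add_cancel]

lemma bilin_sub_right {L : ℝ} (hL : 0 < L) {a b b' : Coeff} (ha : MemV 0 a) (hb : MemV 1 b)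
    (hb' : MemV 1 b') : bilin L a (b - b') = bilin L a b - bilin L a b' := by
  rw [eq_sub_iff_add_eq, ← bilin_add_right hL ha (hb.sub hb') hb', sub_add_cancel]

lemma norm_bilin_le {L : ℝ} (hL : 0 < L) {a b : Coeff} (ha : MemV 0 a) (hb : MemV 1 b)
    (K : Fin 3 → ℤ) : ‖bilin L a b K‖ ≤ 2 * (L ^ 3)⁻¹ * (normV L 0 a * normV L 1 b) := by
  have h1 := norm_leray_le (advect L a b) K
  have h2 := norm_advect_le hL ha hb K
  calc _ ≤ 2 * ‖advect L a b K‖ := h1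
    _ ≤ 2 * ((L ^ 3)⁻¹ * (normV L 0 a * normV L 1 b)) := by gcongr
    _ = _ := by ring

/-- The projection subtracts a multiple of K, which is orthogonal to d_K. -/
lemma inner_leray {d : Coeff} (hd : IsField d) (z : Coeff) (K : Fin 3 → ℤ) :
    inner ℂ (d K) (leray z K) = inner ℂ (d K) (z K) := by
  by_cases hK : K = 0
  · simp [hK, hd.1]
  · simp only [leray, hK, if_false, inner_sub_right, inner_smul_right]
    have : inner ℂ (d K) (WithLp.toLp 2 (fun i => (K i : ℂ)) : EuclideanSpace ℂ (Fin 3)) = 0 := by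
      rw [← inner_conj_symm, map_eq_zero, PiLp.inner_apply]
      simpa [mul_comm] using hd.2.2 K
    rw [this]; simp

/-! ### The trilinear form -/

/-- The trilinear form `(B(a,b),d)`. -/
def tri (L : ℝ) (a b d : Coeff) : ℝ := innerV L 0 (bilin L a b) d

lemma tri_eq_sum (L : ℝ) (a b : Coeff) {M : ℕ} {d : Coeff} (hd : IsTrig M d) :
    tri L a b d = L ^ 3 * (∑ K ∈ modes M, inner ℂ (d K) (advect L a b K)).re := by
  rw [tri, innerV_eq_sum L 0 _ hd.2, Complex.re_sum]
  congr 1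
  exact Finset.sum_congr rfl fun K _ => by rw [bilin, inner_leray hd.1]; simp

lemma inner_eq_sum_neg {d : Coeff} (hd : IsField d) (K : Fin 3 → ℤ) (z : EuclideanSpace ℂ (Fin 3)) :
    inner ℂ (d K) z = ∑ i, d (-K) i * z i := by
  rw [PiLp.inner_apply]
  exact Finset.sum_congr rfl fun i _ => by rw [hd.2.1]; simp [mul_comm]

/-- The order of summation is exchanged so that J, the mode of the advecting field, stays fixed
while K is reflected; this reflection is the integration by parts. -/
lemma sum_inner_advect {L : ℝ} (hL : 0 < L) {M : ℕ} {a b d : Coeff} (ha : MemV 0 a)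
    (hb : MemV 1 b) (hd : IsTrig M d) :
    ∑ K ∈ modes M, inner ℂ (d K) (advect L a b K) =
      ∑' J, ∑' K, symb L (a J) K * ∑ i, d (-K) i * b (K - J) i := by
  have h1 : ∀ K, inner ℂ (d K) (advect L a b K) =
      ∑' J, symb L (a J) K * ∑ i, d (-K) i * b (K - J) i := fun K => by
    rw [advect_eq, ← innerSL_apply_apply ℂ (d K), ContinuousLinearMap.map_tsum _
      (summable_advect hL ha hb K)]
    refine tsum_congr fun J => ?_
    rw [innerSL_apply_apply, inner_smul_right, inner_eq_sum_neg hd.1, symb_sub_self ha.isField]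
  have h2 : ∀ K, Summable fun J => symb L (a J) K * ∑ i, d (-K) i * b (K - J) i := fun K => by
    have := (innerSL ℂ (d K)).summable (summable_advect hL ha hb K)
    refine this.congr fun J => ?_
    rw [innerSL_apply_apply, inner_smul_right, inner_eq_sum_neg hd.1, symb_sub_self ha.isField]
  simp only [h1]
  rw [← Summable.tsum_finsetSum fun K _ => h2 K]
  refine tsum_congr fun J => ?_
  rw [tsum_eq_sum (s := modes M)]
  intro K hK
  have : d (-K) = 0 := hd.2 _ fun h => hK (neg_mem_modes.mp h)
  simp [this]

/-- Antisymmetry of the trilinear form. -/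
lemma tri_antisymm {L : ℝ} (hL : 0 < L) {M : ℕ} {a b d : Coeff} (ha : MemV 0 a)
    (hb : IsTrig M b) (hd : IsTrig M d) : tri L a b d = -tri L a d b := by
  rw [tri_eq_sum L a b hd, tri_eq_sum L a d hb, sum_inner_advect hL ha (hb.memV 1) hd,
    sum_inner_advect hL ha (hd.memV 1) hb, ← mul_neg, ← Complex.neg_re, ← tsum_neg]
  congr 3
  ext1 J
  -- Under K ↦ J - K the roles of b and d are exchanged, and the symbol changes sign because it is
  -- odd and a_J·J = 0.
  rw [← (Equiv.subLeft J).tsum_eq, ← tsum_neg]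
  refine tsum_congr fun K => ?_
  rw [Equiv.subLeft_apply, show J - K = -(K - J) by abel, symb_neg, symb_sub_self ha.isField,
    neg_neg, show -(K - J) - J = -K by abel, neg_mul]
  congr 2
  exact Finset.sum_congr rfl fun i _ => mul_comm _ _

lemma tri_self {L : ℝ} (hL : 0 < L) {M : ℕ} {a d : Coeff} (ha : MemV 0 a) (hd : IsTrig M d) :
    tri L a d d = 0 := by
  have := tri_antisymm hL ha hd hd
  linarith

lemma tri_add_left {L : ℝ} (hL : 0 < L) {M : ℕ} {a a' b d : Coeff} (ha : MemV 0 a)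
    (ha' : MemV 0 a') (hb : MemV 1 b) (hd : IsTrig M d) :
    tri L (a + a') b d = tri L a b d + tri L a' b d := by
  rw [tri, bilin_add_left hL ha ha' hb, innerV_add_left L 0 _ _ hd]; rfl

lemma tri_add_mid {L : ℝ} (hL : 0 < L) {M : ℕ} {a b b' d : Coeff} (ha : MemV 0 a)
    (hb : MemV 1 b) (hb' : MemV 1 b') (hd : IsTrig M d) :
    tri L a (b + b') d = tri L a b d + tri L a b' d := by
  rw [tri, bilin_add_right hL ha hb hb', innerV_add_left L 0 _ _ hd]; rfl

/-- With a trigonometric polynomial as test field only finitely many modes of B(a,b) matter, and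
each depends continuously on a in L² and b in V. -/
lemma tendsto_tri_proj {L : ℝ} (hL : 0 < L) {M : ℕ} {a b d : Coeff} (ha : MemV 0 a)
    (hb : MemV 1 b) (hd : IsTrig M d) :
    Tendsto (fun m => tri L (proj m a) (proj m b) d) atTop (𝓝 (tri L a b d)) := by
  have h1 : ∀ K, Tendsto (fun m => bilin L (proj m a) (proj m b) K) atTop (𝓝 (bilin L a b K)) := by
    intro K
    rw [tendsto_iff_norm_sub_tendsto_zero]
    have hb1 : ∀ m, ‖bilin L (proj m a) (proj m b) K - bilin L a b K‖ ≤
        2 * (L ^ 3)⁻¹ * (normV L 0 (a - proj m a) * normV L 1 b) +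
        2 * (L ^ 3)⁻¹ * (normV L 0 a * normV L 1 (b - proj m b)) := fun m => by
      have e1 := congrFun (bilin_sub_left hL ha (ha.proj m) (hb.proj m)) K
      have e2 := congrFun (bilin_sub_right hL ha hb (hb.proj m)) K
      have e : bilin L (proj m a) (proj m b) K - bilin L a b K =
          -(bilin L (a - proj m a) (proj m b) K) - bilin L a (b - proj m b) K := by
        rw [e1, e2]; simp
      rw [e]
      refine (norm_sub_le _ _).trans ?_
      rw [norm_neg]
      gcongr
      · refine (norm_bilin_le hL (ha.sub_proj m) (hb.proj m) K).trans ?_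
        have := normV_proj_le hL hb m
        have := normV_nonneg L 0 (a - proj m a)
        gcongr
      · exact norm_bilin_le hL ha (hb.sub_proj m) K
    refine squeeze_zero (fun _ => norm_nonneg _) hb1 ?_
    have t1 := ((tendsto_normV_sub_proj L ha).mul_const (normV L 1 b)).const_mul (2 * (L ^ 3)⁻¹)
    have t2 := ((tendsto_normV_sub_proj L hb).const_mul (normV L 0 a)).const_mul (2 * (L ^ 3)⁻¹)
    simpa using t1.add t2
  simp only [tri, innerV_eq_sum L 0 _ hd.2]
  refine Tendsto.const_mul _ (tendsto_finsetSum _ fun K _ => Tendsto.const_mul _ ?_)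
  exact (Complex.continuous_re.tendsto _).comp (tendsto_const_nhds.inner (h1 K))

end

section

/-! ### Trigonometric polynomials in physical space -/

/-- The exponential `exp(2πi K·x/L)`. -/
def expo (L : ℝ) (K : Fin 3 → ℤ) (x : Fin 3 → ℝ) : ℂ :=
  Complex.exp (2 * π * Complex.I * (∑ j, (K j : ℂ) * (x j : ℂ)) / (L : ℂ))

lemma expo_add (L : ℝ) (J K : Fin 3 → ℤ) (x : Fin 3 → ℝ) :
    expo L (J + K) x = expo L J x * expo L K x := by
  rw [expo, expo, expo, ← Complex.exp_add]
  congr 1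
  simp only [Pi.add_apply, Int.cast_add, add_mul, Finset.sum_add_distrib]
  ring

lemma expo_neg (L : ℝ) (K : Fin 3 → ℤ) (x : Fin 3 → ℝ) :
    expo L (-K) x = (starRingEnd ℂ) (expo L K x) := by
  rw [expo, expo, ← Complex.exp_conj]
  congr 1
  simp [map_sum, Complex.conj_ofNat]

lemma continuous_expo (L : ℝ) (K : Fin 3 → ℤ) : Continuous (expo L K) := by
  unfold expo
  fun_prop

lemma expo_eq_prod (L : ℝ) (K : Fin 3 → ℤ) (x : Fin 3 → ℝ) :
    expo L K x = ∏ j, Complex.exp ((2 * π * Complex.I * K j / L) * x j) := by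
  rw [expo, ← Complex.exp_sum]
  congr 1
  rw [Finset.mul_sum, Finset.sum_div]
  exact Finset.sum_congr rfl fun j _ => by ring

lemma integral_exp_period {L : ℝ} (hL : 0 < L) (k m n : ℤ) (hmn : m ≤ n) :
    ∫ x : ℝ in Icc (m * L) (n * L), Complex.exp ((2 * π * Complex.I * k / L) * x) =
      if k = 0 then (((n - m) * L : ℝ) : ℂ) else 0 := by
  have hle : (m : ℝ) * L ≤ n * L := by
    have : (m : ℝ) ≤ n := by exact_mod_cast hmn
    gcongr
  have hL' : (L : ℂ) ≠ 0 := by exact_mod_cast hL.ne'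
  rw [integral_Icc_eq_integral_Ioc, ← intervalIntegral.integral_of_le hle]
  split_ifs with hk
  · simp [hk]; ring
  · have hk' : (k : ℂ) ≠ 0 := by exact_mod_cast hk
    have hc : 2 * (π : ℂ) * Complex.I * k / L ≠ 0 := by
      have := Complex.two_pi_I_ne_zero
      exact div_ne_zero (mul_ne_zero this hk') hL'
    rw [integral_exp_mul_complex hc]
    have h : ∀ l : ℤ, Complex.exp (2 * π * Complex.I * k / L * ((l * L : ℝ) : ℂ)) = 1 := fun l => by
      rw [Complex.exp_eq_one_iff]
      refine ⟨k * l, ?_⟩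
      push_cast
      field_simp
    rw [h, h, sub_self, zero_div]

/-- The cube `[mL,nL]³`. -/
def bigCube (L : ℝ) (m n : ℤ) : Set (Fin 3 → ℝ) := Icc (fun _ => m * L) (fun _ => n * L)

lemma cube_eq (L : ℝ) : cube L = bigCube L 0 1 := by
  simp [cube, bigCube, Pi.zero_def]

lemma isCompact_bigCube (L : ℝ) (m n : ℤ) : IsCompact (bigCube L m n) := isCompact_Icc

lemma integral_expo {L : ℝ} (hL : 0 < L) (K : Fin 3 → ℤ) (m n : ℤ) (hmn : m ≤ n) :
    ∫ x in bigCube L m n, expo L K x = if K = 0 then ((((n - m) * L) ^ 3 : ℝ) : ℂ) else 0 := by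
  have h : (volume : Measure (Fin 3 → ℝ)).restrict (bigCube L m n) =
      Measure.pi fun _ => (volume : Measure ℝ).restrict (Icc (m * L) (n * L)) := by
    rw [bigCube, ← Set.pi_univ_Icc, volume_pi, Measure.restrict_pi_pi]
  simp only [expo_eq_prod]
  rw [h, integral_fintype_prod_eq_prod (𝕜 := ℂ)
    (f := fun j (y : ℝ) => Complex.exp ((2 * π * Complex.I * K j / L) * y))]
  simp only [integral_exp_period hL _ m n hmn]
  split_ifs with hK
  · simp [hK, Finset.prod_const]
  · obtain ⟨j, hj⟩ := Function.ne_iff.mp hK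
    exact Finset.prod_eq_zero (Finset.mem_univ j) (if_neg hj)

/-- The trigonometric polynomial with coefficients `c`. -/
def spoly (L : ℝ) (M : ℕ) (c : (Fin 3 → ℤ) → ℂ) (x : Fin 3 → ℝ) : ℂ :=
  ∑ K ∈ modes M, c K * expo L K x

lemma continuous_spoly (L : ℝ) (M : ℕ) (c : (Fin 3 → ℤ) → ℂ) : Continuous (spoly L M c) :=
  continuous_finsetSum _ fun K _ => continuous_const.mul (continuous_expo L K)

lemma spoly_re {L : ℝ} {M : ℕ} {c : (Fin 3 → ℤ) → ℂ} (hc : ∀ K, c (-K) = (starRingEnd ℂ) (c K))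
    (x : Fin 3 → ℝ) : ((spoly L M c x).re : ℂ) = spoly L M c x := by
  rw [← Complex.conj_eq_iff_re]
  simp only [spoly, map_sum, map_mul, ← hc, ← expo_neg]
  exact Finset.sum_nbij' (fun K => -K) (fun K => -K) (fun K hK => neg_mem_modes.mpr hK)
    (fun K hK => neg_mem_modes.mpr hK) (fun K _ => neg_neg K) (fun K _ => neg_neg K) fun K _ => rfl

lemma integral_spoly_mul_expo {L : ℝ} (hL : 0 < L) (M : ℕ) (c : (Fin 3 → ℤ) → ℂ)
    (K : Fin 3 → ℤ) (m n : ℤ) (hmn : m ≤ n) :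
    ∫ x in bigCube L m n, spoly L M c x * expo L K x =
      (((n - m) * L) ^ 3 : ℝ) * if -K ∈ modes M then c (-K) else 0 := by
  simp only [spoly, Finset.sum_mul]
  rw [integral_finsetSum]
  · simp only [mul_assoc, ← expo_add, integral_const_mul, integral_expo hL _ m n hmn]
    rw [← Finset.sum_ite_eq' (modes M) (-K), Finset.mul_sum]
    refine Finset.sum_congr rfl fun J _ => ?_
    simp only [add_eq_zero_iff_eq_neg]
    split_ifs with h
    · rw [h, mul_comm]
    · simp
  · intro J _
    exact ((continuous_const.mul (continuous_expo L J)).mul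
      (continuous_expo L K)).continuousOn.integrableOn_compact (isCompact_bigCube L m n)

lemma integral_spoly_mul_spoly {L : ℝ} (hL : 0 < L) (M : ℕ) (c c' : (Fin 3 → ℤ) → ℂ)
    (m n : ℤ) (hmn : m ≤ n) :
    ∫ x in bigCube L m n, spoly L M c x * spoly L M c' x =
      (((n - m) * L) ^ 3 : ℝ) * ∑ K ∈ modes M, c (-K) * c' K := by
  have : ∀ x, spoly L M c x * spoly L M c' x = ∑ K ∈ modes M, c' K * (spoly L M c x * expo L K x) :=
    fun x => by
    rw [spoly.eq_def L M c', Finset.mul_sum]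
    exact Finset.sum_congr rfl fun K _ => by ring
  simp only [this]
  rw [integral_finsetSum]
  · simp only [integral_const_mul, integral_spoly_mul_expo hL M c _ m n hmn]
    rw [Finset.mul_sum]
    refine Finset.sum_congr rfl fun K hK => ?_
    rw [if_pos (neg_mem_modes.mpr hK)]; ring
  · intro J _
    exact (continuous_const.mul ((continuous_spoly L M c).mul
      (continuous_expo L J))).continuousOn.integrableOn_compact (isCompact_bigCube L m n)

lemma integral_spoly_mul_mul {L : ℝ} (hL : 0 < L) (M : ℕ) (c₁ c₂ c₃ : (Fin 3 → ℤ) → ℂ)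
    (h₂ : ∀ K, K ∉ modes M → c₂ K = 0) :
    ∫ x in cube L, spoly L M c₁ x * spoly L M c₂ x * spoly L M c₃ x =
      (L ^ 3 : ℝ) * ∑ K ∈ modes M, ∑ J ∈ modes M, c₁ J * c₂ (K - J) * c₃ (-K) := by
  have : ∀ x, spoly L M c₁ x * spoly L M c₂ x * spoly L M c₃ x =
      ∑ K ∈ modes M, ∑ J ∈ modes M, c₁ J * c₃ (-K) * (spoly L M c₂ x * expo L (J - K) x) :=
    fun x => by
    have e : spoly L M c₃ x = ∑ K ∈ modes M, c₃ (-K) * expo L (-K) x :=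
      Finset.sum_nbij' (fun K => -K) (fun K => -K) (fun K hK => neg_mem_modes.mpr hK)
        (fun K hK => neg_mem_modes.mpr hK) (fun K _ => neg_neg K) (fun K _ => neg_neg K)
        fun K _ => by rw [neg_neg]
    rw [e, spoly.eq_def L M c₁, Finset.mul_sum]
    refine Finset.sum_congr rfl fun K _ => ?_
    rw [Finset.sum_mul, Finset.sum_mul]
    refine Finset.sum_congr rfl fun J _ => ?_
    rw [sub_eq_add_neg, expo_add]; ring
  have hi : ∀ K J, IntegrableOn (fun x => c₁ J * c₃ (-K) * (spoly L M c₂ x * expo L (J - K) x))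
      (bigCube L 0 1) := fun K J =>
    (continuous_const.mul ((continuous_spoly L M c₂).mul
      (continuous_expo L (J - K)))).continuousOn.integrableOn_compact (isCompact_bigCube L 0 1)
  simp only [this, cube_eq]
  rw [integral_finsetSum _ fun K _ => integrable_finsetSum _ fun J _ => hi K J, Finset.mul_sum]
  refine Finset.sum_congr rfl fun K _ => ?_
  rw [integral_finsetSum _ fun J _ => hi K J, Finset.mul_sum]
  refine Finset.sum_congr rfl fun J _ => ?_
  rw [integral_const_mul, integral_spoly_mul_expo hL M c₂ _ 0 1 zero_le_one, neg_sub]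
  split_ifs with h
  · simp; ring
  -- K - J may leave the truncation range even though K and J lie in it; vanishing of c₂ there keeps
  -- the double sum exact.
  · rw [h₂ _ h]; simp

/-- The vector field with Fourier coefficients `d`, for a trigonometric polynomial `d`. -/
def field (L : ℝ) (M : ℕ) (d : Coeff) (x : Fin 3 → ℝ) : EuclideanSpace ℝ (Fin 3) :=
  WithLp.toLp 2 fun i => (spoly L M (fun K => d K i) x).re

/-- The gradient of the vector field with Fourier coefficients `d`. -/
def gradField (L : ℝ) (M : ℕ) (d : Coeff) (x : Fin 3 → ℝ) : EuclideanSpace ℝ (Fin 3 × Fin 3) :=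
  WithLp.toLp 2 fun p => (spoly L M (fun K => 2 * π * Complex.I * (K p.1 : ℂ) / L * d K p.2) x).re

lemma continuous_field (L : ℝ) (M : ℕ) (d : Coeff) : Continuous (field L M d) := by
  unfold field
  have := fun i => continuous_spoly L M fun K => d K i
  fun_prop

lemma continuous_gradField (L : ℝ) (M : ℕ) (d : Coeff) : Continuous (gradField L M d) := by
  unfold gradField
  have := fun p : Fin 3 × Fin 3 =>
    continuous_spoly L M fun K => 2 * π * Complex.I * (K p.1 : ℂ) / L * d K p.2
  fun_prop

lemma field_apply {M : ℕ} (L : ℝ) {d : Coeff} (hd : IsField d) (x : Fin 3 → ℝ) (i : Fin 3) :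
    ((field L M d x i : ℝ) : ℂ) = spoly L M (fun K => d K i) x :=
  spoly_re (fun K => hd.2.1 K i) x

lemma gradField_apply {M : ℕ} (L : ℝ) {d : Coeff} (hd : IsField d) (x : Fin 3 → ℝ)
    (p : Fin 3 × Fin 3) : ((gradField L M d x p : ℝ) : ℂ) =
      spoly L M (fun K => 2 * π * Complex.I * (K p.1 : ℂ) / L * d K p.2) x :=
  spoly_re (fun K => by simp [hd.2.1 K, Complex.conj_ofNat]) x

lemma realizes_field {L : ℝ} (hL : 0 < L) {M : ℕ} {d : Coeff} (hd : IsTrig M d) :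
    Realizes L (field L M d) d := by
  have hc : IsCompact (cube L) := isCompact_Icc
  refine ⟨?_, fun K i => ?_⟩
  · have : IsFiniteMeasure (volume.restrict (cube L)) := ⟨by
      simpa using hc.measure_lt_top⟩
    obtain ⟨C, hC⟩ := hc.exists_bound_of_continuousOn (continuous_field L M d).continuousOn
    exact MemLp.of_bound (continuous_field L M d).aestronglyMeasurable C
      ((ae_restrict_iff' measurableSet_Icc).mpr (Eventually.of_forall hC))
  · have h1 : ∀ x, (field L M d x i : ℂ) * Complex.exp (-(2 * π * Complex.I *
        (∑ j, (K j : ℂ) * (x j : ℂ)) / (L : ℂ))) = spoly L M (fun K => d K i) x * expo L (-K) x :=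
      fun x => by
      rw [field_apply L hd.1, expo]
      congr 2
      simp; ring
    simp only [h1]
    have hL' : (L : ℂ) ≠ 0 := by exact_mod_cast hL.ne'
    rw [cube_eq, integral_spoly_mul_expo hL M _ (-K) 0 1 zero_le_one, neg_neg]
    split_ifs with h
    · simp; field_simp
    · simp [hd.2 K h]

lemma isFiniteMeasure_bigCube (L : ℝ) (m n : ℤ) :
    IsFiniteMeasure (volume.restrict (bigCube L m n)) := ⟨by
  simpa using (isCompact_bigCube L m n).measure_lt_top⟩

lemma memLp_bigCube {E : Type*} [NormedAddCommGroup E] {φ : (Fin 3 → ℝ) → E}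
    [SecondCountableTopologyEither (Fin 3 → ℝ) E] (hφ : Continuous φ) (L : ℝ) (m n : ℤ) (q : ENNReal) :
    MemLp φ q (volume.restrict (bigCube L m n)) := by
  have := isFiniteMeasure_bigCube L m n
  obtain ⟨C, hC⟩ := (isCompact_bigCube L m n).exists_bound_of_continuousOn hφ.continuousOn
  exact MemLp.of_bound hφ.aestronglyMeasurable C
    ((ae_restrict_iff' measurableSet_Icc).mpr (Eventually.of_forall hC))

lemma integral_spoly_re_sq {L : ℝ} (hL : 0 < L) {M : ℕ} {c : (Fin 3 → ℤ) → ℂ}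
    (hc : ∀ K, c (-K) = (starRingEnd ℂ) (c K)) (m n : ℤ) (hmn : m ≤ n) :
    ∫ x in bigCube L m n, (spoly L M c x).re ^ 2 =
      ((n - m) * L) ^ 3 * ∑ K ∈ modes M, ‖c K‖ ^ 2 := by
  have h := integral_spoly_mul_spoly hL M c c m n hmn
  have h' : ∀ x, spoly L M c x * spoly L M c x = (((spoly L M c x).re ^ 2 : ℝ) : ℂ) := fun x => by
    rw [← sq, Complex.ofReal_pow, spoly_re hc]
  simp only [h'] at h
  rw [integral_complex_ofReal] at h
  apply Complex.ofReal_injective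
  rw [h]
  push_cast
  congr 1
  refine Finset.sum_congr rfl fun K _ => ?_
  rw [hc, mul_comm, Complex.mul_conj, Complex.normSq_eq_norm_sq]
  push_cast; ring

lemma eLpNorm_two_bigCube {ι : Type*} [Fintype ι] {L : ℝ} (hL : 0 < L) {M : ℕ}
    {c : ι → (Fin 3 → ℤ) → ℂ} (hc : ∀ i K, c i (-K) = (starRingEnd ℂ) (c i K)) (m n : ℤ)
    (hmn : m ≤ n) :
    eLpNorm (fun x => (WithLp.toLp 2 fun i => (spoly L M (c i) x).re : EuclideanSpace ℝ ι)) 2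
      (volume.restrict (bigCube L m n)) =
      ENNReal.ofReal √(((n - m) * L) ^ 3 * ∑ K ∈ modes M, ∑ i, ‖c i K‖ ^ 2) := by
  have hcont : ∀ i, Continuous fun x => (spoly L M (c i) x).re := fun i =>
    Complex.continuous_re.comp (continuous_spoly L M (c i))
  have hcont' : Continuous fun x =>
      (WithLp.toLp 2 fun i => (spoly L M (c i) x).re : EuclideanSpace ℝ ι) := by fun_prop
  rw [MemLp.eLpNorm_eq_integral_rpow_norm (by norm_num) (by norm_num)
    (memLp_bigCube hcont' L m n 2), Real.sqrt_eq_rpow]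
  norm_num
  congr 2
  simp only [EuclideanSpace.norm_sq_eq, Real.norm_eq_abs, sq_abs]
  rw [integral_finsetSum]
  · simp only [integral_spoly_re_sq hL (hc _) m n hmn]
    rw [Finset.sum_comm, Finset.mul_sum]
  · intro i _
    exact ((hcont i).pow 2).continuousOn.integrableOn_compact (isCompact_bigCube L m n)

lemma eLpNorm_field {L : ℝ} (hL : 0 < L) {M : ℕ} {d : Coeff} (hd : IsTrig M d) (m n : ℤ)
    (hmn : m ≤ n) : eLpNorm (field L M d) 2 (volume.restrict (bigCube L m n)) =
      ENNReal.ofReal (√((n - m) ^ 3) * normV L 0 d) := by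
  have h0 : (0 : ℝ) ≤ (n - m) ^ 3 := by
    have : (m : ℝ) ≤ n := by exact_mod_cast hmn
    have : (0 : ℝ) ≤ n - m := by linarith
    positivity
  have := eLpNorm_two_bigCube (M := M) (c := fun i K => d K i) hL (fun i K => hd.1.2.1 K i) m n hmn
  refine this.trans ?_
  rw [← Real.sqrt_sq (normV_nonneg L 0 d), ← Real.sqrt_mul h0, normV_sq_of_support hL 0 hd.2]
  congr 2
  simp only [EuclideanSpace.norm_sq_eq, pow_zero, one_mul]
  ring

lemma eLpNorm_gradField {L : ℝ} (hL : 0 < L) {M : ℕ} {d : Coeff} (hd : IsTrig M d) (m n : ℤ)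
    (hmn : m ≤ n) : eLpNorm (gradField L M d) 2 (volume.restrict (bigCube L m n)) =
      ENNReal.ofReal (√((n - m) ^ 3) * normV L 1 d) := by
  have h0 : (0 : ℝ) ≤ (n - m) ^ 3 := by
    have : (m : ℝ) ≤ n := by exact_mod_cast hmn
    have : (0 : ℝ) ≤ n - m := by linarith
    positivity
  have := eLpNorm_two_bigCube (M := M)
    (c := fun (p : Fin 3 × Fin 3) K => 2 * π * Complex.I * (K p.1 : ℂ) / L * d K p.2) hL
    (fun p K => by simp [hd.1.2.1 K, Complex.conj_ofNat]) m n hmn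
  refine this.trans ?_
  rw [← Real.sqrt_sq (normV_nonneg L 1 d), ← Real.sqrt_mul h0, normV_sq_of_support hL 1 hd.2]
  congr 2
  rw [mul_pow, mul_assoc]
  congr 2
  refine Finset.sum_congr rfl fun K _ => ?_
  rw [Fintype.sum_prod_type, EuclideanSpace.norm_sq_eq, lam, kSq, pow_one]
  simp only [norm_mul, norm_div, mul_pow, div_pow, ← Finset.mul_sum]
  rw [← Finset.sum_mul]
  congr 1
  rw [Finset.mul_sum, Finset.sum_div]
  refine Finset.sum_congr rfl fun i _ => ?_
  simp
  ring

/-- Passage to physical space, where Hölder's inequality and the Gagliardo–Nirenberg bounds apply.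
-/
lemma tri_eq_integral {L : ℝ} (hL : 0 < L) {M : ℕ} {a b d : Coeff} (ha : IsTrig M a)
    (hb : IsTrig M b) (hd : IsTrig M d) :
    tri L a b d = ∫ x in cube L,
      ∑ i, ∑ j, field L M a x i * gradField L M b x (i, j) * field L M d x j := by
  rw [tri_eq_sum L a b hd]
  set g : Fin 3 → Fin 3 → (Fin 3 → ℤ) → ℂ :=
    fun i j K => 2 * π * Complex.I * (K i : ℂ) / L * b K j with hg
  have hi : ∀ i j, IntegrableOn (fun x => spoly L M (fun K => a K i) x * spoly L M (g i j) x *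
      spoly L M (fun K => d K j) x) (cube L) := fun i j =>
    (((continuous_spoly L M _).mul (continuous_spoly L M _)).mul
      (continuous_spoly L M _)).continuousOn.integrableOn_compact isCompact_Icc
  have h2 : ((∫ x in cube L, ∑ i, ∑ j,
      field L M a x i * gradField L M b x (i, j) * field L M d x j : ℝ) : ℂ) =
      (L ^ 3 : ℝ) * ∑ K ∈ modes M, inner ℂ (d K) (advect L a b K) := by
    rw [← integral_complex_ofReal]
    simp only [Complex.ofReal_sum, Complex.ofReal_mul, field_apply L ha.1, field_apply L hd.1,
      gradField_apply L hb.1]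
    rw [integral_finsetSum _ fun i _ => integrable_finsetSum _ fun j _ => hi i j]
    rw [Finset.sum_congr rfl fun i _ => integral_finsetSum _ fun j _ => hi i j]
    have h3 : ∀ i j, ∫ x in cube L, spoly L M (fun K => a K i) x * spoly L M (g i j) x *
        spoly L M (fun K => d K j) x = (L ^ 3 : ℝ) * ∑ K ∈ modes M, ∑ J ∈ modes M,
          a J i * g i j (K - J) * d (-K) j := fun i j =>
      integral_spoly_mul_mul hL M _ _ _ fun K hK => by simp [hg, hb.2 K hK]
    rw [Finset.sum_congr rfl fun i _ => Finset.sum_congr rfl fun j _ => h3 i j]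
    simp only [← Finset.mul_sum]
    congr 1
    have e1 : ∀ K, inner ℂ (d K) (advect L a b K) = ∑ J ∈ modes M,
        ∑ i, ∑ j, a J i * (2 * π * Complex.I * ((K - J) i : ℂ) / L * b (K - J) j) * d (-K) j := by
      intro K
      rw [advect_eq, tsum_eq_sum (s := modes M) fun J hJ => by simp [ha.2 J hJ, symb], inner_sum]
      refine Finset.sum_congr rfl fun J _ => ?_
      rw [inner_smul_right, inner_eq_sum_neg hd.1, symb, Finset.sum_mul_sum]
      exact Finset.sum_congr rfl fun i _ => Finset.sum_congr rfl fun j _ => by ring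
    simp only [e1]
    rw [Finset.sum_congr rfl fun i _ => Finset.sum_comm, Finset.sum_comm]
    refine Finset.sum_congr rfl fun K _ => ?_
    rw [Finset.sum_congr rfl fun i _ => Finset.sum_comm, Finset.sum_comm]
  rw [← Complex.re_ofReal_mul, ← h2, Complex.ofReal_re]

/-- Cauchy–Schwarz between the tensor a ⊗ d and B in the Frobenius norm, so that no dimensional
constant is lost. -/
lemma abs_contraction_le (a d : EuclideanSpace ℝ (Fin 3)) (B : EuclideanSpace ℝ (Fin 3 × Fin 3)) :
    |∑ i, ∑ j, a i * B (i, j) * d j| ≤ ‖a‖ * ‖d‖ * ‖B‖ := by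
  refine abs_le_of_sq_le_sq ?_ (by positivity)
  rw [mul_pow, mul_pow, EuclideanSpace.norm_sq_eq, EuclideanSpace.norm_sq_eq,
    EuclideanSpace.norm_sq_eq]
  have h := Finset.sum_mul_sq_le_sq_mul_sq (Finset.univ : Finset (Fin 3 × Fin 3))
    (fun p => a p.1 * d p.2) (fun p => B p)
  simp only [Real.norm_eq_abs, sq_abs]
  rw [Finset.sum_mul_sum]
  refine le_trans (le_of_eq ?_) (h.trans (le_of_eq ?_))
  · rw [Fintype.sum_prod_type]
    congr 1
    exact Finset.sum_congr rfl fun i _ => Finset.sum_congr rfl fun j _ => by ring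
  · simp only [mul_pow]
    rw [Fintype.sum_prod_type]

lemma ofReal_abs_tri_le {L : ℝ} (hL : 0 < L) {M : ℕ} {a b d : Coeff} (ha : IsTrig M a)
    (hb : IsTrig M b) (hd : IsTrig M d) (p q : ENNReal) [ENNReal.HolderTriple p q 2] :
    ENNReal.ofReal |tri L a b d| ≤ eLpNorm (field L M a) p (volume.restrict (cube L)) *
      eLpNorm (field L M d) q (volume.restrict (cube L)) * ENNReal.ofReal (normV L 1 b) := by
  have hB : eLpNorm (gradField L M b) 2 (volume.restrict (cube L)) =
      ENNReal.ofReal (normV L 1 b) := by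
    rw [cube_eq, eLpNorm_gradField hL hb 0 1 zero_le_one]; simp
  set μ := volume.restrict (cube L)
  have ma := (continuous_field L M a).norm.aestronglyMeasurable (μ := μ)
  have md := (continuous_field L M d).norm.aestronglyMeasurable (μ := μ)
  have mb := (continuous_gradField L M b).norm.aestronglyMeasurable (μ := μ)
  rw [tri_eq_integral hL ha hb hd, ← Real.norm_eq_abs, ofReal_norm]
  calc _ ≤ ∫⁻ x, ‖∑ i, ∑ j, field L M a x i * gradField L M b x (i, j) * field L M d x j‖ₑ ∂μ :=
        enorm_integral_le_lintegral_enorm _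
    _ ≤ ∫⁻ x, ‖(((fun x => ‖field L M a x‖) • fun x => ‖field L M d x‖) •
          fun x => ‖gradField L M b x‖) x‖ₑ ∂μ := by
        refine lintegral_mono fun x => ?_
        rw [enorm_le_iff_norm_le, Real.norm_eq_abs]
        refine (abs_contraction_le _ _ _).trans (le_of_eq ?_)
        simp
    _ = eLpNorm (((fun x => ‖field L M a x‖) • fun x => ‖field L M d x‖) •
          fun x => ‖gradField L M b x‖) 1 μ := by rw [eLpNorm_one_eq_lintegral_enorm]
    _ ≤ eLpNorm ((fun x => ‖field L M a x‖) • fun x => ‖field L M d x‖) 2 μ *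
          eLpNorm (fun x => ‖gradField L M b x‖) 2 μ := eLpNorm_smul_le_mul_eLpNorm mb (ma.smul md)
    _ ≤ eLpNorm (fun x => ‖field L M a x‖) p μ * eLpNorm (fun x => ‖field L M d x‖) q μ *
          eLpNorm (fun x => ‖gradField L M b x‖) 2 μ := by
        gcongr
        exact eLpNorm_smul_le_mul_eLpNorm md ma
    _ = _ := by rw [eLpNorm_norm, eLpNorm_norm, eLpNorm_norm, hB]

end

section

/-! ### Estimates of the trilinear form -/

instance holderTriple_four_four : ENNReal.HolderTriple 4 4 2 := ⟨by
  rw [← ENNReal.toReal_eq_toReal_iff' (by norm_num) (by norm_num),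
    ENNReal.toReal_add (by norm_num) (by norm_num)]
  norm_num⟩

instance holderTriple_six_three : ENNReal.HolderTriple 6 3 2 := ⟨by
  rw [← ENNReal.toReal_eq_toReal_iff' (by norm_num) (by norm_num),
    ENNReal.toReal_add (by norm_num) (by norm_num)]
  norm_num⟩

instance holderTriple_three_six : ENNReal.HolderTriple 3 6 2 := ⟨by
  rw [← ENNReal.toReal_eq_toReal_iff' (by norm_num) (by norm_num),
    ENNReal.toReal_add (by norm_num) (by norm_num)]
  norm_num⟩

/-- The geometric mean `‖u‖^{1/2} ‖∇u‖^{1/2}`. -/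
def interp (L : ℝ) (u : Coeff) : ℝ := √(normV L 0 u * normV L 1 u)

lemma interp_nonneg (L : ℝ) (u : Coeff) : 0 ≤ interp L u := Real.sqrt_nonneg _

lemma interp_mono {L : ℝ} (hL : 0 < L) {u v : Coeff} (hu : MemV 1 u) (h : ∀ K, ‖v K‖ ≤ ‖u K‖) :
    interp L v ≤ interp L u :=
  Real.sqrt_le_sqrt (mul_le_mul (normV_mono hL hu.of_one h) (normV_mono hL hu h)
    (normV_nonneg _ _ _) (normV_nonneg _ _ _))

lemma interp_proj_le {L : ℝ} (hL : 0 < L) {u : Coeff} (hu : MemV 1 u) (N : ℕ) :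
    interp L (proj N u) ≤ interp L u := interp_mono hL hu (norm_proj_le N u)

lemma rpow_neg_quarter_eq {x : ℝ} (hx : 0 < x) : x ^ (-1 / 4 : ℝ) = √(√x)⁻¹ := by
  rw [Real.sqrt_inv, Real.sqrt_eq_rpow, Real.sqrt_eq_rpow, ← Real.rpow_mul hx.le,
    ← Real.rpow_neg hx.le]
  norm_num

lemma sqrt_mul_normV_le {L : ℝ} (hL : 0 < L) {u : Coeff} (hu : MemV 1 u) :
    √(lam1 L) * normV L 0 u ≤ normV L 1 u := by
  have h := Real.sqrt_le_sqrt (poincare hL (s := 0) hu)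
  rwa [Real.sqrt_mul (lam1_nonneg L), Real.sqrt_sq (normV_nonneg _ _ _),
    Real.sqrt_sq (normV_nonneg _ _ _)] at h

lemma interp_le {L : ℝ} (hL : 0 < L) {u : Coeff} (hu : MemV 1 u) :
    interp L u ≤ lam1 L ^ (-1 / 4 : ℝ) * normV L 1 u := by
  have hl := lam1_pos hL
  have h := sqrt_mul_normV_le hL hu
  have h0 := Real.sqrt_pos.mpr hl
  have h1 : normV L 0 u ≤ (√(lam1 L))⁻¹ * normV L 1 u := by
    rw [inv_mul_eq_div, le_div_iff₀ h0, mul_comm]; exact h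
  have h2 := normV_nonneg L 1 u
  rw [interp, rpow_neg_quarter_eq hl]
  calc _ ≤ √((√(lam1 L))⁻¹ * normV L 1 u ^ 2) := by
        apply Real.sqrt_le_sqrt
        nlinarith
    _ = _ := by rw [Real.sqrt_mul (by positivity), Real.sqrt_sq h2]

/-- On high modes ‖q‖ ≤ λ₁^{-1/2} N⁻¹ ‖∇q‖, and the geometric mean keeps half of this gain. This is
the origin of every N^{-1/2} in the size conditions. -/
lemma interp_high_modes_le {L : ℝ} (hL : 0 < L) {u : Coeff} (hu : MemV 1 u) {N : ℕ} (hN : 0 < N) :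
    interp L (u - proj N u) ≤ lam1 L ^ (-1 / 4 : ℝ) * (√N)⁻¹ * normV L 1 (u - proj N u) := by
  have hl := lam1_pos hL
  have hN' : (0 : ℝ) < N := by exact_mod_cast hN
  have h := Real.sqrt_le_sqrt (normV_high_modes hL (s := 0) hu N)
  rw [Real.sqrt_mul (by positivity), Real.sqrt_mul hl.le, Real.sqrt_sq hN'.le,
    Real.sqrt_sq (normV_nonneg _ _ _), Real.sqrt_sq (normV_nonneg _ _ _), zero_add] at h
  have h0 := Real.sqrt_pos.mpr hl
  set X := normV L 0 (u - proj N u)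
  set Y := normV L 1 (u - proj N u) with hY
  have h1 : X ≤ (√(lam1 L))⁻¹ * (N : ℝ)⁻¹ * Y := by
    rw [← mul_inv, inv_mul_eq_div, le_div_iff₀ (by positivity), mul_comm]; exact h
  have h2 : 0 ≤ Y := normV_nonneg L 1 _
  rw [interp, rpow_neg_quarter_eq hl]
  calc _ ≤ √((√(lam1 L))⁻¹ * (N : ℝ)⁻¹ * Y ^ 2) := by
        apply Real.sqrt_le_sqrt
        nlinarith
    _ = _ := by
        rw [Real.sqrt_mul (by positivity), Real.sqrt_mul (by positivity), Real.sqrt_sq h2,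
          Real.sqrt_inv (N : ℝ)]

lemma rpow_half_mul_rpow_half {x y : ℝ} (hx : 0 ≤ x) :
    x ^ (1 / 2 : ℝ) * y ^ (1 / 2 : ℝ) = √(x * y) := by
  rw [Real.sqrt_mul hx, Real.sqrt_eq_rpow, Real.sqrt_eq_rpow]

lemma quarter_mul_self {x y : ℝ} (hx : 0 ≤ x) (hy : 0 ≤ y) :
    (x ^ (1 / 4 : ℝ) * y ^ (3 / 4 : ℝ)) * (x ^ (1 / 4 : ℝ) * y ^ (3 / 4 : ℝ)) = √(x * y) * y := by
  have e1 : x ^ (1 / 4 : ℝ) * x ^ (1 / 4 : ℝ) = √x := by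
    rw [Real.sqrt_eq_rpow, ← Real.rpow_add_of_nonneg hx (by norm_num) (by norm_num)]; norm_num
  have e2 : y ^ (3 / 4 : ℝ) * y ^ (3 / 4 : ℝ) = √y * y := by
    nth_rw 4 [← Real.rpow_one y]
    rw [Real.sqrt_eq_rpow, ← Real.rpow_add_of_nonneg hy (by norm_num) (by norm_num),
      ← Real.rpow_add_of_nonneg hy (by norm_num) (by norm_num)]
    norm_num
  calc _ = (x ^ (1 / 4 : ℝ) * x ^ (1 / 4 : ℝ)) * (y ^ (3 / 4 : ℝ) * y ^ (3 / 4 : ℝ)) := by ring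
    _ = _ := by rw [e1, e2, Real.sqrt_mul hx]; ring

lemma abs_tri_trig_le {L : ℝ} (hL : 0 < L) {M : ℕ} {a b d : Coeff} (ha : IsTrig M a)
    (hb : IsTrig M b) (hd : IsTrig M d) (p q : ENNReal) [ENNReal.HolderTriple p q 2] {X Y : ℝ}
    (hX : 0 ≤ X) (hY : 0 ≤ Y)
    (h1 : eLpNorm (field L M a) p (volume.restrict (cube L)) ≤ ENNReal.ofReal X)
    (h2 : eLpNorm (field L M d) q (volume.restrict (cube L)) ≤ ENNReal.ofReal Y) :
    |tri L a b d| ≤ X * Y * normV L 1 b := by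
  have h := ofReal_abs_tri_le hL ha hb hd p q
  rw [← ENNReal.ofReal_le_ofReal_iff (by have := normV_nonneg L 1 b; positivity),
    ENNReal.ofReal_mul (by positivity), ENNReal.ofReal_mul hX]
  exact h.trans (by gcongr)

variable {L c : ℝ}

lemma gn_field (hL : 0 < L) (hc : IsGNConstant L c) {M : ℕ} {a : Coeff} (ha : IsTrig M a) :
    eLpNorm (field L M a) 3 (volume.restrict (cube L)) ≤ ENNReal.ofReal (c * interp L a) ∧
    eLpNorm (field L M a) 4 (volume.restrict (cube L)) ≤
      ENNReal.ofReal (c * (normV L 0 a ^ (1 / 4 : ℝ) * normV L 1 a ^ (3 / 4 : ℝ))) ∧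
    eLpNorm (field L M a) 6 (volume.restrict (cube L)) ≤ ENNReal.ofReal (c * normV L 1 a) := by
  obtain ⟨h3, h4, h6⟩ := hc.2 a (ha.memV 1) _ (realizes_field hL ha)
  rw [mul_assoc, rpow_half_mul_rpow_half (normV_nonneg _ _ _)] at h3
  rw [mul_assoc] at h4
  exact ⟨h3, h4, h6⟩

/-- Extension of estimates of the trilinear form from trigonometric polynomials. -/
lemma abs_tri_le_of_proj (hL : 0 < L) {M : ℕ} {a b d : Coeff} (ha : MemV 1 a)
    (hb : MemV 1 b) (hd : IsTrig M d) {C : ℝ}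
    (h : ∀ m, M ≤ m → |tri L (proj m a) (proj m b) d| ≤ C) : |tri L a b d| ≤ C := by
  refine le_of_tendsto (tendsto_tri_proj hL ha.of_one hb hd).abs ?_
  filter_upwards [eventually_ge_atTop M] with m hm using h m hm

/-- Hölder's inequality with exponents `6, 2, 3`. -/
lemma abs_tri_le_six_two_three (hL : 0 < L) (hc : IsGNConstant L c) {M : ℕ} {a b d : Coeff}
    (ha : MemV 1 a) (hb : MemV 1 b) (hd : IsTrig M d) :
    |tri L a b d| ≤ c ^ 2 * (normV L 1 a * normV L 1 b * interp L d) := by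
  refine abs_tri_le_of_proj hL ha hb hd fun m hm => ?_
  have hc0 := hc.1
  have ta := ha.isField.isTrig_proj m
  have h := abs_tri_trig_le hL ta (hb.isField.isTrig_proj m) (hd.mono hm) 6 3
    (mul_nonneg hc0.le (normV_nonneg _ _ _)) (mul_nonneg hc0.le (interp_nonneg _ _))
    (gn_field hL hc ta).2.2 (gn_field hL hc (hd.mono hm)).1
  have h1 := normV_proj_le hL ha m
  have h2 := normV_proj_le hL hb m
  have := normV_nonneg L 1 a
  have := normV_nonneg L 1 (proj m a)
  have := normV_nonneg L 1 (proj m b)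
  have := interp_nonneg L d
  calc _ ≤ _ := h
    _ = c ^ 2 * (normV L 1 (proj m a) * normV L 1 (proj m b) * interp L d) := by ring
    _ ≤ _ := by gcongr

/-- Hölder's inequality with exponents `3, 2, 6`. -/
lemma abs_tri_le_three_two_six (hL : 0 < L) (hc : IsGNConstant L c) {M : ℕ} {a b d : Coeff}
    (ha : MemV 1 a) (hb : MemV 1 b) (hd : IsTrig M d) :
    |tri L a b d| ≤ c ^ 2 * (interp L a * normV L 1 b * normV L 1 d) := by
  refine abs_tri_le_of_proj hL ha hb hd fun m hm => ?_
  have hc0 := hc.1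
  have ta := ha.isField.isTrig_proj m
  have h := abs_tri_trig_le hL ta (hb.isField.isTrig_proj m) (hd.mono hm) 3 6
    (mul_nonneg hc0.le (interp_nonneg _ _)) (mul_nonneg hc0.le (normV_nonneg _ _ _))
    (gn_field hL hc ta).1 (gn_field hL hc (hd.mono hm)).2.2
  have h1 := interp_proj_le hL ha m
  have h2 := normV_proj_le hL hb m
  have := interp_nonneg L a
  have := interp_nonneg L (proj m a)
  have := normV_nonneg L 1 (proj m b)
  have := normV_nonneg L 1 d
  calc _ ≤ _ := h
    _ = c ^ 2 * (interp L (proj m a) * normV L 1 (proj m b) * normV L 1 d) := by ring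
    _ ≤ _ := by gcongr

/-- Hölder's inequality with exponents `6, 3, 2`, after an integration by parts. -/
lemma abs_tri_le_six_three_two (hL : 0 < L) (hc : IsGNConstant L c) {M : ℕ} {a b d : Coeff}
    (ha : MemV 1 a) (hb : MemV 1 b) (hd : IsTrig M d) :
    |tri L a b d| ≤ c ^ 2 * (normV L 1 a * interp L b * normV L 1 d) := by
  refine abs_tri_le_of_proj hL ha hb hd fun m hm => ?_
  have tb := hb.isField.isTrig_proj m
  rw [tri_antisymm hL (ha.proj m).of_one tb (hd.mono hm), abs_neg]
  refine (abs_tri_le_six_two_three hL hc (ha.proj m) (hd.memV 1) tb).trans ?_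
  have h1 := normV_proj_le hL ha m
  have h2 := interp_proj_le hL hb m
  have := normV_nonneg L 1 a
  have := normV_nonneg L 1 (proj m a)
  have := interp_nonneg L (proj m b)
  have := normV_nonneg L 1 d
  calc _ = c ^ 2 * (normV L 1 (proj m a) * interp L (proj m b) * normV L 1 d) := by ring
    _ ≤ _ := by gcongr

/-- Hölder's inequality with exponents `4, 2, 4`. -/
lemma abs_tri_le_four_two_four (hL : 0 < L) (hc : IsGNConstant L c) {M : ℕ} {b d : Coeff}
    (hb : MemV 1 b) (hd : IsTrig M d) :
    |tri L d b d| ≤ c ^ 2 * (interp L d * normV L 1 d * normV L 1 b) := by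
  refine abs_tri_le_of_proj hL (hd.memV 1) hb hd fun m hm => ?_
  have hc0 := hc.1
  have td := hd.mono hm
  rw [td.proj_eq]
  have h0 := Real.rpow_nonneg (normV_nonneg L 0 d) (1 / 4)
  have h1 := Real.rpow_nonneg (normV_nonneg L 1 d) (3 / 4)
  have h := abs_tri_trig_le hL td (hb.isField.isTrig_proj m) td 4 4 (by positivity) (by positivity)
    (gn_field hL hc td).2.1 (gn_field hL hc td).2.1
  have h2 := normV_proj_le hL hb m
  have := normV_nonneg L 1 d
  have := interp_nonneg L d
  calc _ ≤ _ := h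
    _ = c ^ 2 * ((normV L 0 d ^ (1 / 4 : ℝ) * normV L 1 d ^ (3 / 4 : ℝ)) *
        (normV L 0 d ^ (1 / 4 : ℝ) * normV L 1 d ^ (3 / 4 : ℝ)) * normV L 1 (proj m b)) := by ring
    _ = c ^ 2 * (interp L d * normV L 1 d * normV L 1 (proj m b)) := by
        rw [quarter_mul_self (normV_nonneg _ _ _) (normV_nonneg _ _ _), interp]
    _ ≤ _ := by gcongr

end

section

/-! ### Continuity in time -/

/-- `z ∈ C(S;V)`. -/
def ContV (L : ℝ) (S : Set ℝ) (z : ℝ → Coeff) : Prop :=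
  (∀ t ∈ S, MemV 1 (z t)) ∧ ∀ t ∈ S, Tendsto (fun s => normV L 1 (z s - z t)) (𝓝[S] t) (𝓝 0)

variable {L : ℝ} {S : Set ℝ}

lemma ContV.mono {z : ℝ → Coeff} (hz : ContV L S z) {T : Set ℝ} (h : T ⊆ S) : ContV L T z :=
  ⟨fun t ht => hz.1 t (h ht), fun t ht => (hz.2 t (h ht)).mono_left (nhdsWithin_mono t h)⟩

lemma ContV.add (hL : 0 < L) {y z : ℝ → Coeff} (hy : ContV L S y) (hz : ContV L S z) :
    ContV L S fun t => y t + z t := by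
  refine ⟨fun t ht => (hy.1 t ht).add (hz.1 t ht), fun t ht => ?_⟩
  have h := (hy.2 t ht).add (hz.2 t ht)
  rw [add_zero] at h
  refine squeeze_zero' (Eventually.of_forall fun s => normV_nonneg _ _ _) ?_ h
  filter_upwards [self_mem_nhdsWithin] with s hs
  rw [add_sub_add_comm]
  exact normV_add_le hL ((hy.1 s hs).sub (hy.1 t ht)) ((hz.1 s hs).sub (hz.1 t ht))

lemma ContV.neg {z : ℝ → Coeff} (hz : ContV L S z) : ContV L S fun t => -z t := by
  refine ⟨fun t ht => (hz.1 t ht).neg, fun t ht => ?_⟩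
  refine (hz.2 t ht).congr fun s => ?_
  rw [← normV_neg, neg_sub_neg, neg_sub]

lemma ContV.sub (hL : 0 < L) {y z : ℝ → Coeff} (hy : ContV L S y) (hz : ContV L S z) :
    ContV L S fun t => y t - z t := by
  simp only [sub_eq_add_neg]
  exact hy.add hL hz.neg

lemma ContV.proj (hL : 0 < L) {z : ℝ → Coeff} (hz : ContV L S z) (N : ℕ) :
    ContV L S fun t => proj N (z t) := by
  refine ⟨fun t ht => (hz.1 t ht).proj N, fun t ht => ?_⟩
  refine squeeze_zero' (Eventually.of_forall fun s => normV_nonneg _ _ _) ?_ (hz.2 t ht)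
  filter_upwards [self_mem_nhdsWithin] with s hs
  rw [← proj_sub]
  exact normV_proj_le hL ((hz.1 s hs).sub (hz.1 t ht)) N

lemma ContV.continuousOn_normV (hL : 0 < L) {z : ℝ → Coeff} (hz : ContV L S z) :
    ContinuousOn (fun t => normV L 1 (z t)) S := by
  intro t ht
  rw [ContinuousWithinAt, tendsto_iff_norm_sub_tendsto_zero]
  refine squeeze_zero' (Eventually.of_forall fun s => norm_nonneg _) ?_ (hz.2 t ht)
  filter_upwards [self_mem_nhdsWithin] with s hs
  exact abs_normV_sub_le hL (hz.1 s hs) (hz.1 t ht)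

lemma ContV.exists_bound (hL : 0 < L) {z : ℝ → Coeff} (hz : ContV L S z) (hS : IsCompact S) :
    ∃ W, 0 ≤ W ∧ ∀ t ∈ S, normV L 1 (z t) ≤ W := by
  obtain ⟨W, hW⟩ := hS.exists_bound_of_continuousOn (hz.continuousOn_normV hL)
  exact ⟨max W 0, le_max_right _ _, fun t ht =>
    (le_abs_self _).trans ((hW t ht).trans (le_max_left _ _))⟩

lemma normV_zero_le (hL : 0 < L) {u : Coeff} (hu : MemV 1 u) :
    normV L 0 u ≤ (√(lam1 L))⁻¹ * normV L 1 u := by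
  rw [inv_mul_eq_div, le_div_iff₀ (Real.sqrt_pos.mpr (lam1_pos hL)), mul_comm]
  exact sqrt_mul_normV_le hL hu

lemma ContV.continuousOn_coeff (hL : 0 < L) {z : ℝ → Coeff} (hz : ContV L S z)
    (K : Fin 3 → ℤ) : ContinuousOn (fun t => z t K) S := by
  intro t ht
  rw [ContinuousWithinAt, tendsto_iff_norm_sub_tendsto_zero]
  have h := ((hz.2 t ht).const_mul (√(lam1 L))⁻¹).const_mul (√(L ^ 3))⁻¹
  rw [mul_zero, mul_zero] at h
  refine squeeze_zero' (Eventually.of_forall fun s => norm_nonneg _) ?_ h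
  filter_upwards [self_mem_nhdsWithin] with s hs
  have hm := (hz.1 s hs).sub (hz.1 t ht)
  have h1 := norm_coeff_le hL hm.of_one K
  rw [pow_zero, mul_one] at h1
  have h2 := normV_zero_le hL hm
  rw [inv_mul_eq_div (√(L ^ 3)), le_div_iff₀ (Real.sqrt_pos.mpr (by positivity)), mul_comm]
  exact h1.trans h2

lemma ContV.continuousOn_bilin (hL : 0 < L) {z : ℝ → Coeff} (hz : ContV L S z)
    (K : Fin 3 → ℤ) : ContinuousOn (fun t => bilin L (z t) (z t) K) S := by
  intro t ht
  rw [ContinuousWithinAt, tendsto_iff_norm_sub_tendsto_zero]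
  set r := (√(lam1 L))⁻¹
  have hr : 0 ≤ r := by positivity
  have h : Tendsto (fun s => 2 * (L ^ 3)⁻¹ * (r * normV L 1 (z s - z t) * normV L 1 (z s)) +
      2 * (L ^ 3)⁻¹ * (r * normV L 1 (z t) * normV L 1 (z s - z t))) (𝓝[S] t) (𝓝 0) := by
    have h1 := (((hz.2 t ht).const_mul r).mul (hz.continuousOn_normV hL t ht)).const_mul
      (2 * (L ^ 3)⁻¹)
    have h2 := ((hz.2 t ht).const_mul (r * normV L 1 (z t))).const_mul (2 * (L ^ 3)⁻¹)
    simpa using h1.add h2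
  refine squeeze_zero' (Eventually.of_forall fun s => norm_nonneg _) ?_ h
  filter_upwards [self_mem_nhdsWithin] with s hs
  have ms := hz.1 s hs
  have mt := hz.1 t ht
  have e1 := congrFun (bilin_sub_left hL ms.of_one mt.of_one ms) K
  have e2 := congrFun (bilin_sub_right hL mt.of_one ms mt) K
  have e : bilin L (z s) (z s) K - bilin L (z t) (z t) K =
      bilin L (z s - z t) (z s) K + bilin L (z t) (z s - z t) K := by
    rw [e1, e2]; simp
  rw [e]
  refine (norm_add_le _ _).trans ?_
  have := normV_nonneg L 1 (z s)
  have := normV_nonneg L 1 (z s - z t)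
  gcongr
  · refine (norm_bilin_le hL (ms.sub mt).of_one ms K).trans ?_
    gcongr
    exact normV_zero_le hL (ms.sub mt)
  · refine (norm_bilin_le hL mt.of_one (ms.sub mt) K).trans ?_
    gcongr
    exact normV_zero_le hL mt

/-! ### Mode-by-mode evolution -/

/-- On `[a,b]`, every mode of `z` is a primitive of the corresponding mode of `G`. -/
structure Evolves (L a b : ℝ) (z G : ℝ → Coeff) : Prop where
  contV : ContV L (Icc a b) z
  integrable : ∀ K, IntervalIntegrable (fun r => G r K) volume a b
  eq : ∀ t ∈ Icc a b, ∀ K, z t K = z a K + ∫ r in a..t, G r K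

variable {a b : ℝ}

lemma Evolves.sub (hL : 0 < L) {y z F G : ℝ → Coeff} (hy : Evolves L a b y F)
    (hz : Evolves L a b z G) : Evolves L a b (fun t => y t - z t) fun t => F t - G t := by
  refine ⟨hy.contV.sub hL hz.contV, fun K => (hy.integrable K).sub (hz.integrable K),
    fun t ht K => ?_⟩
  have hs : uIcc a t ⊆ uIcc a b := by
    rw [uIcc_of_le ht.1, uIcc_of_le (ht.1.trans ht.2)]; exact Icc_subset_Icc_right ht.2
  have h := intervalIntegral.integral_sub ((hy.integrable K).mono_set hs)
    ((hz.integrable K).mono_set hs)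
  simp only [Pi.sub_apply]
  rw [h, hy.eq t ht K, hz.eq t ht K]
  abel

lemma Evolves.mono {z G : ℝ → Coeff} (hz : Evolves L a b z G) {s t : ℝ} (hs : a ≤ s)
    (hst : s ≤ t) (ht : t ≤ b) : Evolves L s t z G := by
  have hi : ∀ x y, x ∈ Icc a b → y ∈ Icc a b → ∀ K,
      IntervalIntegrable (fun r => G r K) volume x y := fun x y hx hy K =>
    (hz.integrable K).mono_set (by
      rw [uIcc_of_le (hx.1.trans hx.2)]; exact uIcc_subset_Icc hx hy)
  have ha : a ∈ Icc a b := ⟨le_rfl, hs.trans (hst.trans ht)⟩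
  have hs' : s ∈ Icc a b := ⟨hs, hst.trans ht⟩
  have ht' : t ∈ Icc a b := ⟨hs.trans hst, ht⟩
  refine ⟨hz.contV.mono (Icc_subset_Icc hs ht), hi s t hs' ht', fun r hr K => ?_⟩
  have hr' : r ∈ Icc a b := ⟨hs.trans hr.1, hr.2.trans ht⟩
  rw [hz.eq r hr' K, hz.eq s hs' K, add_assoc,
    intervalIntegral.integral_add_adjacent_intervals (hi a s ha hs' K) (hi s r hs' hr' K)]

/-- Lebesgue differentiation for each mode; there are countably many modes, so one null set serves
for all. -/
lemma Evolves.ae_hasDerivAt {z G : ℝ → Coeff} (hz : Evolves L a b z G) :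
    ∀ᵐ t, t ∈ Ioo a b → ∀ K, HasDerivAt (fun s => z s K) (G t K) t := by
  have h : ∀ᵐ t, ∀ K, t ∈ uIcc a b → ∀ c ∈ uIcc a b,
      HasDerivAt (fun x => ∫ r in c..x, G r K) (G t K) t :=
    ae_all_iff.mpr fun K => (hz.integrable K).ae_hasDerivAt_integral
  filter_upwards [h] with t ht hab K
  have hle : a ≤ b := hab.1.le.trans hab.2.le
  have h1 := (ht K (by rw [uIcc_of_le hle]; exact Ioo_subset_Icc_self hab) a left_mem_uIcc).const_add
    (z a K)
  refine h1.congr_of_eventuallyEq ?_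
  filter_upwards [Icc_mem_nhds hab.1 hab.2] with s hs
  exact hz.eq s hs K

/-! ### Absolutely continuous functions -/

lemma absolutelyContinuousOnInterval_const (x : ℝ) :
    AbsolutelyContinuousOnInterval (fun _ : ℝ => x) a b :=
  (LipschitzWith.const x).lipschitzOnWith.absolutelyContinuousOnInterval (K := 0)

lemma absolutelyContinuousOnInterval_sum {ι : Type*} (s : Finset ι) {f : ι → ℝ → ℝ}
    (hf : ∀ i ∈ s, AbsolutelyContinuousOnInterval (f i) a b) :
    AbsolutelyContinuousOnInterval (fun t => ∑ i ∈ s, f i t) a b := by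
  classical
  induction s using Finset.induction_on with
  | empty => simpa using absolutelyContinuousOnInterval_const 0
  | insert i s hi ih =>
    simp only [Finset.sum_insert hi]
    exact (hf i (Finset.mem_insert_self i s)).add
      (ih fun j hj => hf j (Finset.mem_insert_of_mem hj))

lemma AbsolutelyContinuousOnInterval.congr_on {f g : ℝ → ℝ}
    (hf : AbsolutelyContinuousOnInterval f a b) (h : EqOn f g (uIcc a b)) :
    AbsolutelyContinuousOnInterval g a b := by
  rw [absolutelyContinuousOnInterval_iff] at hf ⊢
  intro ε hε
  obtain ⟨δ, hδ, H⟩ := hf ε hε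
  refine ⟨δ, hδ, fun E hE hlen => ?_⟩
  refine lt_of_eq_of_lt (Finset.sum_congr rfl fun i hi => ?_) (H E hE hlen)
  have := hE.1 i hi
  rw [h this.1, h this.2]

lemma integral_mono_ae_Ioo (hab : a ≤ b) {f g : ℝ → ℝ} (hf : IntervalIntegrable f volume a b)
    (hg : IntervalIntegrable g volume a b) (h : ∀ᵐ t, t ∈ Ioo a b → f t ≤ g t) :
    ∫ t in a..b, f t ≤ ∫ t in a..b, g t := by
  simp only [intervalIntegral.integral_of_le hab, integral_Ioc_eq_integral_Ioo]
  exact setIntegral_mono_on_ae (hf.1.mono_set Ioo_subset_Ioc_self)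
    (hg.1.mono_set Ioo_subset_Ioc_self) measurableSet_Ioo h

/-- Grönwall's inequality for absolutely continuous functions. -/
lemma gronwall_of_ac (hab : a ≤ b) {y y' e : ℝ → ℝ} (hy : AbsolutelyContinuousOnInterval y a b)
    {k C : ℝ} (hk : 0 < k) (hC : 0 ≤ C) (he : IntervalIntegrable e volume a b)
    (he0 : ∀ t ∈ Ioo a b, 0 ≤ e t) (hd : ∀ᵐ t, t ∈ Ioo a b → HasDerivAt y (y' t) t)
    (h : ∀ᵐ t, t ∈ Ioo a b → y' t ≤ -k * y t + C + e t) :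
    y b ≤ exp (-(k * (b - a))) * y a + C / k + ∫ t in a..b, e t := by
  -- The integrating factor is normalised at the right endpoint. It is then at most 1 on the
  -- interval, so the error e is not amplified.
  set E : ℝ → ℝ := fun t => exp (k * (t - b)) with hE
  have hEd : ∀ t, HasDerivAt E (exp (k * (t - b)) * k) t := fun t => by
    have := ((hasDerivAt_id t).sub_const b).const_mul k
    simpa using this.exp
  have hEc : ContDiff ℝ 1 E := by fun_prop
  have hY := hEc.contDiffOn.absolutelyContinuousOnInterval (a := a) (b := b) |>.mul hy
  have h1 := hY.integral_deriv_eq_sub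
  have hint : IntervalIntegrable (fun t => exp (k * (t - b)) * C) volume a b :=
    (by fun_prop : Continuous fun t => exp (k * (t - b)) * C).intervalIntegrable a b
  have h2 : ∫ t in a..b, deriv (E * y) t ≤ ∫ t in a..b, (exp (k * (t - b)) * C + e t) := by
    refine integral_mono_ae_Ioo hab hY.intervalIntegrable_deriv (hint.add he) ?_
    filter_upwards [hd, h] with t hdt ht hab'
    have hexp : exp (k * (t - b)) ≤ 1 := exp_le_one_iff.mpr
      (mul_nonpos_of_nonneg_of_nonpos hk.le (by linarith [hab'.2]))
    rw [((hEd t).mul (hdt hab')).deriv]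
    have h5 := mul_le_mul_of_nonneg_left (ht hab') (exp_pos (k * (t - b))).le
    have h6 := mul_le_mul_of_nonneg_right hexp (he0 t hab')
    simp only [hE]
    linarith
  have h3 : ∫ t in a..b, exp (k * (t - b)) * C = C / k * (1 - exp (-(k * (b - a)))) := by
    have := intervalIntegral.integral_eq_sub_of_hasDerivAt
      (f := fun t => C / k * E t) (f' := fun t => exp (k * (t - b)) * C) (a := a) (b := b)
      (fun t _ => by
        have := (hEd t).const_mul (C / k)
        rwa [show C / k * (exp (k * (t - b)) * k) = exp (k * (t - b)) * C by
          field_simp] at this) hint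
    rw [this]
    simp only [hE, sub_self, mul_zero, exp_zero]
    rw [show k * (a - b) = -(k * (b - a)) by ring]; ring
  rw [h1, intervalIntegral.integral_add hint he, h3] at h2
  simp only [hE, Pi.mul_apply, sub_self, mul_zero, exp_zero, one_mul] at h2
  rw [show k * (a - b) = -(k * (b - a)) by ring] at h2
  have h4 : 0 ≤ C / k * exp (-(k * (b - a))) := by positivity
  linarith

/-! ### Energy estimates -/

/-- The energy `‖u‖² + β² ‖∇u‖²`. -/
def energy (L β : ℝ) (u : Coeff) : ℝ := normV L 0 u ^ 2 + β ^ 2 * normV L 1 u ^ 2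

lemma energy_nonneg (L β : ℝ) (u : Coeff) : 0 ≤ energy L β u := by
  unfold energy; positivity

lemma filtered_apply (L α : ℝ) (u : Coeff) (K : Fin 3 → ℤ) :
    filtered L α u K = (1 + α ^ 2 * lam L K) • u K := by
  rw [filtered, Pi.add_apply, Pi.smul_apply, stokes, add_smul, one_smul, mul_smul]
  congr 2

/-- The real coordinates on `ℂ³`. -/
def coord (i : Fin 3) (r : Bool) : EuclideanSpace ℂ (Fin 3) →L[ℝ] ℝ :=
  (if r then Complex.reCLM else Complex.imCLM).comp
    ((EuclideanSpace.proj i : EuclideanSpace ℂ (Fin 3) →L[ℂ] ℂ).restrictScalars ℝ)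

lemma re_inner_eq_coord (y z : EuclideanSpace ℂ (Fin 3)) :
    (inner ℂ y z).re = ∑ i, ∑ r, coord i r y * coord i r z := by
  rw [PiLp.inner_apply, Complex.re_sum]
  refine Finset.sum_congr rfl fun i _ => ?_
  simp [coord]
  ring

lemma norm_sq_eq_coord (z : EuclideanSpace ℂ (Fin 3)) : ‖z‖ ^ 2 = ∑ i, ∑ r, coord i r z ^ 2 := by
  have h := re_inner_eq_coord z z
  rw [inner_self_eq_norm_sq_to_K] at h
  simp only [← sq] at h
  rw [← h]
  norm_cast

/-- The truncated energy as a finite sum of squares of real scalar functions, to which the product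
rule for absolutely continuous functions applies. -/
lemma energy_proj_eq (hL : 0 < L) (M : ℕ) (β : ℝ) (u : Coeff) :
    energy L β (proj M u) = ∑ K ∈ modes M, ∑ i, ∑ r,
      L ^ 3 * (1 + β ^ 2 * lam L K) * (coord i r (u K) * coord i r (u K)) := by
  rw [energy, normV_proj_sq hL, normV_proj_sq hL]
  simp only [← Finset.mul_sum, ← sq, ← norm_sq_eq_coord]
  simp only [Finset.mul_sum, ← Finset.sum_add_distrib]
  exact Finset.sum_congr rfl fun K _ => by ring

/-- The right side is written as the product rule produces it when differentiating the sum in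
`energy_proj_eq`. -/
lemma two_mul_innerV_filtered (M : ℕ) (β : ℝ) {u : Coeff} (hu : IsField u) (G : Coeff) :
    2 * innerV L 0 (filtered L β G) (proj M u) = ∑ K ∈ modes M, ∑ i, ∑ r,
      L ^ 3 * (1 + β ^ 2 * lam L K) *
        (coord i r (G K) * coord i r (u K) + coord i r (u K) * coord i r (G K)) := by
  rw [innerV_eq_sum L 0 _ (hu.isTrig_proj M).2, Finset.mul_sum, Finset.mul_sum]
  refine Finset.sum_congr rfl fun K hK => ?_
  rw [proj_of_mem hK, re_inner_eq_coord, filtered_apply]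
  simp only [Finset.mul_sum, map_smul, smul_eq_mul]
  exact Finset.sum_congr rfl fun i _ => Finset.sum_congr rfl fun r _ => by ring

lemma Evolves.ac_coord {z G : ℝ → Coeff} (hz : Evolves L a b z G) (hab : a ≤ b) (K : Fin 3 → ℤ)
    (i : Fin 3) (r : Bool) : AbsolutelyContinuousOnInterval (fun t => coord i r (z t K)) a b := by
  have hG : IntervalIntegrable (fun t => coord i r (G t K)) volume a b :=
    ⟨(coord i r).integrable_comp (hz.integrable K).1, (coord i r).integrable_comp (hz.integrable K).2⟩
  refine AbsolutelyContinuousOnInterval.congr_on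
    ((absolutelyContinuousOnInterval_const (coord i r (z a K))).add
      (hG.absolutelyContinuousOnInterval_intervalIntegral left_mem_uIcc)) fun t ht => ?_
  rw [uIcc_of_le hab] at ht
  have hs : uIcc a t ⊆ uIcc a b := by
    rw [uIcc_of_le ht.1, uIcc_of_le hab]; exact Icc_subset_Icc_right ht.2
  rw [hz.eq t ht K, map_add, Pi.add_apply,
    ContinuousLinearMap.intervalIntegral_comp_comm _ ((hz.integrable K).mono_set hs)]

lemma tendsto_energy_proj (hL : 0 < L) (β : ℝ) {u : Coeff} (hu : MemV 1 u) :
    Tendsto (fun M => energy L β (proj M u)) atTop (𝓝 (energy L β u)) := by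
  have h : ∀ s, MemV s u → Tendsto (fun M => normV L s (proj M u)) atTop (𝓝 (normV L s u)) :=
    fun s hs => by
    rw [tendsto_iff_norm_sub_tendsto_zero]
    refine squeeze_zero (fun _ => norm_nonneg _) (fun M => ?_) (tendsto_normV_sub_proj L hs)
    rw [norm_sub_rev]
    exact abs_normV_sub_le hL hs (hs.proj M)
  exact ((h 0 hu.of_one).pow 2).add (((h 1 hu).pow 2).const_mul _)

/-- The energy inequality: a differential inequality for all truncations, up to an error controlled
by the tail of `z`, can be integrated in time. -/
lemma Evolves.energy_le (hL : 0 < L) {z G : ℝ → Coeff} (hz : Evolves L a b z G) (hab : a ≤ b)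
    {β k B C : ℝ} (hk : 0 < k) (hB : 0 ≤ B) (hC : 0 ≤ C)
    (h : ∀ᶠ M in atTop, ∀ᵐ t, t ∈ Ioo a b →
      2 * innerV L 0 (filtered L β (G t)) (proj M (z t)) ≤
        -k * energy L β (proj M (z t)) + C + B * normV L 1 (z t - proj M (z t))) :
    energy L β (z b) ≤ exp (-(k * (b - a))) * energy L β (z a) + C / k := by
  have ha : a ∈ Icc a b := ⟨le_rfl, hab⟩
  have hb : b ∈ Icc a b := ⟨hab, le_rfl⟩
  have htail : ∀ M, ContinuousOn (fun t => normV L 1 (z t - proj M (z t))) (Icc a b) := fun M =>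
    (hz.contV.sub hL (hz.contV.proj hL M)).continuousOn_normV hL
  obtain ⟨W, hW0, hW⟩ := hz.contV.exists_bound hL isCompact_Icc
  -- Dominated convergence: the tail tends to zero for each t and is bounded by the supremum W of
  -- ‖∇z‖ over the compact interval.
  have hlim : Tendsto (fun M => ∫ t in a..b, B * normV L 1 (z t - proj M (z t))) atTop (𝓝 0) := by
    have := intervalIntegral.tendsto_integral_filter_of_dominated_convergence
      (μ := volume) (a := a) (b := b) (l := atTop) (f := fun _ => (0 : ℝ))
      (F := fun M t => B * normV L 1 (z t - proj M (z t))) (fun _ => B * W) ?_ ?_ ?_ ?_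
    · simpa using this
    · refine Eventually.of_forall fun M => ?_
      rw [uIoc_of_le hab]
      exact ((htail M).const_smul B).mono Ioc_subset_Icc_self |>.aestronglyMeasurable
        measurableSet_Ioc
    · refine Eventually.of_forall fun M => Eventually.of_forall fun t ht => ?_
      rw [uIoc_of_le hab] at ht
      have ht' := Ioc_subset_Icc_self ht
      rw [Real.norm_of_nonneg (mul_nonneg hB (normV_nonneg _ _ _))]
      gcongr
      exact (normV_sub_proj_le hL (hz.contV.1 t ht') M).trans (hW t ht')
    · exact intervalIntegrable_const
    · refine Eventually.of_forall fun t ht => ?_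
      rw [uIoc_of_le hab] at ht
      simpa using (tendsto_normV_sub_proj L (hz.contV.1 t (Ioc_subset_Icc_self ht))).const_mul B
  have hlim2 : Tendsto (fun M => exp (-(k * (b - a))) * energy L β (proj M (z a)) + C / k +
      ∫ t in a..b, B * normV L 1 (z t - proj M (z t))) atTop
      (𝓝 (exp (-(k * (b - a))) * energy L β (z a) + C / k + 0)) :=
    (((tendsto_energy_proj hL β (hz.contV.1 a ha)).const_mul _).add_const _).add hlim
  rw [add_zero] at hlim2
  refine le_of_tendsto_of_tendsto (tendsto_energy_proj hL β (hz.contV.1 b hb)) hlim2 ?_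
  filter_upwards [h] with M hM
  refine gronwall_of_ac hab (y := fun t => energy L β (proj M (z t)))
    (y' := fun t => 2 * innerV L 0 (filtered L β (G t)) (proj M (z t)))
    (e := fun t => B * normV L 1 (z t - proj M (z t))) ?_ hk hC ?_ ?_ ?_ hM
  · simp only [energy_proj_eq hL]
    refine absolutelyContinuousOnInterval_sum _ fun K _ =>
      absolutelyContinuousOnInterval_sum _ fun i _ => absolutelyContinuousOnInterval_sum _ fun r _ => ?_
    exact ((hz.ac_coord hab K i r).mul (hz.ac_coord hab K i r)).const_mul _
  · exact ContinuousOn.intervalIntegrable (by rw [uIcc_of_le hab]; exact (htail M).const_smul B)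
  · exact fun t _ => mul_nonneg hB (normV_nonneg _ _ _)
  · filter_upwards [hz.ae_hasDerivAt] with t ht htab
    rw [two_mul_innerV_filtered M β (hz.contV.1 t (Ioo_subset_Icc_self htab)).isField]
    simp only [energy_proj_eq hL]
    refine HasDerivAt.fun_sum fun K _ => HasDerivAt.fun_sum fun i _ => HasDerivAt.fun_sum fun r _ => ?_
    have h1 := ((coord i r).hasFDerivAt (x := z t K)).comp_hasDerivAt t (ht htab K)
    exact (h1.mul h1).const_mul _

end

section

variable {L a b : ℝ}

/-! ### Solutions evolve mode by mode -/

/-- The right-hand side of the equation for `u + α² A u`. -/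
def rhs (L ν α : ℝ) (F u : ℝ → Coeff) (r : ℝ) : Coeff := fun K =>
  F r K - ν • stokes L (filtered L α (u r)) K - bilin L (u r) (u r) K

/-- The time derivative prescribed by the equation. -/
def rate (L ν α : ℝ) (F u : ℝ → Coeff) (r : ℝ) : Coeff := fun K =>
  (1 + α ^ 2 * lam L K)⁻¹ • rhs L ν α F u r K

lemma one_add_pos (L α : ℝ) (K : Fin 3 → ℤ) : 0 < 1 + α ^ 2 * lam L K := by
  have := lam_nonneg L K
  positivity

lemma filtered_rate (L ν α : ℝ) (F u : ℝ → Coeff) (r : ℝ) :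
    filtered L α (rate L ν α F u r) = rhs L ν α F u r := by
  ext1 K
  rw [filtered_apply, rate, smul_smul, mul_inv_cancel₀ (one_add_pos L α K).ne', one_smul]

lemma IsSolution.contV {ν α : ℝ} {F u : ℝ → Coeff} {I : Set ℝ} (h : IsSolution L ν α F I u) :
    ContV L I u := ⟨h.memV, h.continuous⟩

lemma continuousOn_stokes_filtered (hL : 0 < L) {S : Set ℝ} {z : ℝ → Coeff} (hz : ContV L S z)
    (α : ℝ) (K : Fin 3 → ℤ) : ContinuousOn (fun t => stokes L (filtered L α (z t)) K) S := by
  have h1 : ContinuousOn (fun t => (1 + α ^ 2 * lam L K) • z t K) S :=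
    (hz.continuousOn_coeff hL K).const_smul (1 + α ^ 2 * lam L K)
  have h2 : ContinuousOn (fun t => (lam L K : ℂ) • ((1 + α ^ 2 * lam L K) • z t K)) S :=
    h1.const_smul (lam L K : ℂ)
  refine h2.congr fun t _ => ?_
  rw [stokes, filtered_apply]

/-- On a single mode I + α²A is multiplication by 1 + α²λ_K > 0, so the weak equation is solved for
the coefficient of u itself. All terms other than F are continuous in time. -/
lemma IsSolution.evolves (hL : 0 < L) {ν α : ℝ} {F u : ℝ → Coeff} {I : Set ℝ}
    (h : IsSolution L ν α F I u) (hab : a ≤ b) (hI : Icc a b ⊆ I)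
    (hF : ∀ K, IntervalIntegrable (fun r => F r K) volume a b) :
    Evolves L a b u (rate L ν α F u) := by
  have hc := h.contV.mono hI
  have hi : ∀ K, IntervalIntegrable (fun r => rhs L ν α F u r K) volume a b := fun K => by
    refine ((hF K).sub ?_).sub ?_
    · refine ContinuousOn.intervalIntegrable ?_
      rw [uIcc_of_le hab]
      exact (continuousOn_stokes_filtered hL hc α K).const_smul ν
    · refine ContinuousOn.intervalIntegrable ?_
      rw [uIcc_of_le hab]
      exact hc.continuousOn_bilin hL K
  refine ⟨hc, fun K => (hi K).smul (1 + α ^ 2 * lam L K)⁻¹, fun t ht K => ?_⟩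
  have h1 := h.equation a (hI ⟨le_rfl, hab⟩) t (hI ht) ht.1 K
  rw [filtered_apply, filtered_apply, ← smul_sub] at h1
  simp only [rate]
  rw [intervalIntegral.integral_smul]
  simp only [rhs]
  rw [← h1, smul_smul, inv_mul_cancel₀ (one_add_pos L α K).ne', one_smul]
  abel

lemma nudgedForcing_eq {β η : ℝ} {N : ℕ} {f u w : ℝ → Coeff} {t : ℝ} (hu : IsField (u t))
    (hw : IsField (w t)) :
    nudgedForcing L β η N f u w t = f t - η • filtered L β (proj N (w t - u t)) := by
  rw [nudgedForcing, leray_eq_self ((hw.proj N).sub (hu.proj N)), proj_sub]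

lemma integrable_nudgedForcing (hL : 0 < L) {β η : ℝ} {N : ℕ} {f u w : ℝ → Coeff} (hab : a ≤ b)
    (hf : ∀ K, IntervalIntegrable (fun r => f r K) volume a b)
    (hu : ContV L (Icc a b) u) (hw : ContV L (Icc a b) w) (K : Fin 3 → ℤ) :
    IntervalIntegrable (fun r => nudgedForcing L β η N f u w r K) volume a b := by
  have h1 : IntervalIntegrable (fun r => f r K - η • ((1 + β ^ 2 * lam L K) •
      proj N (w r - u r) K)) volume a b := by
    refine (hf K).sub (ContinuousOn.intervalIntegrable ?_)
    rw [uIcc_of_le hab]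
    have h2 : ContinuousOn (fun r => (1 + β ^ 2 * lam L K) • proj N (w r - u r) K) (Icc a b) :=
      (((hw.sub hL hu).proj hL N).continuousOn_coeff hL K).const_smul (1 + β ^ 2 * lam L K)
    exact h2.const_smul η
  refine (intervalIntegrable_congr fun t ht => ?_).mp h1
  rw [uIoc_of_le hab] at ht
  replace ht := Ioc_subset_Icc_self ht
  simp only [nudgedForcing_eq (hu.1 t ht).isField (hw.1 t ht).isField, Pi.sub_apply, Pi.smul_apply,
    filtered_apply]

/-! ### The forcing -/

section forcing
variable {f : ℝ → Coeff}

lemma IsForcing.ae_le (hf : IsForcing L f) :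
    ∀ᵐ t, t ∈ Ici (0 : ℝ) → MemV 0 (f t) ∧ normV L 0 (f t) ≤ supNorm L f := by
  rw [← ae_restrict_iff' measurableSet_Ici]
  obtain ⟨-, h1, C, hC⟩ := hf
  -- A real-valued essential supremum is a bound only for essentially bounded functions; the
  -- constant C provides this.
  have h2 : ∀ᵐ t ∂(volume.restrict (Ici (0 : ℝ))), normV L 0 (f t) ≤ supNorm L f :=
    ae_le_essSup ⟨C, hC⟩
  exact h1.and h2

lemma IsForcing.supNorm_nonneg (hf : IsForcing L f) : 0 ≤ supNorm L f := by
  have h := hf.ae_le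
  rw [← ae_restrict_iff' measurableSet_Ici] at h
  have : (ae (volume.restrict (Ici (0 : ℝ)))).NeBot := by
    rw [ae_neBot, Ne, Measure.restrict_eq_zero]; simp
  obtain ⟨t, ht⟩ := h.exists
  exact (normV_nonneg _ _ _).trans ht.2

lemma IsForcing.intervalIntegrable (hL : 0 < L) (hf : IsForcing L f) (ha : 0 ≤ a) (hab : a ≤ b)
    (K : Fin 3 → ℤ) : IntervalIntegrable (fun r => f r K) volume a b := by
  rw [intervalIntegrable_iff_integrableOn_Ioc_of_le hab]
  have hsub : Ioc a b ⊆ Ici 0 := fun x hx => ha.trans hx.1.le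
  refine ⟨(hf.1 K).mono_measure (Measure.restrict_mono hsub le_rfl),
    .restrict_of_bounded (C := (√(L ^ 3))⁻¹ * supNorm L f) (by simp) ?_⟩
  rw [ae_restrict_iff' measurableSet_Ioc]
  filter_upwards [hf.ae_le] with t ht htab
  obtain ⟨h1, h2⟩ := ht (hsub htab)
  have h3 := norm_coeff_le hL h1 K
  rw [pow_zero, mul_one] at h3
  rw [inv_mul_eq_div, le_div_iff₀ (Real.sqrt_pos.mpr (by positivity)), mul_comm]
  exact h3.trans h2

end forcing

/-! ### Inner products of the terms of the equation -/

lemma innerV_comm (L : ℝ) (s : ℕ) (u v : Coeff) : innerV L s u v = innerV L s v u := by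
  unfold innerV
  congr 1
  exact tsum_congr fun K => by rw [← inner_conj_symm (v K), Complex.conj_re]

lemma innerV_proj_self (hL : 0 < L) (s M : ℕ) {u : Coeff} (hu : IsField u) :
    innerV L s u (proj M u) = normV L s (proj M u) ^ 2 := by
  rw [← innerV_self hL, innerV_proj_left L s le_rfl u (hu.isTrig_proj M)]

lemma innerV_proj_proj (L : ℝ) (s : ℕ) {M N : ℕ} (h : N ≤ M) {u v : Coeff} (hu : IsField u) :
    innerV L s (proj N u) (proj M v) = innerV L s v (proj N u) := by
  rw [innerV_comm, innerV_proj_left L s h v (hu.isTrig_proj N)]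

lemma innerV_filtered (L : ℝ) (s : ℕ) (β : ℝ) {M : ℕ} (u : Coeff) {d : Coeff} (hd : IsTrig M d) :
    innerV L s (filtered L β u) d = innerV L s u d + β ^ 2 * innerV L (s + 1) u d := by
  rw [filtered, innerV_add_left L s _ _ hd, innerV_smul_left L s _ _ hd, innerV_stokes L s u hd]

lemma proj_proj {M N : ℕ} (h : N ≤ M) (u : Coeff) : proj N (proj M u) = proj N u := by
  ext1 K
  by_cases hK : K ∈ modes N
  · rw [proj_of_mem hK, proj_of_mem hK, proj_of_mem (modes_mono h hK)]
  · rw [proj_of_notMem hK, proj_of_notMem hK]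

lemma normV_sq_split (hL : 0 < L) {s : ℕ} {u : Coeff} (hu : MemV s u) (N : ℕ) :
    normV L s u ^ 2 = normV L s (proj N u) ^ 2 + normV L s (u - proj N u) ^ 2 := by
  rw [normV_sq hL, normV_sq hL, normV_sq hL, ← mul_add,
    ← (summable_lam L (hu.proj N)).tsum_add (summable_lam L (hu.sub_proj N))]
  congr 1
  refine tsum_congr fun K => ?_
  by_cases hK : K ∈ modes N <;> simp [proj_of_mem, proj_of_notMem, hK]

/-- Nudging reaches only P_N u. Since η/N² ≤ νλ₁/2, half of the dissipation 2ν‖·‖² in the next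
higher norm pays for the missing high modes, as if the nudging acted on all of u. -/
lemma high_modes_absorb (hL : 0 < L) {ν η : ℝ} (hν : 0 ≤ ν) {N : ℕ} (hN : 0 < N)
    (h : η / (N : ℝ) ^ 2 ≤ ν * lam1 L / 2) {s : ℕ} {u : Coeff} (hu : MemV (s + 1) u)
    (hu' : MemV s u) :
    2 * η * (normV L s u ^ 2 - normV L s (proj N u) ^ 2) ≤ ν * normV L (s + 1) u ^ 2 := by
  have hN' : (0 : ℝ) < (N : ℝ) ^ 2 := by positivity
  rw [div_le_iff₀ hN'] at h
  have h1 := normV_high_modes hL (s := s) hu N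
  have h2 := normV_sub_proj_le hL hu N
  have h3 := normV_sq_split hL hu' N
  have h4 := normV_nonneg L (s + 1) (u - proj N u)
  have h5 : normV L (s + 1) (u - proj N u) ^ 2 ≤ normV L (s + 1) u ^ 2 := by gcongr
  rw [h3, add_sub_cancel_left]
  have h6 := mul_le_mul_of_nonneg_right h (sq_nonneg (normV L s (u - proj N u)))
  have h7 := mul_le_mul_of_nonneg_left (h1.trans h5) hν
  nlinarith

end

section

variable {L a b c ν : ℝ}

/-! ### A priori estimates -/

/-- Because (B(y, P_M z), P_M z) = 0, only the tail z - P_M z contributes. The cancellation of the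
nonlinear term thus holds for truncations up to an error of the form required by
`Evolves.energy_le`. -/
lemma abs_tri_tail_le (hL : 0 < L) (hc : IsGNConstant L c) (M : ℕ) {y z : Coeff} (hy : MemV 1 y)
    (hz : MemV 1 z) {Y Z : ℝ} (hY : normV L 1 y ≤ Y) (hZ : normV L 1 z ≤ Z) :
    |tri L y z (proj M z)| ≤
      c ^ 2 * Y * (lam1 L ^ (-1 / 4 : ℝ) * Z) * normV L 1 (z - proj M z) := by
  have hd := hz.isField.isTrig_proj M
  have h0 : tri L y z (proj M z) = tri L y (z - proj M z) (proj M z) := by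
    conv_lhs => rw [← add_sub_cancel (proj M z) z]
    rw [tri_add_mid hL hy.of_one (hz.proj M) (hz.sub_proj M) (M := M)
      (by rw [add_sub_cancel]; exact hd), add_sub_cancel, tri_self hL hy.of_one hd, zero_add]
  rw [h0]
  have h1 := abs_tri_le_six_two_three hL hc hy (hz.sub_proj M) hd
  have h2 := interp_le hL (hz.proj M)
  have h3 := normV_proj_le hL hz M
  have h4 := normV_nonneg L 1 (z - proj M z)
  have h5 := normV_nonneg L 1 y
  have h6 := normV_nonneg L 1 (proj M z)
  have h7 : 0 ≤ lam1 L ^ (-1 / 4 : ℝ) := Real.rpow_nonneg (lam1_nonneg L) _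
  calc _ ≤ _ := h1
    _ ≤ c ^ 2 * (Y * normV L 1 (z - proj M z) * (lam1 L ^ (-1 / 4 : ℝ) * Z)) := by
        have h8 : interp L (proj M z) ≤ lam1 L ^ (-1 / 4 : ℝ) * Z :=
          h2.trans (mul_le_mul_of_nonneg_left (h3.trans hZ) h7)
        have := interp_nonneg L (proj M z)
        have : 0 ≤ Y := h5.trans hY
        gcongr
    _ = _ := by ring

/-- The energy estimate for the reference solution. -/
lemma energy_reference_le (hL : 0 < L) (hc : IsGNConstant L c) (hν : 0 < ν) {f : ℝ → Coeff}
    (hf : IsForcing L f) {α : ℝ} {u : ℝ → Coeff} (hu : IsSolution L ν α f (Ici 0) u) {t : ℝ}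
    (ht : 0 ≤ t) :
    energy L α (u t) ≤ exp (-(ν * lam1 L * t)) * energy L α (u 0)
      + 1 / (lam1 L ^ 2 * ν ^ 2) * supNorm L f ^ 2 := by
  have hl := lam1_pos hL
  have hev := hu.evolves hL ht Icc_subset_Ici_self (hf.intervalIntegrable hL le_rfl ht)
  obtain ⟨W, hW0, hW⟩ := hev.contV.exists_bound hL isCompact_Icc
  set F := supNorm L f
  have hF : 0 ≤ F := hf.supNorm_nonneg
  have hr : 0 ≤ lam1 L ^ (-1 / 4 : ℝ) := Real.rpow_nonneg (lam1_nonneg L) _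
  -- Through Poincaré, half of the dissipation gives the decay rate νλ₁, and the other half of its
  -- L² part absorbs the forcing at the cost F²/(νλ₁). Dividing by the rate yields F²/(λ₁²ν²).
  have key := hev.energy_le hL ht (β := α) (k := ν * lam1 L)
    (B := 2 * (c ^ 2 * W * (lam1 L ^ (-1 / 4 : ℝ) * W))) (C := F ^ 2 / (ν * lam1 L))
    (by positivity) (by positivity) (by positivity) ?_
  · refine key.trans (le_of_eq ?_)
    rw [sub_zero]
    congr 1
    field_simp
  · refine Eventually.of_forall fun M => ?_
    filter_upwards [hf.ae_le] with r hr' hr0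
    obtain ⟨hf1, hf2⟩ := hr' hr0.1.le
    have hrI := Ioo_subset_Icc_self hr0
    have hm := hev.contV.1 r hrI
    have hd := hm.isField.isTrig_proj M
    have e : innerV L 0 (filtered L α (rate L ν α f u r)) (proj M (u r)) =
        innerV L 0 (f r) (proj M (u r)) - ν * (normV L 1 (proj M (u r)) ^ 2
          + α ^ 2 * normV L 2 (proj M (u r)) ^ 2) - tri L (u r) (u r) (proj M (u r)) := by
      rw [filtered_rate]
      have : rhs L ν α f u r = f r - ν • stokes L (filtered L α (u r)) - bilin L (u r) (u r) := rfl
      rw [this, innerV_sub_left L 0 _ _ hd, innerV_sub_left L 0 _ _ hd, innerV_smul_left L 0 _ _ hd,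
        innerV_stokes L 0 _ hd, innerV_filtered L _ α _ hd, innerV_proj_self hL _ M hm.isField,
        innerV_proj_self hL _ M hm.isField, tri]
    rw [e]
    have h1 := abs_le.mp (abs_innerV_le hL 0 hf1 hd)
    have h2 := abs_le.mp (abs_tri_tail_le hL hc M hm hm (hW r hrI) (hW r hrI))
    have p1 := poincare hL (s := 0) (hd.memV 1)
    have p2 := poincare hL (s := 1) (hd.memV 2)
    rw [zero_add] at p1
    norm_num at p2
    set x0 := normV L 0 (proj M (u r))
    set x1 := normV L 1 (proj M (u r))
    set x2 := normV L 2 (proj M (u r))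
    have hx0 : 0 ≤ x0 := normV_nonneg _ _ _
    have h3 : normV L 0 (f r) * x0 ≤ F * x0 := by gcongr
    have h4 : 2 * (F * x0) ≤ F ^ 2 / (ν * lam1 L) + ν * lam1 L * x0 ^ 2 := by
      have hp : 0 < ν * lam1 L := by positivity
      have : F ^ 2 / (ν * lam1 L) + ν * lam1 L * x0 ^ 2 - 2 * (F * x0) =
        (F - ν * lam1 L * x0) ^ 2 / (ν * lam1 L) := by field_simp; ring
      have : 0 ≤ (F - ν * lam1 L * x0) ^ 2 / (ν * lam1 L) := by positivity
      linarith
    have p1' := mul_le_mul_of_nonneg_left p1 hν.le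
    have p2' := mul_le_mul_of_nonneg_left (mul_le_mul_of_nonneg_left p2 hν.le) (sq_nonneg α)
    have h5 : 0 ≤ ν * (α ^ 2 * x2 ^ 2) := by positivity
    have he : energy L α (proj M (u r)) = x0 ^ 2 + α ^ 2 * x1 ^ 2 := rfl
    rw [he]
    nlinarith

/-- Being real, mean-free and divergence-free are closed real-linear conditions on the coefficients,
hence inherited by the derivative. -/
lemma isField_of_hasDerivAt {z : ℝ → Coeff} {G : Coeff} {t : ℝ} (hz : ∀ᶠ s in 𝓝 t, IsField (z s))
    (h : ∀ K, HasDerivAt (fun s => z s K) (G K) t) : IsField G := by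
  have hcomp : ∀ K i, HasDerivAt (fun s => z s K i) (G K i) t := fun K i => by
    have h1 := ((EuclideanSpace.proj i : EuclideanSpace ℂ (Fin 3) →L[ℂ] ℂ).restrictScalars
      ℝ).hasFDerivAt (x := z t K)
    exact h1.comp_hasDerivAt t (h K)
  refine ⟨?_, fun K i => ?_, fun K => ?_⟩
  · refine (h 0).unique ((hasDerivAt_const t 0).congr_of_eventuallyEq ?_)
    filter_upwards [hz] with s hs using hs.1
  · refine (hcomp (-K) i).unique ?_
    have := (Complex.conjCLE.toContinuousLinearMap.hasFDerivAt (x := z t K i)).comp_hasDerivAt t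
      (hcomp K i)
    refine this.congr_of_eventuallyEq ?_
    filter_upwards [hz] with s hs using hs.2.1 K i
  · have h1 : HasDerivAt (fun s => ∑ i, (K i : ℂ) * z s K i) (∑ i, (K i : ℂ) * G K i) t :=
      HasDerivAt.fun_sum fun i _ => (hcomp K i).const_mul _
    refine h1.unique ((hasDerivAt_const t 0).congr_of_eventuallyEq ?_)
    filter_upwards [hz] with s hs using hs.2.2 K

lemma Evolves.isField {z G : ℝ → Coeff} (hz : Evolves L a b z G) {t : ℝ} (ht : t ∈ Ioo a b)
    (h : ∀ K, HasDerivAt (fun s => z s K) (G t K) t) : IsField (G t) := by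
  refine isField_of_hasDerivAt ?_ h
  filter_upwards [Icc_mem_nhds ht.1 ht.2] with s hs using (hz.contV.1 s hs).isField

/-- The field `u_t + ν A u`, with `u_t` given by the equation. -/
def transported (L ν α : ℝ) (f u : ℝ → Coeff) (t : ℝ) : Coeff :=
  rate L ν α f u t + ν • stokes L (u t)

/-- The viscous terms cancel: (I + α²A)(u_t + νAu) = f - B(u,u). Hence an L² bound on u_t + νAu
needs no more than ‖∇u‖ and ‖f‖. -/
lemma transported_apply (L ν α : ℝ) (f u : ℝ → Coeff) (t : ℝ) (K : Fin 3 → ℤ) :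
    transported L ν α f u t K =
      (1 + α ^ 2 * lam L K)⁻¹ • (f t K - bilin L (u t) (u t) K) := by
  have h := one_add_pos L α K
  have e : stokes L (filtered L α (u t)) K = (1 + α ^ 2 * lam L K) • stokes L (u t) K := by
    rw [stokes, stokes, filtered_apply, smul_comm]
  rw [transported, Pi.add_apply, rate, rhs, Pi.smul_apply, e, smul_comm ν, sub_right_comm, smul_sub,
    smul_smul, inv_mul_cancel₀ h.ne', one_smul, sub_add_cancel]

/-- A duality argument: f - B(u,u) is tested with ψ = (I + α²A)⁻¹ P_M h, which reproduces ‖P_M h‖².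
The smoothing of ψ then controls the nonlinear term. -/
lemma normV_proj_transported_le (hL : 0 < L) (hc : IsGNConstant L c) {α : ℝ} (hα : 0 < α)
    {f u : ℝ → Coeff} {t : ℝ} (M : ℕ) (hf : MemV 0 (f t)) (hu : MemV 1 (u t))
    (hh : IsField (transported L ν α f u t)) :
    normV L 0 (proj M (transported L ν α f u t)) ≤ normV L 0 (f t) +
      c ^ 2 * normV L 1 (u t) ^ 2 / (α ^ 2 * lam1 L ^ (3 / 4 : ℝ)) := by
  have hl := lam1_pos hL
  set h := transported L ν α f u t with hdef
  have ht := hh.isTrig_proj M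
  set ψ : Coeff := fun K => (1 + α ^ 2 * lam L K)⁻¹ • proj M h K with hψ
  have hψK : ∀ K, ψ K = (1 + α ^ 2 * lam L K)⁻¹ • proj M h K := fun _ => rfl
  have hψt : IsTrig M ψ := ht.mult (m := fun K => (1 + α ^ 2 * lam L K)⁻¹) fun K => by
    rw [lam_neg]
  have hinv : ∀ K, 0 ≤ (1 + α ^ 2 * lam L K)⁻¹ ∧ (1 + α ^ 2 * lam L K)⁻¹ ≤ 1 := fun K => by
    have := one_add_pos L α K
    refine ⟨by positivity, inv_le_one_of_one_le₀ ?_⟩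
    have := mul_nonneg (sq_nonneg α) (lam_nonneg L K)
    linarith
  have e1 : normV L 0 (proj M h) ^ 2 = innerV L 0 (f t) ψ - tri L (u t) (u t) ψ := by
    rw [tri, ← innerV_sub_left L 0 _ _ hψt, innerV_eq_sum L 0 _ hψt.2, normV_proj_sq hL]
    congr 1
    refine Finset.sum_congr rfl fun K hK => ?_
    rw [hψK, proj_of_mem hK, hdef, transported_apply]
    set y := f t K - bilin L (u t) (u t) K with hy
    have hy' : (f t - bilin L (u t) (u t)) K = y := rfl
    rw [hy', pow_zero, one_mul, one_mul, norm_smul, Real.norm_of_nonneg (hinv K).1, smul_smul,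
      ← Complex.coe_smul, inner_smul_left, Complex.conj_ofReal, inner_self_eq_norm_sq_to_K]
    norm_cast
    rw [Complex.re_ofReal_mul]
    refine Eq.trans ?_ (congrArg _ (Complex.ofReal_re (‖y‖ ^ 2)).symm)
    ring
  have n0 : normV L 0 ψ ≤ normV L 0 (proj M h) := by
    refine normV_mono hL (ht.memV 0) fun K => ?_
    rw [hψK, norm_smul, Real.norm_of_nonneg (hinv K).1]
    exact mul_le_of_le_one_left (norm_nonneg _) (hinv K).2
  -- In Fourier variables, α²λ_K/(1 + α²λ_K) ≤ 1 and λ₁ ≤ λ_K. With the interpolation bound this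
  -- yields the power λ₁^{-3/4}.
  have n1 : α ^ 2 * (√(lam1 L) * normV L 1 ψ) ≤ normV L 0 (proj M h) := by
    refine le_of_sq_le_sq ?_ (normV_nonneg _ _ _)
    rw [mul_pow, mul_pow, Real.sq_sqrt hl.le,
      normV_sq_of_support hL 1 hψt.2, normV_proj_sq hL, mul_left_comm (lam1 L), mul_left_comm _ (L ^ 3)]
    refine mul_le_mul_of_nonneg_left ?_ (by positivity)
    rw [Finset.mul_sum, Finset.mul_sum]
    refine Finset.sum_le_sum fun K hK => ?_
    have hK0 := (mem_modes'.mp hK).1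
    rw [hψK, norm_smul, Real.norm_of_nonneg (hinv K).1, proj_of_mem hK]
    have h1 := lam1_le_lam (L := L) hK0
    have h2 : α ^ 2 * lam L K * (1 + α ^ 2 * lam L K)⁻¹ ≤ 1 := by
      rw [← div_eq_mul_inv, div_le_one (one_add_pos L α K)]; linarith
    have h3 : 0 ≤ α ^ 2 * lam L K * (1 + α ^ 2 * lam L K)⁻¹ :=
      mul_nonneg (mul_nonneg (sq_nonneg _) (lam_nonneg _ _)) (hinv K).1
    have h4 : (α ^ 2 * lam L K * (1 + α ^ 2 * lam L K)⁻¹) ^ 2 ≤ 1 := pow_le_one₀ h3 h2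
    have h5 : 0 ≤ lam L K := lam_nonneg L K
    calc (α ^ 2) ^ 2 * (lam1 L * (lam L K ^ 1 * ((1 + α ^ 2 * lam L K)⁻¹ * ‖h K‖) ^ 2))
        ≤ (α ^ 2) ^ 2 * (lam L K * (lam L K ^ 1 * ((1 + α ^ 2 * lam L K)⁻¹ * ‖h K‖) ^ 2)) := by
          gcongr
      _ = (α ^ 2 * lam L K * (1 + α ^ 2 * lam L K)⁻¹) ^ 2 * ‖h K‖ ^ 2 := by ring
      _ ≤ 1 * ‖h K‖ ^ 2 := by gcongr
      _ = _ := by ring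
  have h1 := (abs_le.mp (abs_innerV_le hL 0 hf hψt)).2
  have h2 := (abs_le.mp (abs_tri_le_six_two_three hL hc hu hu hψt)).1
  have h3 := interp_le hL (hψt.memV 1)
  set X := normV L 0 (proj M h)
  have hX : 0 ≤ X := normV_nonneg _ _ _
  have hU : 0 ≤ normV L 1 (u t) := normV_nonneg _ _ _
  have hs : 0 < √(lam1 L) := Real.sqrt_pos.mpr hl
  have n2 : normV L 1 ψ ≤ X / (α ^ 2 * √(lam1 L)) := by
    rw [le_div_iff₀ (by positivity)]; linarith
  have hq : lam1 L ^ (-1 / 4 : ℝ) / √(lam1 L) = (lam1 L ^ (3 / 4 : ℝ))⁻¹ := by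
    rw [Real.sqrt_eq_rpow, ← Real.rpow_sub hl, ← Real.rpow_neg hl.le]; norm_num
  have h4 : interp L ψ ≤ X / (α ^ 2 * lam1 L ^ (3 / 4 : ℝ)) := by
    refine h3.trans ((mul_le_mul_of_nonneg_left n2 (Real.rpow_nonneg hl.le _)).trans (le_of_eq ?_))
    calc _ = X / α ^ 2 * (lam1 L ^ (-1 / 4 : ℝ) / √(lam1 L)) := by field_simp
      _ = _ := by rw [hq]; field_simp
  have h5 : X ^ 2 ≤ (normV L 0 (f t) + c ^ 2 * normV L 1 (u t) ^ 2 /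
      (α ^ 2 * lam1 L ^ (3 / 4 : ℝ))) * X := by
    have h6 : normV L 0 (f t) * normV L 0 ψ ≤ normV L 0 (f t) * X :=
      mul_le_mul_of_nonneg_left n0 (normV_nonneg _ _ _)
    have h7 : c ^ 2 * (normV L 1 (u t) * normV L 1 (u t) * interp L ψ) ≤
        c ^ 2 * (normV L 1 (u t) * normV L 1 (u t) * (X / (α ^ 2 * lam1 L ^ (3 / 4 : ℝ)))) := by
      gcongr
    calc X ^ 2 ≤ normV L 0 (f t) * X +
          c ^ 2 * (normV L 1 (u t) * normV L 1 (u t) * (X / (α ^ 2 * lam1 L ^ (3 / 4 : ℝ)))) := by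
          linarith
      _ = _ := by ring
  by_cases hX0 : X = 0
  · rw [hX0]
    have := normV_nonneg L 0 (f t)
    have := Real.rpow_nonneg hl.le (3 / 4)
    positivity
  · have : 0 < X := lt_of_le_of_ne hX (Ne.symm hX0)
    nlinarith

end

section

/-! ### Sobolev inequalities for periodic functions -/

section gridlines
open Function
open scoped ENNReal

lemma sq_lintegral_mul_le {X : Type*} [MeasurableSpace X] (μ : Measure X) {f g : X → ℝ≥0∞}
    (hf : Measurable f) (hg : Measurable g) :
    (∫⁻ x, f x * g x ∂μ) ^ 2 ≤ (∫⁻ x, f x ^ 2 ∂μ) * ∫⁻ x, g x ^ 2 ∂μ := by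
  have h := ENNReal.lintegral_mul_le_Lp_mul_Lq μ Real.HolderConjugate.two_two hf.aemeasurable
    hg.aemeasurable
  simp only [Pi.mul_apply, ENNReal.rpow_two] at h
  refine (pow_le_pow_left' h 2).trans (le_of_eq ?_)
  rw [mul_pow, ← ENNReal.rpow_natCast, ← ENNReal.rpow_natCast, ← ENNReal.rpow_mul,
    ← ENNReal.rpow_mul]
  norm_num

variable {μ : Measure ℝ} [SigmaFinite μ] {a m : (Fin 3 → ℝ) → ℝ≥0∞}

lemma measurable_cons :
    Measurable fun p : ℝ × (Fin 2 → ℝ) => (Fin.cons p.1 p.2 : Fin 3 → ℝ) := by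
  refine measurable_pi_iff.mpr fun i => ?_
  refine Fin.cases measurable_fst (fun j => ?_) i
  exact (measurable_pi_apply j).comp measurable_snd

lemma lintegral_pi_eq_cons {f : (Fin 3 → ℝ) → ℝ≥0∞} (hf : Measurable f) :
    ∫⁻ x, f x ∂(Measure.pi fun _ => μ) =
      ∫⁻ z, ∫⁻ y : Fin 2 → ℝ, f (Fin.cons z y) ∂(Measure.pi fun _ => μ) ∂μ := by
  have h := (measurePreserving_piFinSuccAbove (fun _ : Fin 3 => μ) 0).symm
  rw [← h.lintegral_comp_emb (MeasurableEquiv.measurableEmbedding _), lintegral_prod]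
  · have e : ∀ z (y : Fin 2 → ℝ), (MeasurableEquiv.piFinSuccAbove (fun _ : Fin 3 => ℝ) 0).symm
        (z, y) = Fin.cons z y := fun z y => Fin.insertNth_zero' z y
    simp only [e]
  · exact (hf.comp (MeasurableEquiv.measurable _)).aemeasurable

lemma lintegral_pi_eq_cons' {f : (Fin 3 → ℝ) → ℝ≥0∞} (hf : Measurable f) :
    ∫⁻ x, f x ∂(Measure.pi fun _ => μ) =
      ∫⁻ y : Fin 2 → ℝ, ∫⁻ z, f (Fin.cons z y) ∂μ ∂(Measure.pi fun _ => μ) := by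
  rw [lintegral_pi_eq_cons hf, lintegral_lintegral_swap]
  exact (hf.comp measurable_cons).aemeasurable

/-- Ladyzhenskaya's inequality. -/
lemma lintegral_pow_four_le (ha : Measurable a) (hm : Measurable m)
    (h : ∀ x i, a x ^ 2 ≤ ∫⁻ s, a (update x i s) * m (update x i s) ∂μ) :
    (∫⁻ x, a x ^ 4 ∂(Measure.pi fun _ => μ)) ^ 2 ≤
      (∫⁻ x, a x ^ 2 ∂(Measure.pi fun _ => μ)) * (∫⁻ x, m x ^ 2 ∂(Measure.pi fun _ => μ)) ^ 3 := by
  set P := (Measure.pi fun _ : Fin 2 => μ)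
  set J := ∫⁻ x, a x * m x ∂(Measure.pi fun _ => μ) with hJ
  set R := ∫⁻ x, m x ^ 2 ∂(Measure.pi fun _ => μ) with hR
  have mcons : ∀ z : ℝ, Measurable fun y : Fin 2 → ℝ => (Fin.cons z y : Fin 3 → ℝ) := fun z =>
    measurable_cons.comp measurable_prodMk_left
  -- The hypothesis in the first coordinate direction, integrated over a slice, bounds the slice
  -- mass of a² uniformly in z.
  have h2 : ∀ z, ∫⁻ y, a (Fin.cons z y) ^ 2 ∂P ≤ J := fun z => by
    rw [hJ, lintegral_pi_eq_cons' (f := fun x => a x * m x) (ha.mul hm)]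
    refine lintegral_mono fun y => (h (Fin.cons z y) 0).trans (le_of_eq ?_)
    simp only [Fin.update_cons_zero]
  -- Within a slice the other two directions are used: a⁴ = a²·a² is at most a product of two line
  -- integrals, so its integral is at most (∫ a m)². Cauchy–Schwarz and the uniform slice bound
  -- follow.
  have h3 : ∀ z, ∫⁻ y, a (Fin.cons z y) ^ 4 ∂P ≤ J * ∫⁻ y, m (Fin.cons z y) ^ 2 ∂P := fun z => by
    have hp : Real.HolderConjugate (Fintype.card (Fin 2)) 2 := by
      simpa using Real.HolderConjugate.two_two
    have g := lintegral_prod_lintegral_pow_le (fun _ : Fin 2 => μ) hp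
      ((ha.comp (mcons z)).mul (hm.comp (mcons z)))
    calc _ ≤ _ := lintegral_mono fun y => ?_
      _ ≤ _ := g
      _ ≤ (∫⁻ y, a (Fin.cons z y) ^ 2 ∂P) * ∫⁻ y, m (Fin.cons z y) ^ 2 ∂P := by
        rw [ENNReal.rpow_two]
        exact sq_lintegral_mul_le P (ha.comp (mcons z)) (hm.comp (mcons z))
      _ ≤ _ := by gcongr; exact h2 z
    simp only [Fin.prod_univ_two, Function.comp, Pi.mul_apply, Fin.cons_update]
    norm_num
    rw [show a (Fin.cons z y) ^ 4 = a (Fin.cons z y) ^ 2 * a (Fin.cons z y) ^ 2 by ring]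
    exact mul_le_mul' (h (Fin.cons z y) 1) (h (Fin.cons z y) 2)
  have h4 : ∫⁻ x, a x ^ 4 ∂(Measure.pi fun _ => μ) ≤ J * R := by
    rw [lintegral_pi_eq_cons (ha.pow_const 4), hR, lintegral_pi_eq_cons (hm.pow_const 2)]
    refine (lintegral_mono h3).trans (le_of_eq (lintegral_const_mul _ ?_))
    exact ((hm.pow_const 2).comp measurable_cons).lintegral_prod_right'
  calc _ ≤ (J * R) ^ 2 := by gcongr
    _ = J ^ 2 * R ^ 2 := by ring
    _ ≤ _ * R * R ^ 2 := by gcongr; exact sq_lintegral_mul_le _ ha hm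
    _ = _ := by ring

/-- The Sobolev inequality, before cancelling. -/
lemma lintegral_pow_six_le (ha : Measurable a) (hm : Measurable m)
    (h : ∀ x i, a x ^ 4 ≤ ∫⁻ s, a (update x i s) ^ 3 * m (update x i s) ∂μ) :
    (∫⁻ x, a x ^ 6 ∂(Measure.pi fun _ => μ)) ^ 4 ≤
      (∫⁻ x, a x ^ 6 ∂(Measure.pi fun _ => μ)) ^ 3 *
        (∫⁻ x, m x ^ 2 ∂(Measure.pi fun _ => μ)) ^ 3 := by
  have hp : Real.HolderConjugate (Fintype.card (Fin 3)) (3 / 2) := by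
    rw [Real.holderConjugate_iff]; norm_num
  have g := lintegral_prod_lintegral_pow_le (fun _ : Fin 3 => μ) hp ((ha.pow_const 3).mul hm)
  have h1 : ∫⁻ x, a x ^ 6 ∂(Measure.pi fun _ => μ) ≤
      (∫⁻ x, a x ^ 3 * m x ∂(Measure.pi fun _ => μ)) ^ (3 / 2 : ℝ) := by
    refine (lintegral_mono fun x => ?_).trans g
    -- One factor (a⁴)^{1/2} for each direction, matching the exponent 1/(3 - 1) of the grid-line
    -- inequality.
    have e : a x ^ 6 = ∏ _i : Fin 3, (a x ^ 4) ^ ((1 : ℝ) / ((Fintype.card (Fin 3) : ℝ) - 1)) := by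
      rw [Finset.prod_const, ← ENNReal.rpow_natCast, ← ENNReal.rpow_natCast, ← ENNReal.rpow_natCast,
        ← ENNReal.rpow_mul, ← ENNReal.rpow_mul]
      norm_num
    rw [e]
    refine Finset.prod_le_prod' fun i _ => ?_
    refine ENNReal.rpow_le_rpow (h x i) ?_
    norm_num
  have h2 := sq_lintegral_mul_le (Measure.pi fun _ => μ) (ha.pow_const 3) hm
  simp only [← pow_mul] at h2
  norm_num at h2
  set A := ∫⁻ x, a x ^ 6 ∂(Measure.pi fun _ => μ)
  set J := ∫⁻ x, a x ^ 3 * m x ∂(Measure.pi fun _ => μ)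
  calc A ^ 4 ≤ (J ^ (3 / 2 : ℝ)) ^ 4 := by gcongr
    _ = (J ^ 2) ^ 3 := by
        rw [← ENNReal.rpow_natCast, ← ENNReal.rpow_natCast, ← ENNReal.rpow_natCast,
          ← ENNReal.rpow_mul, ← ENNReal.rpow_mul]
        norm_num
    _ ≤ (A * ∫⁻ x, m x ^ 2 ∂(Measure.pi fun _ => μ)) ^ 3 := by gcongr
    _ = _ := mul_pow _ _ _

end gridlines

/-- A periodic function is bounded by its mean plus half of its variation. -/
lemma le_integral_of_periodic {L : ℝ} (hL : 0 < L) {φ φ' e : ℝ → ℝ} (hφ : Function.Periodic φ L)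
    (he : Function.Periodic e L) (hd : ∀ x, HasDerivAt φ (φ' x) x) (hc : Continuous φ')
    (hec : Continuous e) (hle : ∀ x, |φ' x| ≤ 2 * e x) (x : ℝ) :
    φ x ≤ ∫ s in (0 : ℝ)..L, (φ s / L + e s) := by
  have hφc : Continuous φ := continuous_iff_continuousAt.mpr fun x => (hd x).continuousAt
  set E := ∫ s in (0 : ℝ)..L, e s
  -- The difference φ(x) - φ(y) is bounded by the variation along each of the two arcs, from y to x
  -- and from x to y + L. Averaging the two halves the total variation, which cancels the factor 2
  -- in |φ'| ≤ 2e.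
  have h1 : ∀ y ∈ Icc (x - L) x, φ x - E ≤ φ y := fun y hy => by
    have f1 := intervalIntegral.integral_eq_sub_of_hasDerivAt (a := y) (b := x)
      (fun s _ => hd s) (hc.intervalIntegrable _ _)
    have f2 := intervalIntegral.integral_eq_sub_of_hasDerivAt (a := x) (b := y + L)
      (fun s _ => hd s) (hc.intervalIntegrable _ _)
    have b1 := intervalIntegral.integral_mono_on (μ := volume) hy.2 (hc.intervalIntegrable _ _)
      ((hec.const_smul (2 : ℝ)).intervalIntegrable _ _) (fun s _ => (le_abs_self _).trans (hle s))
    have b2 := intervalIntegral.integral_mono_on (μ := volume) (by linarith [hy.1] : x ≤ y + L)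
      (hc.neg.intervalIntegrable _ _)
      ((hec.const_smul (2 : ℝ)).intervalIntegrable _ _) (fun s _ => (neg_le_abs _).trans (hle s))
    have e1 := intervalIntegral.integral_add_adjacent_intervals
      (hec.intervalIntegrable (μ := volume) y x) (hec.intervalIntegrable x (y + L))
    have e2 := he.intervalIntegral_add_eq y 0
    rw [zero_add] at e2
    simp only [Pi.smul_apply, Pi.neg_apply, smul_eq_mul, intervalIntegral.integral_const_mul,
      intervalIntegral.integral_neg] at b1 b2
    rw [hφ y] at f2
    simp only [E]
    linarith
  have h2 := intervalIntegral.integral_mono_on (μ := volume) (by linarith : x - L ≤ x)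
    (intervalIntegrable_const (c := φ x - E))
    (hφc.intervalIntegrable _ _) h1
  have e3 := hφ.intervalIntegral_add_eq (x - L) 0
  rw [zero_add, sub_add_cancel] at e3
  rw [intervalIntegral.integral_const, smul_eq_mul, e3, sub_sub_cancel] at h2
  rw [intervalIntegral.integral_add ((hφc.div_const L).intervalIntegrable _ _)
    (hec.intervalIntegrable _ _), intervalIntegral.integral_div]
  have : φ x - E ≤ (∫ s in (0 : ℝ)..L, φ s) / L := by
    rw [le_div_iff₀ hL, mul_comm]; exact h2
  simp only [E] at this
  linarith

end

/-! ### Grid-line and Sobolev bounds for trigonometric polynomials -/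

section

section fields
open Function
open scoped ENNReal

variable {L : ℝ} {M : ℕ} {d : Coeff}

lemma sum_mul_update (K : Fin 3 → ℤ) (x : Fin 3 → ℝ) (i : Fin 3) (s : ℝ) :
    ∑ j, (K j : ℂ) * (update x i s j : ℝ) = ∑ j, (K j : ℂ) * (update x i 0 j : ℝ) + K i * s := by
  fin_cases i <;> simp [Fin.sum_univ_three] <;> ring

lemma expo_update (L : ℝ) (K : Fin 3 → ℤ) (x : Fin 3 → ℝ) (i : Fin 3) (s : ℝ) :
    expo L K (update x i s) = Complex.exp (2 * π * Complex.I *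
      (∑ j, (K j : ℂ) * (update x i 0 j : ℝ) + K i * (s : ℂ)) / (L : ℂ)) := by
  rw [expo, sum_mul_update]

lemma hasDerivAt_spoly (L : ℝ) (M : ℕ) (c : (Fin 3 → ℤ) → ℂ) (x : Fin 3 → ℝ) (i : Fin 3) (s : ℝ) :
    HasDerivAt (fun s : ℝ => spoly L M c (update x i s))
      (spoly L M (fun K => 2 * π * Complex.I * (K i : ℂ) / L * c K) (update x i s)) s := by
  unfold spoly
  refine HasDerivAt.fun_sum fun K _ => ?_
  have h1 : HasDerivAt (fun s : ℝ => 2 * π * Complex.I *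
      (∑ j, (K j : ℂ) * (update x i 0 j : ℝ) + K i * (s : ℂ)) / (L : ℂ))
      (2 * π * Complex.I * (K i * 1) / L) s :=
    ((((Complex.ofRealCLM.hasDerivAt (x := s)).const_mul (K i : ℂ)).const_add _).const_mul
      _).div_const _
  have h2 := (h1.cexp).const_mul (c K)
  simp only [expo_update L K x i]
  refine h2.congr_deriv ?_
  ring

lemma periodic_expo (hL : 0 < L) (K : Fin 3 → ℤ) (x : Fin 3 → ℝ) (i : Fin 3) :
    Periodic (fun s => expo L K (update x i s)) L := fun s => by
  have hL' : (L : ℂ) ≠ 0 := by exact_mod_cast hL.ne'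
  simp only [expo_update L K x i]
  rw [Complex.exp_eq_exp_iff_exists_int]
  refine ⟨K i, ?_⟩
  push_cast
  field_simp
  ring

lemma periodic_spoly (hL : 0 < L) (M : ℕ) (c : (Fin 3 → ℤ) → ℂ) (x : Fin 3 → ℝ) (i : Fin 3) :
    Periodic (fun s => spoly L M c (update x i s)) L := fun s => by
  simp only [spoly]
  exact Finset.sum_congr rfl fun K _ => congrArg _ (periodic_expo hL K x i s)

lemma periodic_field (hL : 0 < L) (M : ℕ) (d : Coeff) (x : Fin 3 → ℝ) (i : Fin 3) :
    Periodic (fun s => field L M d (update x i s)) L := fun s => by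
  simp only [field]
  congr 1
  ext j
  exact congrArg Complex.re (periodic_spoly hL M _ x i s)

lemma periodic_gradField (hL : 0 < L) (M : ℕ) (d : Coeff) (x : Fin 3 → ℝ) (i : Fin 3) :
    Periodic (fun s => gradField L M d (update x i s)) L := fun s => by
  simp only [gradField]
  congr 1
  ext j
  exact congrArg Complex.re (periodic_spoly hL M _ x i s)

/-- Even powers of the modulus are used because |g| itself may fail to be differentiable at zeros of
g. -/
lemma hasDerivAt_field_sq (L : ℝ) (M : ℕ) (d : Coeff) (x : Fin 3 → ℝ) (i : Fin 3) (s : ℝ) :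
    HasDerivAt (fun s => ‖field L M d (update x i s)‖ ^ 2)
      (2 * ∑ j, field L M d (update x i s) j * gradField L M d (update x i s) (i, j)) s := by
  simp only [EuclideanSpace.norm_sq_eq, Real.norm_eq_abs, sq_abs]
  rw [Finset.mul_sum]
  refine HasDerivAt.fun_sum fun j _ => ?_
  have h := ((Complex.reCLM.hasFDerivAt).comp_hasDerivAt s
    (hasDerivAt_spoly L M (fun K => d K j) x i s)).pow 2
  refine h.congr_deriv ?_
  simp [field, gradField]
  ring

lemma abs_sum_mul_le (v : EuclideanSpace ℝ (Fin 3)) (B : EuclideanSpace ℝ (Fin 3 × Fin 3))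
    (i : Fin 3) : |∑ j, v j * B (i, j)| ≤ ‖v‖ * ‖B‖ := by
  refine abs_le_of_sq_le_sq ?_ (by positivity)
  rw [mul_pow, EuclideanSpace.norm_sq_eq, EuclideanSpace.norm_sq_eq, Fintype.sum_prod_type]
  simp only [Real.norm_eq_abs, sq_abs]
  refine (Finset.sum_mul_sq_le_sq_mul_sq _ _ _).trans ?_
  refine mul_le_mul_of_nonneg_left ?_ (Finset.sum_nonneg fun _ _ => sq_nonneg _)
  exact Finset.single_le_sum (f := fun i => ∑ j, B (i, j) ^ 2)
    (fun i _ => Finset.sum_nonneg fun j _ => sq_nonneg _) (Finset.mem_univ i)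

/-- The majorant `|g|/L + k |∇g|`. -/
def majorant (L : ℝ) (M : ℕ) (d : Coeff) (k : ℝ) (x : Fin 3 → ℝ) : ℝ :=
  L⁻¹ * ‖field L M d x‖ + k * ‖gradField L M d x‖

lemma continuous_majorant (L : ℝ) (M : ℕ) (d : Coeff) (k : ℝ) : Continuous (majorant L M d k) :=
  ((continuous_field L M d).norm.const_mul _).add ((continuous_gradField L M d).norm.const_mul _)

lemma enorm_majorant (hL : 0 < L) (M : ℕ) (d : Coeff) {k : ℝ} (hk : 0 ≤ k) (x : Fin 3 → ℝ) :
    ‖majorant L M d k x‖ₑ = ENNReal.ofReal (majorant L M d k x) := by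
  refine Real.enorm_of_nonneg ?_
  unfold majorant
  positivity

/-- The bound of a periodic function by its mean and variation along a grid line. -/
lemma ofReal_le_lintegral_line (hL : 0 < L) {φ φ' e : ℝ → ℝ} (hφ : Periodic φ L)
    (he : Periodic e L) (hd : ∀ x, HasDerivAt φ (φ' x) x) (hc : Continuous φ')
    (hec : Continuous e) (h0 : ∀ x, 0 ≤ φ x) (hle : ∀ x, |φ' x| ≤ 2 * e x) (x : ℝ) :
    ENNReal.ofReal (φ x) ≤ ∫⁻ s in Icc 0 L, ENNReal.ofReal (φ s / L + e s) := by
  have hφc : Continuous φ := continuous_iff_continuousAt.mpr fun x => (hd x).continuousAt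
  have h := le_integral_of_periodic hL hφ he hd hc hec hle x
  rw [intervalIntegral.integral_of_le hL.le, ← integral_Icc_eq_integral_Ioc] at h
  refine (ENNReal.ofReal_le_ofReal h).trans (le_of_eq ?_)
  refine ofReal_integral_eq_lintegral_ofReal ?_ (Eventually.of_forall fun s => ?_)
  · exact ((hφc.div_const L).add hec).continuousOn.integrableOn_compact isCompact_Icc
  · have h1 := (abs_nonneg _).trans (hle s)
    have h2 := h0 s
    have : 0 ≤ φ s / L := by positivity
    simp only [Pi.zero_apply]
    linarith

/-- The line bound for φ = |g|² with e = |g||∇g|: the integrand φ/L + e factors as |g| times the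
majorant with k = 1. -/
lemma enorm_field_sq_le (hL : 0 < L) (M : ℕ) (d : Coeff) (x : Fin 3 → ℝ) (i : Fin 3) :
    ‖field L M d x‖ₑ ^ 2 ≤ ∫⁻ s in Icc 0 L,
      ‖field L M d (update x i s)‖ₑ * ‖majorant L M d 1 (update x i s)‖ₑ := by
  have cu : Continuous fun s : ℝ => update x i s := continuous_const.update i continuous_id
  have cf := (continuous_field L M d).comp cu
  have cg := (continuous_gradField L M d).comp cu
  have h := ofReal_le_lintegral_line hL (φ := fun s => ‖field L M d (update x i s)‖ ^ 2)
    (e := fun s => ‖field L M d (update x i s)‖ * ‖gradField L M d (update x i s)‖)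
    (fun s => by simp only [periodic_field hL M d x i s])
    (fun s => by simp only [periodic_field hL M d x i s, periodic_gradField hL M d x i s])
    (hasDerivAt_field_sq L M d x i) ?_ (cf.norm.mul cg.norm) (fun _ => by positivity)
    (fun s => by
      rw [abs_mul, abs_two]
      exact mul_le_mul_of_nonneg_left (abs_sum_mul_le _ _ i) zero_le_two) (x i)
  · simp only [update_eq_self] at h
    rw [← ofReal_norm, ← ENNReal.ofReal_pow (norm_nonneg _)]
    refine h.trans (lintegral_mono fun s => le_of_eq ?_)
    rw [enorm_majorant hL _ _ zero_le_one, ← ofReal_norm, ← ENNReal.ofReal_mul (norm_nonneg _),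
      majorant]
    congr 1
    ring
  · refine continuous_const.mul (continuous_finsetSum _ fun j _ => ?_)
    exact ((EuclideanSpace.proj j).continuous.comp cf).mul
      ((EuclideanSpace.proj (i, j)).continuous.comp cg)

/-- The line bound for φ = |g|⁴ with e = 2|g|³|∇g|: the integrand factors as |g|³ times the majorant
with k = 2. -/
lemma enorm_field_pow_four_le (hL : 0 < L) (M : ℕ) (d : Coeff) (x : Fin 3 → ℝ) (i : Fin 3) :
    ‖field L M d x‖ₑ ^ 4 ≤ ∫⁻ s in Icc 0 L,
      ‖field L M d (update x i s)‖ₑ ^ 3 * ‖majorant L M d 2 (update x i s)‖ₑ := by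
  have cu : Continuous fun s : ℝ => update x i s := continuous_const.update i continuous_id
  have cf := (continuous_field L M d).comp cu
  have cg := (continuous_gradField L M d).comp cu
  have h := ofReal_le_lintegral_line hL (φ := fun s => (‖field L M d (update x i s)‖ ^ 2) ^ 2)
    (e := fun s => 2 * (‖field L M d (update x i s)‖ ^ 3 * ‖gradField L M d (update x i s)‖))
    (fun s => by simp only [periodic_field hL M d x i s])
    (fun s => by simp only [periodic_field hL M d x i s, periodic_gradField hL M d x i s])
    (fun s => (hasDerivAt_field_sq L M d x i s).pow 2) ?_
    (((cf.norm.pow 3).mul cg.norm).const_mul 2) (fun _ => by positivity)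
    (fun s => by
      have h1 := abs_sum_mul_le (field L M d (update x i s)) (gradField L M d (update x i s)) i
      norm_num
      set n := ‖field L M d (update x i s)‖
      calc 2 * n ^ 2 * (2 * _) ≤ 2 * n ^ 2 * (2 * (n * ‖gradField L M d (update x i s)‖)) := by
            gcongr
        _ = _ := by ring) (x i)
  · simp only [update_eq_self] at h
    rw [← ofReal_norm, ← ENNReal.ofReal_pow (norm_nonneg _)]
    rw [← pow_mul] at h
    refine h.trans (lintegral_mono fun s => le_of_eq ?_)
    rw [enorm_majorant hL _ _ zero_le_two, ← ofReal_norm, ← ENNReal.ofReal_pow (norm_nonneg _),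
      ← ENNReal.ofReal_mul (by positivity), majorant]
    congr 1
    ring
  · have h1 : Continuous fun s : ℝ => ∑ j, field L M d (update x i s) j *
        gradField L M d (update x i s) (i, j) := continuous_finsetSum _ fun j _ =>
      ((EuclideanSpace.proj j).continuous.comp cf).mul
        ((EuclideanSpace.proj (i, j)).continuous.comp cg)
    have h2 : Continuous fun s : ℝ => ‖field L M d (update x i s)‖ := cf.norm
    fun_prop

lemma restrict_cube (L : ℝ) : (volume : Measure (Fin 3 → ℝ)).restrict (cube L) =
    Measure.pi fun _ => (volume : Measure ℝ).restrict (Icc 0 L) := by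
  rw [cube, ← Set.pi_univ_Icc, volume_pi, Measure.restrict_pi_pi]
  rfl

lemma eLpNorm_pow_eq {X E : Type*} [MeasurableSpace X] [NormedAddCommGroup E] (μ : Measure X)
    (f : X → E) (n : ℕ) [NeZero n] : ∫⁻ x, ‖f x‖ₑ ^ n ∂μ = eLpNorm f n μ ^ n := by
  have h := eLpNorm_nnreal_pow_eq_lintegral (μ := μ) (f := f) (p := n)
    (by exact_mod_cast NeZero.ne n)
  simp only [NNReal.coe_natCast, ENNReal.rpow_natCast, ENNReal.coe_natCast] at h
  exact h.symm

/-- Since √λ₁ = 2π/L, Poincaré gives ‖g‖/L ≤ ‖∇g‖/(2π), and 1/6 comes from π > 3. The constant does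
not depend on L. -/
lemma eLpNorm_majorant_le (hL : 0 < L) (hd : IsTrig M d) {k : ℝ} (hk : 0 ≤ k) :
    eLpNorm (majorant L M d k) 2 (volume.restrict (cube L)) ≤
      ENNReal.ofReal ((1 / 6 + k) * normV L 1 d) := by
  have hn : L⁻¹ * normV L 0 d ≤ 1 / 6 * normV L 1 d := by
    have h := sqrt_mul_normV_le hL (hd.memV 1)
    have e : √(lam1 L) = 2 * π / L := by
      rw [lam1, show 4 * π ^ 2 / L ^ 2 = (2 * π / L) ^ 2 by ring, Real.sqrt_sq (by positivity)]
    rw [e] at h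
    have := pi_gt_three
    have h0 : 0 ≤ L⁻¹ * normV L 0 d := mul_nonneg (by positivity) (normV_nonneg _ _ _)
    have : 2 * π * (L⁻¹ * normV L 0 d) ≤ normV L 1 d := by
      rw [← mul_assoc, ← div_eq_mul_inv]; exact h
    nlinarith
  have h0 := eLpNorm_field hL hd 0 1 zero_le_one
  have h1 := eLpNorm_gradField hL hd 0 1 zero_le_one
  rw [← cube_eq] at h0 h1
  norm_num at h0 h1
  set μ := volume.restrict (cube L)
  have e : majorant L M d k = L⁻¹ • (fun x => ‖field L M d x‖) + k • fun x => ‖gradField L M d x‖ :=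
    rfl
  rw [e]
  refine (eLpNorm_add_le ((continuous_field L M d).norm.const_smul L⁻¹).aestronglyMeasurable
    ((continuous_gradField L M d).norm.const_smul k).aestronglyMeasurable (by norm_num)).trans ?_
  rw [eLpNorm_const_smul, eLpNorm_const_smul, eLpNorm_norm, eLpNorm_norm, h0, h1,
    Real.enorm_of_nonneg (by positivity), Real.enorm_of_nonneg hk,
    ← ENNReal.ofReal_mul (by positivity), ← ENNReal.ofReal_mul hk, ← ENNReal.ofReal_add
      (mul_nonneg (by positivity) (normV_nonneg _ _ _)) (mul_nonneg hk (normV_nonneg _ _ _))]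
  refine ENNReal.ofReal_le_ofReal ?_
  linarith

/-- Ladyzhenskaya's inequality on the torus, with an explicit constant. -/
lemma eLpNorm_four_field_le (hL : 0 < L) (hd : IsTrig M d) :
    eLpNorm (field L M d) 4 (volume.restrict (cube L)) ≤
      ENNReal.ofReal √(√3 * (interp L d * normV L 1 d)) := by
  have h := lintegral_pow_four_le (μ := volume.restrict (Icc 0 L))
    (continuous_field L M d).enorm.measurable (continuous_majorant L M d 1).enorm.measurable
    (enorm_field_sq_le hL M d)
  rw [← restrict_cube, eLpNorm_pow_eq, eLpNorm_pow_eq, eLpNorm_pow_eq] at h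
  have h0 := eLpNorm_field hL hd 0 1 zero_le_one
  rw [← cube_eq] at h0
  norm_num at h0
  have h1 := eLpNorm_majorant_le hL hd zero_le_one
  push_cast at h
  rw [h0] at h
  have n0 := normV_nonneg L 0 d
  have n1 := normV_nonneg L 1 d
  have ni := interp_nonneg L d
  refine (ENNReal.pow_le_pow_left_iff (n := 8) (by norm_num)).mp ?_
  calc _ = (eLpNorm (field L M d) 4 (volume.restrict (cube L)) ^ 4) ^ 2 := by rw [← pow_mul]
    _ ≤ _ := h
    _ ≤ ENNReal.ofReal (normV L 0 d) ^ 2 *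
        (ENNReal.ofReal ((1 / 6 + 1) * normV L 1 d) ^ 2) ^ 3 := by gcongr
    _ = ENNReal.ofReal (normV L 0 d ^ 2 * (((1 / 6 + 1) * normV L 1 d) ^ 2) ^ 3) := by
        rw [ENNReal.ofReal_mul (sq_nonneg (normV L 0 d)), ENNReal.ofReal_pow n0,
          ENNReal.ofReal_pow (by positivity), ENNReal.ofReal_pow (by positivity)]
    _ ≤ _ := by
        rw [← ENNReal.ofReal_pow (by positivity)]
        refine ENNReal.ofReal_le_ofReal ?_
        rw [show (8 : ℕ) = 2 * 2 * 2 from rfl, pow_mul, pow_mul, Real.sq_sqrt (by positivity),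
          mul_pow, mul_pow, mul_pow, mul_pow, Real.sq_sqrt (by norm_num), interp, mul_pow √_,
          Real.sq_sqrt (by positivity)]
        -- What remains is (7/6)⁶ ≤ 9 = (√3)⁴.
        have : 0 ≤ normV L 0 d ^ 2 * normV L 1 d ^ 6 := by positivity
        nlinarith

/-- Sobolev's inequality on the torus, for trigonometric polynomials. -/
lemma eLpNorm_six_field_le (hL : 0 < L) (hd : IsTrig M d) :
    eLpNorm (field L M d) 6 (volume.restrict (cube L)) ≤ ENNReal.ofReal (3 * normV L 1 d) := by
  have h := lintegral_pow_six_le (μ := volume.restrict (Icc 0 L))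
    (continuous_field L M d).enorm.measurable (continuous_majorant L M d 2).enorm.measurable
    (enorm_field_pow_four_le hL M d)
  rw [← restrict_cube, eLpNorm_pow_eq, eLpNorm_pow_eq] at h
  have h1 := eLpNorm_majorant_le hL hd zero_le_two
  have hfin : eLpNorm (field L M d) 6 (volume.restrict (cube L)) ≠ ⊤ := by
    rw [cube_eq]
    exact (memLp_bigCube (continuous_field L M d) L 0 1 6).eLpNorm_ne_top
  push_cast at h
  set A := eLpNorm (field L M d) 6 (volume.restrict (cube L)) with hA
  set m := eLpNorm (majorant L M d 2) 2 (volume.restrict (cube L))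
  by_cases hA0 : A = 0
  · rw [hA0]; exact zero_le
  have h2 : A ^ 6 ≤ m ^ 6 := by
    -- The common factor can be cancelled because A is nonzero and, for a continuous field on a
    -- compact cube, finite.
    have h3 : (A ^ 6) ^ 3 * A ^ 6 ≤ (A ^ 6) ^ 3 * m ^ 6 := by
      calc _ = (A ^ 6) ^ 4 := by ring
        _ ≤ _ := h
        _ = _ := by ring
    exact (ENNReal.mul_le_mul_iff_right (by positivity) (by finiteness)).mp h3
  refine ((ENNReal.pow_le_pow_left_iff (by norm_num)).mp h2).trans (h1.trans ?_)
  refine ENNReal.ofReal_le_ofReal ?_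
  have n1 := normV_nonneg L 1 d
  nlinarith

end fields

/-- The trilinear form with a repeated argument, with a constant whose fourth power is of order
`c⁴` only. -/
lemma exists_abs_tri_repeated_le {L c : ℝ} (hL : 0 < L) (hc : IsGNConstant L c) :
    ∃ κ : ℝ, 0 ≤ κ ∧ κ ^ 4 ≤ 3 * c ^ 4 ∧ ∀ (M : ℕ) (b d : Coeff), MemV 1 b → IsTrig M d →
      |tri L d b d| ≤ κ * (interp L d * normV L 1 d * normV L 1 b) := by
  have hc0 := hc.1
  -- The given L⁴ inequality allows κ = c², and c⁸ ≤ 3c⁴ exactly when c⁴ ≤ 3. Otherwise the explicit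
  -- inequality gives κ = √3, and κ⁴ = 9 ≤ 3c⁴.
  rcases le_total (c ^ 4) 3 with h | h
  · exact ⟨c ^ 2, by positivity, by nlinarith [pow_pos hc0 4],
      fun M b d hb hd => abs_tri_le_four_two_four hL hc hb hd⟩
  · refine ⟨√3, by positivity, ?_, fun M b d hb hd => ?_⟩
    · rw [show (4 : ℕ) = 2 * 2 from rfl, pow_mul, Real.sq_sqrt (by norm_num)]
      norm_num
      linarith
    · refine abs_tri_le_of_proj hL (hd.memV 1) hb hd fun m hm => ?_
      have td := hd.mono hm
      rw [td.proj_eq]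
      have h2 := normV_proj_le hL hb m
      have := normV_nonneg L 1 d
      have := interp_nonneg L d
      have h3 := abs_tri_trig_le hL td (hb.isField.isTrig_proj m) td 4 4 (Real.sqrt_nonneg _)
        (Real.sqrt_nonneg _) (eLpNorm_four_field_le hL td) (eLpNorm_four_field_le hL td)
      rw [Real.mul_self_sqrt (by positivity)] at h3
      calc _ ≤ _ := h3
        _ ≤ √3 * (interp L d * normV L 1 d) * normV L 1 b := by gcongr
        _ = _ := by ring

end

section

variable {L a b c ν : ℝ}

/-! ### Energy estimates for the nudged system -/

lemma innerV_proj_proj' (L : ℝ) (s : ℕ) {M N : ℕ} (h : N ≤ M) {z v : Coeff} (hz : IsField z) :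
    innerV L s (proj N z) (proj M v) = innerV L s (proj N z) (proj N v) := by
  rw [innerV_proj_proj L s h hz, ← innerV_proj_left L s le_rfl v (hz.isTrig_proj N), innerV_comm]

lemma normV_stokes (L : ℝ) (s : ℕ) (u : Coeff) : normV L s (stokes L u) = normV L (s + 2) u := by
  unfold normV
  congr 2
  refine tsum_congr fun K => ?_
  rw [stokes, norm_smul, Complex.norm_real, Real.norm_of_nonneg (lam_nonneg L K)]
  ring

lemma IsTrig.stokes {M : ℕ} {d : Coeff} (hd : IsTrig M d) (L : ℝ) : IsTrig M (stokes L d) :=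
  ⟨hd.1.stokes L, fun K hK => by rw [Bardina.stokes, hd.2 K hK, smul_zero]⟩

/-- (∇h, ∇d) = (h, Ad): both derivatives go to d, so h is needed only in L², and ‖Ad‖ is absorbed by
the dissipation of the filtered energy. -/
lemma abs_innerV_one_le (hL : 0 < L) {M : ℕ} {h d : Coeff} (hh : IsField h) (hd : IsTrig M d) :
    |innerV L 1 h d| ≤ normV L 0 (proj M h) * normV L 2 d := by
  have hp := hh.isTrig_proj M
  rw [← innerV_proj_left L 1 le_rfl h hd, innerV_comm, ← zero_add 1, ← innerV_stokes L 0 d hp,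
    innerV_comm, ← normV_stokes L 0 d]
  exact abs_innerV_le hL 0 (hp.memV 0) (hd.stokes L)

/-- The energy estimate for the nudged solution. -/
lemma energy_nudged_le (hL : 0 < L) (hc : IsGNConstant L c) (hν : 0 < ν) {f : ℝ → Coeff}
    (hf : IsForcing L f) (ha : 0 ≤ a) (hab : a ≤ b) {u w : ℝ → Coeff} {β η U₀ U₁ : ℝ} {N : ℕ}
    (hN : 0 < N) (hη : 0 < η) (hηN : η / (N : ℝ) ^ 2 ≤ ν * lam1 L / 2)
    (hu : ContV L (Icc a b) u) (hu0 : ∀ r ∈ Icc a b, normV L 0 (u r) ≤ U₀)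
    (hu1 : ∀ r ∈ Icc a b, normV L 1 (u r) ≤ U₁)
    (hw : Evolves L a b w (rate L ν β (nudgedForcing L β η N f u w) w)) :
    energy L β (w b) ≤ exp (-(η / 2 * (b - a))) * energy L β (w a)
      + (4 / η ^ 2 * supNorm L f ^ 2 + 2 * (U₀ ^ 2 + β ^ 2 * U₁ ^ 2)) := by
  obtain ⟨W, hW0, hW⟩ := hw.contV.exists_bound hL isCompact_Icc
  set F := supNorm L f
  have hF : 0 ≤ F := hf.supNorm_nonneg
  have hr : 0 ≤ lam1 L ^ (-1 / 4 : ℝ) := Real.rpow_nonneg (lam1_nonneg L) _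
  -- Young's inequality in (P_N u, P_N w) consumes half of the nudging 2η. The rest, completed by
  -- viscosity on high modes, damps at rate η; the forcing takes η/2 of this in L².
  have key := hw.energy_le hL hab (β := β) (k := η / 2)
    (B := 2 * (c ^ 2 * W * (lam1 L ^ (-1 / 4 : ℝ) * W)))
    (C := 2 * F ^ 2 / η + η * (U₀ ^ 2 + β ^ 2 * U₁ ^ 2))
    (by positivity) (by positivity) (by positivity) ?_
  · refine key.trans (le_of_eq ?_)
    congr 1
    field_simp
    ring
  · filter_upwards [eventually_ge_atTop N] with M hM
    filter_upwards [hf.ae_le] with r hr' hr0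
    obtain ⟨hf1, hf2⟩ := hr' (ha.trans hr0.1.le)
    have hrI := Ioo_subset_Icc_self hr0
    have mw := hw.contV.1 r hrI
    have mu := hu.1 r hrI
    have hd := mw.isField.isTrig_proj M
    have inner_pn : ∀ s, innerV L s (proj N (w r - u r)) (proj M (w r)) =
        normV L s (proj N (w r)) ^ 2 - innerV L s (proj N (u r)) (proj N (w r)) := fun s => by
      rw [innerV_proj_proj' L s hM (mw.isField.sub mu.isField), proj_sub,
        innerV_sub_left L s _ _ (mw.isField.isTrig_proj N), innerV_self hL]
    have e : innerV L 0 (filtered L β (rate L ν β (nudgedForcing L β η N f u w) w r))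
          (proj M (w r)) =
        innerV L 0 (f r) (proj M (w r)) - η * (innerV L 0 (proj N (w r - u r)) (proj M (w r))
          + β ^ 2 * innerV L 1 (proj N (w r - u r)) (proj M (w r)))
          - ν * (normV L 1 (proj M (w r)) ^ 2
          + β ^ 2 * normV L 2 (proj M (w r)) ^ 2) - tri L (w r) (w r) (proj M (w r)) := by
      rw [filtered_rate]
      have : rhs L ν β (nudgedForcing L β η N f u w) w r = f r -
          η • filtered L β (proj N (w r - u r))
          - ν • stokes L (filtered L β (w r)) - bilin L (w r) (w r) := by
        rw [← nudgedForcing_eq mu.isField mw.isField]; rfl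
      rw [this, innerV_sub_left L 0 _ _ hd, innerV_sub_left L 0 _ _ hd, innerV_sub_left L 0 _ _ hd,
        innerV_smul_left L 0 _ _ hd, innerV_smul_left L 0 _ _ hd,
        innerV_stokes L 0 _ hd, innerV_filtered L _ β _ hd, innerV_filtered L _ β _ hd,
        innerV_proj_self hL _ M mw.isField, innerV_proj_self hL _ M mw.isField, tri]
    rw [e, inner_pn, inner_pn]
    have h1 := abs_le.mp (abs_innerV_le hL 0 hf1 hd)
    have h2 := abs_le.mp (abs_tri_tail_le hL hc M mw mw (hW r hrI) (hW r hrI))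
    have hpw := mw.isField.isTrig_proj N
    have h30 := (abs_le.mp (abs_innerV_le hL 0 (mu.of_one.proj N) hpw)).2
    have h31 := (abs_le.mp (abs_innerV_le hL 1 (mu.proj N) hpw)).2
    have a0 := high_modes_absorb hL hν.le hN hηN (hd.memV (0 + 1)) (hd.memV 0)
    have a1 := high_modes_absorb hL hν.le hN hηN (hd.memV (1 + 1)) (hd.memV 1)
    rw [proj_proj hM] at a0 a1
    rw [zero_add] at a0
    norm_num at a1
    have u0 := (normV_proj_le hL mu.of_one N).trans (hu0 r hrI)
    have u1 := (normV_proj_le hL mu N).trans (hu1 r hrI)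
    have he : energy L β (proj M (w r)) = normV L 0 (proj M (w r)) ^ 2
      + β ^ 2 * normV L 1 (proj M (w r)) ^ 2 := rfl
    rw [he]
    set x0 := normV L 0 (proj M (w r))
    set x1 := normV L 1 (proj M (w r))
    set x2 := normV L 2 (proj M (w r))
    set q0 := normV L 0 (proj N (w r))
    set q1 := normV L 1 (proj N (w r))
    have hx0 : 0 ≤ x0 := normV_nonneg _ _ _
    have hq0 : 0 ≤ q0 := normV_nonneg _ _ _
    have hq1 : 0 ≤ q1 := normV_nonneg _ _ _
    have h3 : normV L 0 (f r) * x0 ≤ F * x0 := by gcongr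
    have h4 : 2 * (F * x0) ≤ 2 * F ^ 2 / η + η / 2 * x0 ^ 2 := by
      have : 2 * F ^ 2 / η + η / 2 * x0 ^ 2 - 2 * (F * x0) =
        2 * (F - η / 2 * x0) ^ 2 / η := by field_simp; ring
      have : 0 ≤ 2 * (F - η / 2 * x0) ^ 2 / η := by positivity
      linarith
    have young : ∀ {x y U : ℝ}, 0 ≤ x → y ≤ U → 2 * (η * (y * x)) ≤ η * x ^ 2 + η * U ^ 2 := by
      intro x y U hx hy
      have h5 : y * x ≤ U * x := by gcongr
      have h6 := two_mul_le_add_sq x U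
      have h7 : 2 * (y * x) ≤ x ^ 2 + U ^ 2 := by linarith
      have := mul_le_mul_of_nonneg_left h7 hη.le
      linarith
    have y0 := (mul_le_mul_of_nonneg_left h30 (by positivity : 0 ≤ 2 * η))
    have y0' := young hq0 u0
    have y1 := (mul_le_mul_of_nonneg_left h31 (by positivity : 0 ≤ β ^ 2 * (2 * η)))
    have y1' := mul_le_mul_of_nonneg_left (young hq1 u1) (sq_nonneg β)
    have a1' := mul_le_mul_of_nonneg_left a1 (sq_nonneg β)
    have p1 : 0 ≤ ν * x1 ^ 2 := by positivity
    have p2 : 0 ≤ β ^ 2 * (ν * x2 ^ 2) := by positivity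
    have p3 : 0 ≤ β ^ 2 * (η * x1 ^ 2) := by positivity
    linarith

/-- Young's inequality with exponents `4/3` and `4`. -/
lemma young_four (hν : 0 < ν) {k x y : ℝ} (hk : 0 ≤ k) (hx : 0 ≤ x) (hy : 0 ≤ y) :
    2 * (k * (√(x * y) * y)) ≤ ν * y ^ 2 + 27 / 16 * k ^ 4 / ν ^ 3 * x ^ 2 := by
  obtain ⟨A, hA, rfl⟩ : ∃ A, 0 ≤ A ∧ x = A ^ 2 := ⟨√x, Real.sqrt_nonneg _, (Real.sq_sqrt hx).symm⟩
  obtain ⟨B, hB, rfl⟩ : ∃ B, 0 ≤ B ∧ y = B ^ 2 := ⟨√y, Real.sqrt_nonneg _, (Real.sq_sqrt hy).symm⟩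
  rw [← mul_pow, Real.sqrt_sq (by positivity)]
  set p := k * A / ν with hp
  have hp0 : 0 ≤ p := by positivity
  -- As a quartic in B the difference of the two sides has a double root at the optimal point B =
  -- 3p/2, which fixes the constant 27/16.
  have h : 0 ≤ ν * ((B - 3 * p / 2) ^ 2 * (B ^ 2 + p * B + 3 / 4 * p ^ 2)) := by positivity
  have e : ν * ((B - 3 * p / 2) ^ 2 * (B ^ 2 + p * B + 3 / 4 * p ^ 2)) =
      ν * (B ^ 2) ^ 2 + 27 / 16 * k ^ 4 / ν ^ 3 * (A ^ 2) ^ 2 - 2 * (k * (A * B * B ^ 2)) := by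
    rw [hp]
    field_simp
    ring
  linarith

/-- The difference of the two equations, filtered with the parameter of the nudged one. -/
lemma filtered_rate_sub {α β η : ℝ} {N : ℕ} {f u w : ℝ → Coeff} {r : ℝ} (hu : IsField (u r))
    (hw : IsField (w r)) :
    filtered L β (rate L ν β (nudgedForcing L β η N f u w) w r - rate L ν α f u r) =
      -(η • filtered L β (proj N (w r - u r))) - ν • stokes L (filtered L β (w r - u r))
        - (bilin L (w r) (w r) - bilin L (u r) (u r))
        - (β ^ 2 - α ^ 2) • stokes L (transported L ν α f u r) := by
  have st : ∀ (z : Coeff) K, stokes L z K = lam L K • z K := fun z K => Complex.coe_smul _ _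
  ext1 K
  have e1 := congrFun (filtered_rate L ν β (nudgedForcing L β η N f u w) w r) K
  have e2 := congrFun (filtered_rate L ν α f u r) K
  rw [filtered_apply] at e1 e2
  simp only [rhs, st, filtered_apply, nudgedForcing_eq hu hw, Pi.sub_apply, Pi.smul_apply] at e1 e2
  simp only [st, filtered_apply, transported, Pi.sub_apply, Pi.neg_apply, Pi.smul_apply,
    Pi.add_apply]
  -- Changing the filter from β to α on u_t costs (β² - α²)A u_t. The viscous term costs ν(β² -
  -- α²)A²u likewise, and together they form the mismatch force.
  have e3 : (1 + β ^ 2 * lam L K) • rate L ν α f u r K = (1 + α ^ 2 * lam L K) • rate L ν α f u r K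
      + ((β ^ 2 - α ^ 2) * lam L K) • rate L ν α f u r K := by module
  rw [smul_sub, e1, e3, e2]
  module

/-- The energy estimate for the difference of the nudged and the reference solution. -/
lemma energy_diff_le (hL : 0 < L) (hc : IsGNConstant L c) (hν : 0 < ν) (hab : a ≤ b)
    {f u w : ℝ → Coeff} {α β η U Hb : ℝ} {N : ℕ}
    (hN : 0 < N) (hη : 0 < η) (hηN : η / (N : ℝ) ^ 2 ≤ ν * lam1 L / 2) (hβ : 0 < β)
    (hu1 : ∀ r ∈ Icc a b, normV L 1 (u r) ≤ U) (hηU : 27 * c ^ 4 * U ^ 4 / (8 * ν ^ 3) ≤ η)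
    (hu : Evolves L a b u (rate L ν α f u))
    (hw : Evolves L a b w (rate L ν β (nudgedForcing L β η N f u w) w))
    (hh : ∀ᵐ r, r ∈ Ioo a b → IsField (transported L ν α f u r) ∧
      ∀ M, normV L 0 (proj M (transported L ν α f u r)) ≤ Hb) :
    energy L β (w b - u b) ≤ exp (-(η / 2 * (b - a))) * energy L β (w a - u a)
      + 2 * (β ^ 2 - α ^ 2) ^ 2 * Hb ^ 2 / (ν * β ^ 2 * η) := by
  obtain ⟨κ, hκ0, hκ, hκt⟩ := exists_abs_tri_repeated_le hL hc
  have hg := hw.sub hL hu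
  obtain ⟨W, hW0, hW⟩ := hw.contV.exists_bound hL isCompact_Icc
  obtain ⟨Z, hZ0, hZ⟩ := hg.contV.exists_bound hL isCompact_Icc
  have hU0 : 0 ≤ U := (normV_nonneg L 1 (u a)).trans (hu1 a ⟨le_rfl, hab⟩)
  have hr : 0 ≤ lam1 L ^ (-1 / 4 : ℝ) := Real.rpow_nonneg (lam1_nonneg L) _
  -- Here κ⁴ ≤ 3c⁴ matters: (27/16)·3 = (3/2)·(27/8).
  have hkU : 27 / 16 * (κ * U) ^ 4 / ν ^ 3 ≤ 3 / 2 * η := by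
    have h1 : 27 / 16 * (κ * U) ^ 4 / ν ^ 3 ≤ 27 / 16 * (3 * c ^ 4 * U ^ 4) / ν ^ 3 := by
      rw [mul_pow]; gcongr
    have h2 : 27 / 16 * (3 * c ^ 4 * U ^ 4) / ν ^ 3 =
        3 / 2 * (27 * c ^ 4 * U ^ 4 / (8 * ν ^ 3)) := by field_simp; ring
    linarith
  -- Completing the nudging to all modes at rate 2η takes half of the dissipation. The other half of
  -- ν‖∇g‖² serves the trilinear term, which also takes 3η/2 of the L² damping and leaves η/2. The
  -- other half of νβ²‖Ag‖² serves the mismatch force.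
  have key := hg.energy_le hL hab (β := β) (k := η / 2)
    (B := 2 * (c ^ 2 * W * (lam1 L ^ (-1 / 4 : ℝ) * Z))
      + 2 * (c ^ 2 * (U * (lam1 L ^ (-1 / 4 : ℝ) * Z))))
    (C := (β ^ 2 - α ^ 2) ^ 2 * Hb ^ 2 / (ν * β ^ 2))
    (by positivity) (by positivity) (by positivity) ?_
  · refine key.trans (le_of_eq ?_)
    congr 1
    field_simp
  · filter_upwards [eventually_ge_atTop N] with M hM
    filter_upwards [hh] with r hr' hr0
    obtain ⟨ht, hH⟩ := hr' hr0
    have hrI := Ioo_subset_Icc_self hr0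
    have mw := hw.contV.1 r hrI
    have mu := hu.contV.1 r hrI
    have mg : MemV 1 (w r - u r) := mw.sub mu
    have hd := mg.isField.isTrig_proj M
    have hu1' := hu1 r hrI
    have hW' := hW r hrI
    have hZ' : normV L 1 (w r - u r) ≤ Z := hZ r hrI
    rw [filtered_rate_sub mu.isField mw.isField]
    set g := w r - u r with hgdef
    set d := proj M g with hddef
    -- B(w,w) - B(u,u) = B(w,g) + B(g,u). The first term and the part of the second with g - P_M g
    -- are tail errors; only (B(d,u),d) needs the large η.
    have eB : innerV L 0 (bilin L (w r) (w r) - bilin L (u r) (u r)) d =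
        tri L (w r) g d + tri L d (u r) d + tri L (g - d) (u r) d := by
      have e1 := bilin_sub_right hL mw.of_one mw mu
      have e2 := bilin_sub_left hL mw.of_one mu.of_one mu
      have e3 : bilin L (w r) (w r) - bilin L (u r) (u r) =
          bilin L (w r) g + bilin L g (u r) := by rw [hgdef, e1, e2]; abel
      have e4 : tri L g (u r) d = tri L d (u r) d + tri L (g - d) (u r) d := by
        rw [← tri_add_left hL (mg.of_one.proj M) (mg.of_one.sub_proj M) mu hd, add_sub_cancel]
      rw [e3, innerV_add_left L 0 _ _ hd, add_assoc, ← e4]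
      rfl
    have e : innerV L 0 (-(η • filtered L β (proj N g)) - ν • stokes L (filtered L β g)
        - (bilin L (w r) (w r) - bilin L (u r) (u r))
        - (β ^ 2 - α ^ 2) • stokes L (transported L ν α f u r)) d =
        -(η * (normV L 0 (proj N g) ^ 2 + β ^ 2 * normV L 1 (proj N g) ^ 2))
        - ν * (normV L 1 d ^ 2 + β ^ 2 * normV L 2 d ^ 2)
        - (tri L (w r) g d + tri L d (u r) d + tri L (g - d) (u r) d)
        - (β ^ 2 - α ^ 2) * innerV L 1 (transported L ν α f u r) d := by
      rw [← neg_smul, innerV_sub_left L 0 _ _ hd, innerV_sub_left L 0 _ _ hd,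
        innerV_sub_left L 0 _ _ hd, innerV_smul_left L 0 _ _ hd, innerV_smul_left L 0 _ _ hd,
        innerV_smul_left L 0 _ _ hd, innerV_stokes L 0 _ hd, innerV_stokes L 0 _ hd,
        innerV_filtered L _ β _ hd, innerV_filtered L _ β _ hd, eB, hddef,
        innerV_proj_self hL _ M mg.isField, innerV_proj_self hL _ M mg.isField,
        innerV_proj_proj' L 0 hM mg.isField, innerV_proj_proj' L 1 hM mg.isField,
        innerV_self hL, innerV_self hL]
      ring
    rw [e]
    have t1 := (abs_le.mp (abs_tri_tail_le hL hc M mw mg hW' hZ')).1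
    have t2 := (abs_le.mp (hκt M (u r) d mu hd)).1
    have t3 := (abs_le.mp (abs_tri_le_six_two_three hL hc (mg.sub_proj M) mu hd)).1
    have t4 := abs_innerV_one_le hL ht hd
    have a0 := high_modes_absorb hL hν.le hN hηN (hd.memV (0 + 1)) (hd.memV 0)
    have a1 := high_modes_absorb hL hν.le hN hηN (hd.memV (1 + 1)) (hd.memV 1)
    rw [hddef, proj_proj hM, ← hddef] at a0 a1
    rw [zero_add] at a0
    norm_num at a1
    have hi : interp L d ≤ lam1 L ^ (-1 / 4 : ℝ) * Z :=
      (interp_le hL (hd.memV 1)).trans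
        (mul_le_mul_of_nonneg_left ((normV_proj_le hL mg M).trans hZ') hr)
    have he : energy L β d = normV L 0 d ^ 2 + β ^ 2 * normV L 1 d ^ 2 := rfl
    rw [he]
    have y := young_four hν (mul_nonneg hκ0 hU0) (normV_nonneg L 0 d) (normV_nonneg L 1 d)
    have hi0 := interp_nonneg L d
    have hg0 := normV_nonneg L 1 (g - d)
    have t3' : c ^ 2 * (normV L 1 (g - d) * normV L 1 (u r) * interp L d) ≤
        c ^ 2 * (U * (lam1 L ^ (-1 / 4 : ℝ) * Z)) * normV L 1 (g - d) := by
      calc _ ≤ c ^ 2 * (normV L 1 (g - d) * U * (lam1 L ^ (-1 / 4 : ℝ) * Z)) := by gcongr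
        _ = _ := by ring
    have t2' : κ * (interp L d * normV L 1 d * normV L 1 (u r)) ≤
        κ * U * (√(normV L 0 d * normV L 1 d) * normV L 1 d) := by
      have := normV_nonneg L 1 d
      calc _ ≤ κ * (interp L d * normV L 1 d * U) := by gcongr
        _ = _ := by rw [interp]; ring
    set x0 := normV L 0 d
    set x1 := normV L 1 d
    set x2 := normV L 2 d
    set I := innerV L 1 (transported L ν α f u r) d
    have hx2 : 0 ≤ x2 := normV_nonneg _ _ _
    have t4' : |I| ≤ Hb * x2 := t4.trans (mul_le_mul_of_nonneg_right (hH M) hx2)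
    have y4 : -(2 * ((β ^ 2 - α ^ 2) * I)) ≤
        ν * (β ^ 2 * x2 ^ 2) + (β ^ 2 - α ^ 2) ^ 2 * Hb ^ 2 / (ν * β ^ 2) := by
      set D := β ^ 2 - α ^ 2
      have h1 : -(2 * (D * I)) ≤ 2 * (|D| * (Hb * x2)) := by
        have h2 : |D * I| ≤ |D| * (Hb * x2) := by rw [abs_mul]; gcongr
        have := (abs_le.mp h2).1
        linarith
      have h3 : ν * (β ^ 2 * x2 ^ 2) + D ^ 2 * Hb ^ 2 / (ν * β ^ 2) - 2 * (|D| * (Hb * x2)) =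
          (ν * β ^ 2 * x2 - |D| * Hb) ^ 2 / (ν * β ^ 2) := by
        rw [← sq_abs D]
        field_simp
        ring
      have : 0 ≤ (ν * β ^ 2 * x2 - |D| * Hb) ^ 2 / (ν * β ^ 2) := by positivity
      linarith
    have y' : 27 / 16 * (κ * U) ^ 4 / ν ^ 3 * x0 ^ 2 ≤ 3 / 2 * η * x0 ^ 2 := by gcongr
    have a1' := mul_le_mul_of_nonneg_left a1 (sq_nonneg β)
    have p3 : 0 ≤ β ^ 2 * (η * x1 ^ 2) := by positivity
    linarith

end

section

variable {L a b c ν : ℝ}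

/-! ### The parameter update -/

/-- `deriv` takes the value 0 where a mode is not differentiable. The identity holds where all modes
are differentiable, hence almost everywhere, which suffices under the integral. -/
lemma observed_eq {α : ℝ} {N : ℕ} {f u : ℝ → Coeff} {r : ℝ}
    (hu : ∀ K, HasDerivAt (fun s => u s K) (rate L ν α f u r K) r) :
    observed L ν N u r = proj N (transported L ν α f u r) := by
  rw [observed, transported]
  congr 2
  ext1 K
  exact (hu K).deriv

lemma timeDeriv_projDiff {N : ℕ} {u w : ℝ → Coeff} {u' w' : Coeff} {r : ℝ}
    (hu : ∀ K, HasDerivAt (fun s => u s K) (u' K) r)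
    (hw : ∀ K, HasDerivAt (fun s => w s K) (w' K) r) :
    timeDeriv (projDiff N u w) r = proj N (w' - u') := by
  ext1 K
  rw [timeDeriv]
  by_cases hK : K ∈ modes N
  · simp only [projDiff, proj_of_mem hK]
    exact ((hw K).sub (hu K)).deriv
  · simp only [projDiff, proj_of_notMem hK]
    exact deriv_const r 0

/-- The integrand of the update formula. -/
def updateIntegrand (L ν : ℝ) (u w : ℝ → Coeff) (N : ℕ) (β η s : ℝ) : ℝ :=
  innerV L 0 (timeDeriv (projDiff N u w) s) (observed L ν N u s)
      + β ^ 2 * innerV L 1 (timeDeriv (projDiff N u w) s) (observed L ν N u s)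
      + ν * innerV L 1 (projDiff N u w s) (observed L ν N u s)
      + ν * β ^ 2 * innerV L 1 (stokes L (projDiff N u w s)) (observed L ν N u s)
      + innerV L 0
          (proj N (bilin L (w s) (w s))
            - proj N (bilin L (w s - projDiff N u w s) (w s - projDiff N u w s)))
          (observed L ν N u s)
      + η * innerV L 0 (projDiff N u w s) (observed L ν N u s)
      + β ^ 2 * η * innerV L 1 (projDiff N u w s) (observed L ν N u s)

/-- The update is designed for this identity. Its linear terms are those of the difference equation
tested with h, so they cancel, and the mismatch force contributes -(β² - α²)‖∇h‖². Observable data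
replace the true nonlinear defect by one involving w - P_N g instead of u, and the substitution
error is what remains. -/
lemma updateIntegrand_eq (hL : 0 < L) {α β η : ℝ} {N : ℕ} {f u w : ℝ → Coeff} {r : ℝ}
    (mu : IsField (u r)) (mw : IsField (w r))
    (hu : ∀ K, HasDerivAt (fun s => u s K) (rate L ν α f u r K) r)
    (hw : ∀ K, HasDerivAt (fun s => w s K)
      (rate L ν β (nudgedForcing L β η N f u w) w r K) r)
    (hh : IsField (transported L ν α f u r)) :
    updateIntegrand L ν u w N β η r =
      innerV L 0 (bilin L (u r) (u r) - bilin L (w r - projDiff N u w r) (w r - projDiff N u w r))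
        (observed L ν N u r) - (β ^ 2 - α ^ 2) * normV L 1 (observed L ν N u r) ^ 2 := by
  have hd := hh.isTrig_proj N
  have e0 := observed_eq (N := N) hu
  rw [updateIntegrand, timeDeriv_projDiff hu hw, e0]
  set d := proj N (transported L ν α f u r) with hddef
  have e1 := congrArg (fun z => innerV L 0 z d) (filtered_rate_sub (L := L) (ν := ν) (α := α)
    (β := β) (η := η) (N := N) (f := f) mu mw)
  have e2 : innerV L 1 (transported L ν α f u r) d = normV L 1 d ^ 2 := innerV_proj_self hL 1 N hh
  simp only [← neg_smul] at e1
  rw [innerV_filtered L _ β _ hd, innerV_sub_left L 0 _ _ hd, innerV_sub_left L 0 _ _ hd,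
    innerV_sub_left L 0 _ _ hd, innerV_sub_left L 0 _ _ hd, innerV_smul_left L 0 _ _ hd,
    innerV_smul_left L 0 _ _ hd, innerV_smul_left L 0 _ _ hd, innerV_stokes L 0 _ hd,
    innerV_stokes L 0 _ hd, innerV_filtered L _ β _ hd, innerV_filtered L _ β _ hd] at e1
  simp only [zero_add, one_add_one_eq_two] at e1
  rw [e2] at e1
  simp only [projDiff]
  rw [← proj_sub, innerV_proj_left L 0 le_rfl _ hd, innerV_proj_left L 0 le_rfl _ hd,
    innerV_proj_left L 1 le_rfl _ hd, innerV_stokes L 1 _ hd, innerV_sub_left L 0 _ _ hd,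
    innerV_sub_left L 0 _ _ hd, innerV_proj_left L _ le_rfl (w r - u r) hd,
    innerV_proj_left L _ le_rfl (w r - u r) hd, innerV_proj_left L _ le_rfl (w r - u r) hd]
  rw [innerV_proj_left L _ le_rfl (w r - u r) hd, innerV_proj_left L _ le_rfl (w r - u r) hd] at e1
  rw [innerV_sub_left L 0 (bilin L (w r) (w r)) _ hd] at e1
  rw [innerV_sub_left L 0 (bilin L (u r) (u r)) _ hd]
  simp only [one_add_one_eq_two]
  linarith

/-- The consistency error of the update. -/
lemma abs_innerV_bilin_sub_le (hL : 0 < L) (hc : IsGNConstant L c) {N : ℕ} (hN : 0 < N)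
    {u w d : Coeff} (mu : MemV 1 u) (mw : MemV 1 w) (hd : IsTrig N d) {U W G : ℝ}
    (hU : normV L 1 u ≤ U) (hW : normV L 1 w ≤ W) (hG : normV L 1 (w - u) ≤ G) :
    |innerV L 0 (bilin L u u - bilin L (w - proj N (w - u)) (w - proj N (w - u))) d| ≤
      2 * c ^ 2 * lam1 L ^ (-1 / 4 : ℝ) * (U + W) * (√N)⁻¹ * G * normV L 1 d := by
  have mg := mw.sub mu
  set g := w - u with hg
  set q := g - proj N g with hq
  set v := w - proj N g with hv
  have mq : MemV 1 q := mg.sub_proj N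
  have mv : MemV 1 v := mw.sub (mg.proj N)
  -- Only unobserved modes separate v from u, so B(u,u) - B(v,v) = -(B(q,u) + B(v,q)).
  have hvq : v = u + q := by rw [hv, hq, hg]; abel
  -- Low modes come from u and high modes from w, whence ‖∇v‖ ≤ U + W.
  have hv' : v = proj N u + (w - proj N w) := by rw [hv, hg, proj_sub]; abel
  have e : innerV L 0 (bilin L u u - bilin L v v) d = -(tri L q u d + tri L v q d) := by
    have e1 : bilin L v v = bilin L v u + bilin L v q := by
      rw [← bilin_add_right hL mv.of_one mu mq, ← hvq]
    have e2 : bilin L v u = bilin L u u + bilin L q u := by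
      rw [← bilin_add_left hL mu.of_one mq.of_one mu, ← hvq]
    have e3 : bilin L u u - bilin L v v = (-1 : ℝ) • (bilin L q u + bilin L v q) := by
      rw [e1, e2]; module
    rw [e3, innerV_smul_left L 0 _ _ hd, innerV_add_left L 0 _ _ hd, tri, tri]
    ring
  rw [e, abs_neg]
  -- Both Hölder splittings place q in the interpolated norm; for B(v,q) this requires the
  -- integration by parts that moves the derivative to d.
  have t1 := abs_tri_le_three_two_six hL hc mq mu hd
  have t2 := abs_tri_le_six_three_two hL hc mv mq hd
  have hi := interp_high_modes_le hL mg hN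
  have hl : 0 ≤ lam1 L ^ (-1 / 4 : ℝ) := Real.rpow_nonneg (lam1_nonneg L) _
  have hqG : normV L 1 q ≤ G := (normV_sub_proj_le hL mg N).trans hG
  have hi' : interp L q ≤ lam1 L ^ (-1 / 4 : ℝ) * (√N)⁻¹ * G :=
    hi.trans (by gcongr)
  have hvR : normV L 1 v ≤ U + W := by
    rw [hv']
    exact (normV_add_le hL (mu.proj N) (mw.sub_proj N)).trans
      (add_le_add ((normV_proj_le hL mu N).trans hU) ((normV_sub_proj_le hL mw N).trans hW))
  have hW0 := (normV_nonneg L 1 w).trans hW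
  have huR : normV L 1 u ≤ U + W := by linarith
  have n1 := normV_nonneg L 1 d
  have n2 := interp_nonneg L q
  have n3 := normV_nonneg L 1 u
  have n4 := normV_nonneg L 1 v
  have hUW : 0 ≤ U + W := n4.trans hvR
  have b1 : |tri L q u d| ≤ c ^ 2 * (lam1 L ^ (-1 / 4 : ℝ) * (√N)⁻¹ * G * (U + W) * normV L 1 d) :=
    t1.trans (by gcongr; exact n2.trans hi')
  have b2 : |tri L v q d| ≤ c ^ 2 * ((U + W) * (lam1 L ^ (-1 / 4 : ℝ) * (√N)⁻¹ * G) * normV L 1 d) :=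
    t2.trans (by gcongr)
  refine (abs_add_le _ _).trans ((add_le_add b1 b2).trans (le_of_eq ?_))
  ring

/-! ### Integrability of the terms of the update -/

lemma intervalIntegrable_of_bdd {E : Type*} [NormedAddCommGroup E] (hab : a ≤ b) {p : ℝ → E} {C : ℝ}
    (hm : AEStronglyMeasurable p (volume.restrict (Ioc a b)))
    (hC : ∀ᵐ r ∂(volume.restrict (Ioc a b)), ‖p r‖ ≤ C) : IntervalIntegrable p volume a b := by
  rw [intervalIntegrable_iff_integrableOn_Ioc_of_le hab]
  exact ⟨hm, .restrict_of_bounded (C := C) (by simp) hC⟩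

lemma intervalIntegrable_re_inner (hab : a ≤ b) {p q : ℝ → EuclideanSpace ℂ (Fin 3)} {C D : ℝ}
    (hp : AEStronglyMeasurable p (volume.restrict (Ioc a b)))
    (hC : ∀ᵐ r ∂(volume.restrict (Ioc a b)), ‖p r‖ ≤ C)
    (hq : AEStronglyMeasurable q (volume.restrict (Ioc a b)))
    (hD : ∀ᵐ r ∂(volume.restrict (Ioc a b)), ‖q r‖ ≤ D) :
    IntervalIntegrable (fun r => (inner ℂ (p r) (q r)).re) volume a b := by
  refine intervalIntegrable_of_bdd hab (C := C * D)
    (Complex.continuous_re.comp_aestronglyMeasurable (hp.inner hq)) ?_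
  filter_upwards [hC, hD] with r h1 h2
  rw [Real.norm_eq_abs]
  refine (Complex.abs_re_le_norm _).trans ((norm_inner_le_norm _ _).trans ?_)
  gcongr
  exact (norm_nonneg _).trans h1

lemma ae_Ioc_of_Ioo {p : ℝ → Prop} (h : ∀ᵐ r, r ∈ Ioo a b → p r) :
    ∀ᵐ r ∂(volume.restrict (Ioc a b)), p r := by
  rw [← Measure.restrict_congr_set Ioo_ae_eq_Ioc, ae_restrict_iff' measurableSet_Ioo]
  exact h

end

/-! ### The observed field and the error of the updated parameter -/

section

variable {L a b c ν : ℝ}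

/-- The field `u_t + ν A u` exists almost everywhere on `(a,b)`, with `L²` norm at most `C`. -/
def BoundedTransport (L ν α : ℝ) (f u : ℝ → Coeff) (a b C : ℝ) : Prop :=
  ∀ᵐ r, r ∈ Ioo a b → IsField (transported L ν α f u r) ∧
    ∀ M, normV L 0 (proj M (transported L ν α f u r)) ≤ C

variable {α C : ℝ} {f u : ℝ → Coeff}

lemma intervalIntegrable_finsetSum {ι : Type*} {s : Finset ι} {p : ι → ℝ → ℝ}
    (h : ∀ i ∈ s, IntervalIntegrable (p i) volume a b) :
    IntervalIntegrable (fun r => ∑ i ∈ s, p i r) volume a b := by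
  have e : (fun r => ∑ i ∈ s, p i r) = ∑ i ∈ s, p i := by ext; simp
  rw [e]
  exact IntervalIntegrable.sum s h

lemma aestronglyMeasurable_observed (hL : 0 < L) (hab : a ≤ b) (hu : Evolves L a b u (rate L ν α f u))
    (N : ℕ) (K : Fin 3 → ℤ) :
    AEStronglyMeasurable (fun r => observed L ν N u r K) (volume.restrict (Ioc a b)) := by
  by_cases hK : K ∈ modes N
  · have h1 : AEStronglyMeasurable (fun r => rate L ν α f u r K) (volume.restrict (Ioc a b)) := by
      have := hu.integrable K
      rw [intervalIntegrable_iff_integrableOn_Ioc_of_le hab] at this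
      exact this.aestronglyMeasurable
    have h2 : ContinuousOn (fun r => (lam L K : ℂ) • u r K) (Ioc a b) :=
      ((hu.contV.continuousOn_coeff hL K).mono Ioc_subset_Icc_self).const_smul (lam L K : ℂ)
    refine (h1.add ((h2.aestronglyMeasurable measurableSet_Ioc).const_smul ν)).congr ?_
    filter_upwards [ae_Ioc_of_Ioo hu.ae_hasDerivAt] with r hr
    rw [observed_eq hr, proj_of_mem hK]
    rfl
  · simp only [observed, proj_of_notMem hK]
    exact aestronglyMeasurable_const

lemma norm_observed_le (hL : 0 < L) (hu : Evolves L a b u (rate L ν α f u))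
    (hh : BoundedTransport L ν α f u a b C) (N : ℕ) :
    ∀ᵐ r ∂(volume.restrict (Ioc a b)), ∀ K, ‖observed L ν N u r K‖ ≤ C / √(L ^ 3) := by
  filter_upwards [ae_Ioc_of_Ioo hu.ae_hasDerivAt, ae_Ioc_of_Ioo hh] with r hr h K
  rw [observed_eq hr, le_div_iff₀ (Real.sqrt_pos.mpr (by positivity)), mul_comm]
  have h3 := norm_coeff_le hL ((h.1.isTrig_proj N).memV 0) K
  rw [pow_zero, mul_one] at h3
  exact h3.trans (h.2 N)

lemma normV_observed_sq (hL : 0 < L) (N : ℕ) (u : ℝ → Coeff) (r : ℝ) :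
    normV L 1 (observed L ν N u r) ^ 2 =
      L ^ 3 * ∑ K ∈ modes N, lam L K ^ 1 * ‖observed L ν N u r K‖ ^ 2 :=
  normV_sq_of_support hL 1 fun K hK => by rw [observed, proj_of_notMem hK]

lemma intervalIntegrable_observed (hL : 0 < L) (hab : a ≤ b)
    (hu : Evolves L a b u (rate L ν α f u)) (hh : BoundedTransport L ν α f u a b C) (N : ℕ) :
    IntervalIntegrable (fun r => normV L 1 (observed L ν N u r) ^ 2) volume a b := by
  simp only [normV_observed_sq hL]
  refine IntervalIntegrable.const_mul ?_ _
  have h : ∀ K ∈ modes N, IntervalIntegrable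
      (fun r => lam L K ^ 1 * ‖observed L ν N u r K‖ ^ 2) volume a b := fun K _ => by
    refine IntervalIntegrable.const_mul (intervalIntegrable_of_bdd hab (C := (C / √(L ^ 3)) ^ 2)
      ((aestronglyMeasurable_observed hL hab hu N K).norm.pow 2) ?_) _
    filter_upwards [norm_observed_le hL hu hh N] with r hr
    rw [Pi.pow_apply, norm_pow, norm_norm]
    have := hr K
    gcongr
  exact intervalIntegrable_finsetSum h

lemma normV_observed_mono (hL : 0 < L) {M N : ℕ} (hMN : M ≤ N) (u : ℝ → Coeff) (r : ℝ) :
    normV L 1 (observed L ν M u r) ^ 2 ≤ normV L 1 (observed L ν N u r) ^ 2 := by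
  rw [observed, observed, normV_proj_sq hL, normV_proj_sq hL]
  refine mul_le_mul_of_nonneg_left ?_ (by positivity)
  refine Finset.sum_le_sum_of_subset_of_nonneg (modes_mono hMN) fun K _ _ => ?_
  have := lam_nonneg L K
  positivity

/-- Nondegeneracy is assumed at the level Nt, while the update divides by the energy at level N ≥
Nt. -/
lemma observedEnergy_mono (hL : 0 < L) (hab : a ≤ b) (hu : Evolves L a b u (rate L ν α f u))
    (hh : BoundedTransport L ν α f u a b C) {M N : ℕ} (hMN : M ≤ N) :
    observedEnergy L ν M u a b ≤ observedEnergy L ν N u a b :=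
  intervalIntegral.integral_mono_on hab (intervalIntegrable_observed hL hab hu hh M)
    (intervalIntegrable_observed hL hab hu hh N) fun r _ => normV_observed_mono hL hMN u r

/-- The error of the updated parameter. -/
lemma abs_updatedSq_sub_le (hL : 0 < L) (hc : IsGNConstant L c) (hab : a < b) {w : ℝ → Coeff}
    {β η U W G : ℝ} {N Nt : ℕ} (hN : 0 < N) (hNt : Nt ≤ N)
    (hδ : 0 < observedEnergy L ν Nt u a b) (hu : Evolves L a b u (rate L ν α f u))
    (hw : Evolves L a b w (rate L ν β (nudgedForcing L β η N f u w) w))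
    (hh : BoundedTransport L ν α f u a b C)
    (hU : ∀ r ∈ Icc a b, normV L 1 (u r) ≤ U) (hW : ∀ r ∈ Icc a b, normV L 1 (w r) ≤ W)
    (hG : ∀ r ∈ Icc a b, normV L 1 (w r - u r) ≤ G) :
    |updatedSq L ν u w N β η a b - α ^ 2| ≤
      2 * c ^ 2 * lam1 L ^ (-1 / 4 : ℝ) * (U + W) * (√N)⁻¹ * G /
        √(observedEnergy L ν Nt u a b / (b - a)) := by
  set A := 2 * c ^ 2 * lam1 L ^ (-1 / 4 : ℝ) * (U + W) * (√N)⁻¹ * G with hA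
  set δ := observedEnergy L ν N u a b with hδdef
  have hδN : observedEnergy L ν Nt u a b ≤ δ := observedEnergy_mono hL hab.le hu hh hNt
  have hδ0 : 0 < δ := hδ.trans_le hδN
  have hA0 : 0 ≤ A := by
    have ha : a ∈ Icc a b := ⟨le_rfl, hab.le⟩
    have := (normV_nonneg _ _ _).trans (hU a ha)
    have := (normV_nonneg _ _ _).trans (hW a ha)
    have := (normV_nonneg _ _ _).trans (hG a ha)
    have : 0 ≤ lam1 L ^ (-1 / 4 : ℝ) := Real.rpow_nonneg (lam1_nonneg L) _
    positivity
  set E : ℝ → ℝ := fun r => innerV L 0 (bilin L (u r) (u r) -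
    bilin L (w r - projDiff N u w r) (w r - projDiff N u w r)) (observed L ν N u r) with hE
  have hEint : IntervalIntegrable E volume a b := by
    have e : ∀ r, E r = L ^ 3 * ∑ K ∈ modes N, lam L K ^ 0 * (inner ℂ (observed L ν N u r K)
        (bilin L (u r) (u r) K -
          bilin L (w r - projDiff N u w r) (w r - projDiff N u w r) K)).re := fun r =>
      innerV_eq_sum L 0 _ fun K hK => by rw [observed, proj_of_notMem hK]
    rw [funext e]
    refine IntervalIntegrable.const_mul ?_ _
    have h : ∀ K ∈ modes N, IntervalIntegrable (fun r => lam L K ^ 0 *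
        (inner ℂ (observed L ν N u r K) (bilin L (u r) (u r) K -
          bilin L (w r - projDiff N u w r) (w r - projDiff N u w r) K)).re) volume a b :=
        fun K _ => by
      have hb : ContinuousOn (fun r => bilin L (u r) (u r) K -
          bilin L (w r - projDiff N u w r) (w r - projDiff N u w r) K) (Icc a b) :=
        (hu.contV.continuousOn_bilin hL K).sub ((hw.contV.sub hL
          ((hw.contV.sub hL hu.contV).proj hL N)).continuousOn_bilin hL K)
      obtain ⟨D, hD⟩ := isCompact_Icc.exists_bound_of_continuousOn hb
      refine IntervalIntegrable.const_mul (intervalIntegrable_re_inner hab.le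
        (C := C / √(L ^ 3)) (D := D) (aestronglyMeasurable_observed hL hab.le hu N K) ?_
        ((hb.mono Ioc_subset_Icc_self).aestronglyMeasurable measurableSet_Ioc) ?_) _
      · filter_upwards [norm_observed_le hL hu hh N] with r hr using hr K
      · rw [ae_restrict_iff' measurableSet_Ioc]
        exact Eventually.of_forall fun r hr => hD r (Ioc_subset_Icc_self hr)
    exact intervalIntegrable_finsetSum h
  have hHint := intervalIntegrable_observed hL hab.le hu hh N
  have hupd : updatedSq L ν u w N β η a b - α ^ 2 = 1 / δ * ∫ r in a..b, E r := by
    have h1 : ∫ r in a..b, updateIntegrand L ν u w N β η r =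
        ∫ r in a..b, (E r - (β ^ 2 - α ^ 2) * normV L 1 (observed L ν N u r) ^ 2) := by
      refine intervalIntegral.integral_congr_ae_restrict ?_
      rw [uIoc_of_le hab.le]
      have hI : ∀ᵐ r ∂(volume.restrict (Ioc a b)), r ∈ Ioc a b := ae_restrict_mem measurableSet_Ioc
      filter_upwards [ae_Ioc_of_Ioo hu.ae_hasDerivAt, ae_Ioc_of_Ioo hw.ae_hasDerivAt,
        ae_Ioc_of_Ioo hh, hI] with r h1 h2 h3 h4
      have h4' := Ioc_subset_Icc_self h4
      exact updateIntegrand_eq hL (hu.contV.1 r h4').isField (hw.contV.1 r h4').isField h1 h2 h3.1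
    have h2 : updatedSq L ν u w N β η a b =
        β ^ 2 + 1 / δ * ∫ r in a..b, updateIntegrand L ν u w N β η r := rfl
    rw [h2, h1, intervalIntegral.integral_sub hEint (hHint.const_mul _),
      intervalIntegral.integral_const_mul]
    have h3 : ∫ r in a..b, normV L 1 (observed L ν N u r) ^ 2 = δ := rfl
    rw [h3]
    field_simp
    ring
  have hΔ : 0 < b - a := sub_pos.mpr hab
  have sΔ := Real.sqrt_pos.mpr hΔ
  have sδ := Real.sqrt_pos.mpr hδ0
  -- The optimal weight in Young's inequality, so that its integrated form gives the Cauchy–Schwarz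
  -- bound ∫ ‖∇h‖ ≤ √(b - a) √δ.
  set θ := √(b - a) / √δ with hθ
  have hθ0 : 0 < θ := by positivity
  have hbd : |∫ r in a..b, E r| ≤ A * (√(b - a) * √δ) := by
    have h1 : ‖∫ r in a..b, E r‖ ≤ ∫ r in a..b, (A / 2 * θ *
        normV L 1 (observed L ν N u r) ^ 2 + A / 2 * θ⁻¹) := by
      refine intervalIntegral.norm_integral_le_of_norm_le hab.le ?_
        ((hHint.const_mul _).add intervalIntegrable_const)
      rw [← ae_restrict_iff' measurableSet_Ioc]
      have hI : ∀ᵐ r ∂(volume.restrict (Ioc a b)), r ∈ Ioc a b := ae_restrict_mem measurableSet_Ioc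
      filter_upwards [ae_Ioc_of_Ioo hu.ae_hasDerivAt, ae_Ioc_of_Ioo hh, hI] with r h1 h3 h4
      have h4' := Ioc_subset_Icc_self h4
      have hd : IsTrig N (observed L ν N u r) := by
        rw [observed_eq h1]; exact h3.1.isTrig_proj N
      have h5 := abs_innerV_bilin_sub_le hL hc hN (hu.contV.1 r h4') (hw.contV.1 r h4') hd
        (hU r h4') (hW r h4') (hG r h4')
      have h6 : ∀ y : ℝ, A * y ≤ A / 2 * θ * y ^ 2 + A / 2 * θ⁻¹ := fun y => by
        have e : A / 2 * θ * y ^ 2 + A / 2 * θ⁻¹ - A * y = A / 2 * θ * (y - θ⁻¹) ^ 2 := by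
          field_simp
          ring
        have : 0 ≤ A / 2 * θ * (y - θ⁻¹) ^ 2 := by positivity
        linarith
      exact h5.trans (h6 _)
    rw [intervalIntegral.integral_add (hHint.const_mul _) intervalIntegrable_const,
      intervalIntegral.integral_const_mul, intervalIntegral.integral_const, smul_eq_mul] at h1
    have h3 : ∫ r in a..b, normV L 1 (observed L ν N u r) ^ 2 = δ := rfl
    rw [h3] at h1
    refine h1.trans (le_of_eq ?_)
    have e1 : θ * δ = √(b - a) * √δ := by
      rw [hθ, div_mul_eq_mul_div, div_eq_iff sδ.ne', mul_assoc, Real.mul_self_sqrt hδ0.le]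
    have e2 : (b - a) * θ⁻¹ = √(b - a) * √δ := by
      rw [hθ, inv_div, mul_div_assoc', div_eq_iff sΔ.ne', mul_right_comm, Real.mul_self_sqrt hΔ.le]
    calc _ = A / 2 * (θ * δ) + A / 2 * ((b - a) * θ⁻¹) := by ring
      _ = _ := by rw [e1, e2]; ring
  rw [hupd, abs_mul, abs_of_pos (by positivity), one_div_mul_eq_div, Real.sqrt_div hδ.le,
    div_div_eq_mul_div, div_le_div_iff₀ hδ0 (Real.sqrt_pos.mpr hδ)]
  have h8 : √(observedEnergy L ν Nt u a b) ≤ √δ := Real.sqrt_le_sqrt hδN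
  calc _ ≤ A * (√(b - a) * √δ) * √δ := by gcongr
    _ = A * √(b - a) * (√δ * √δ) := by ring
    _ = _ := by rw [Real.mul_self_sqrt hδ0.le]

end

section

/-! ### The reference solution -/

/-- The data of the reference solution. -/
structure Reference (p : Constants) (f : ℝ → Coeff) (α : ℝ) (u : ℝ → Coeff) : Prop where
  hL : 0 < p.L
  gn : IsGNConstant p.L p.c
  hν : 0 < p.ν
  hα₀ : 0 < p.α₀
  forcing : IsForcing p.L f
  le_α : p.α₀ ≤ α
  α_le : α ≤ p.α₁
  solution : IsSolution p.L p.ν α f (Ici 0) u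
  init_zero : normV p.L 0 (u 0) ≤ p.MA
  init_one : normV p.L 1 (u 0) ≤ p.MB

lemma normV_zero_le_sqrt_energy (L β : ℝ) (u : Coeff) : normV L 0 u ≤ √(energy L β u) := by
  refine Real.le_sqrt_of_sq_le ?_
  have : 0 ≤ β ^ 2 * normV L 1 u ^ 2 := by positivity
  unfold energy
  linarith

lemma mul_normV_one_le_sqrt_energy (L : ℝ) (β : ℝ) (u : Coeff) :
    β * normV L 1 u ≤ √(energy L β u) := by
  refine Real.le_sqrt_of_sq_le ?_
  have : 0 ≤ normV L 0 u ^ 2 := by positivity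
  rw [mul_pow]
  unfold energy
  linarith

lemma sqrt_energy_le_errNorm (L : ℝ) {β : ℝ} (hβ : 0 ≤ β) (w u : Coeff) :
    √(energy L β (w - u)) ≤ errNorm L β w u := by
  have h0 := normV_nonneg L 0 (w - u)
  have h1 := mul_nonneg hβ (normV_nonneg L 1 (w - u))
  refine Real.sqrt_le_iff.mpr ⟨add_nonneg h0 h1, ?_⟩
  rw [energy, errNorm]
  nlinarith [mul_nonneg h0 h1]

lemma errNorm_le_sqrt_energy (L β : ℝ) (w u : Coeff) :
    errNorm L β w u ≤ √2 * √(energy L β (w - u)) := by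
  rw [← Real.sqrt_mul zero_le_two]
  refine Real.le_sqrt_of_sq_le ?_
  rw [errNorm, energy]
  nlinarith [sq_nonneg (normV L 0 (w - u) - β * normV L 1 (w - u))]

lemma sqrt_energy_sub_le {L : ℝ} (hL : 0 < L) {β : ℝ} (hβ : 0 ≤ β) {u w : Coeff} (hw : MemV 1 w)
    (hu : MemV 1 u) : √(energy L β (w - u)) ≤ 2 * (√(energy L β w) + √(energy L β u)) := by
  refine (sqrt_energy_le_errNorm L hβ w u).trans ?_
  have h0 := normV_sub_le hL hw.of_one hu.of_one
  have h1 := mul_le_mul_of_nonneg_left (normV_sub_le hL hw hu) hβ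
  have := normV_zero_le_sqrt_energy L β u
  have := normV_zero_le_sqrt_energy L β w
  have := mul_normV_one_le_sqrt_energy L β u
  have := mul_normV_one_le_sqrt_energy L β w
  rw [errNorm]
  linarith

namespace Constants

variable (p : Constants) (f : ℝ → Coeff)

lemma M1_nonneg (t : ℝ) : 0 ≤ p.M1 f t := Real.sqrt_nonneg _

lemma M1_anti {p : Constants} (hν : 0 ≤ p.ν) : Antitone (p.M1 f) := fun s t hst => by
  refine Real.sqrt_le_sqrt ?_
  unfold M1sq
  have : 0 ≤ p.ν * p.l1 := mul_nonneg hν (lam1_nonneg _)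
  gcongr

lemma M4_anti (wn : Coeff) (tn β : ℝ) {η : ℝ} (hη : 0 ≤ η) {s t : ℝ} (hst : s ≤ t) :
    p.M4 f wn tn β t η ≤ p.M4 f wn tn β s η := by
  refine Real.sqrt_le_sqrt ?_
  unfold M4sq
  gcongr

/-- The constant `S`. -/
def S (t : ℝ) : ℝ := 1 / p.ν ^ (1 / 2 : ℝ) * p.M3 f t + p.ν ^ (1 / 2 : ℝ) / p.α₀ * p.M2 f t

/-- The constant `R`. -/
def R (wn : Coeff) (tn β t η : ℝ) : ℝ := p.M1 f t / p.α₀ + p.M4 f wn tn β t η / β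

end Constants

section reference
variable {p : Constants} {f : ℝ → Coeff} {α : ℝ} {u : ℝ → Coeff} (h : Reference p f α u)
include h

lemma Reference.energy_le {t : ℝ} (ht : 0 ≤ t) : energy p.L α (u t) ≤ p.M1sq f t := by
  have h1 := energy_reference_le h.hL h.gn h.hν h.forcing h.solution ht
  refine h1.trans ?_
  unfold Constants.M1sq
  have h2 : energy p.L α (u 0) ≤ p.MA ^ 2 + p.α₁ ^ 2 * p.MB ^ 2 := by
    unfold energy
    have := normV_nonneg p.L 0 (u 0)
    have := normV_nonneg p.L 1 (u 0)
    have := h.init_zero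
    have := h.init_one
    have := h.α_le
    have := h.hα₀.le.trans h.le_α
    gcongr
  have := mul_le_mul_of_nonneg_left h2 (exp_pos (-(p.ν * p.l1 * t))).le
  exact add_le_add_left this _

lemma Reference.normV_zero_le {s t : ℝ} (hs : 0 ≤ s) (hst : s ≤ t) :
    normV p.L 0 (u t) ≤ p.M1 f s :=
  (normV_zero_le_sqrt_energy p.L α (u t)).trans
    ((Real.sqrt_le_sqrt (h.energy_le (hs.trans hst))).trans (Constants.M1_anti f h.hν.le hst))

lemma Reference.normV_one_le {s t : ℝ} (hs : 0 ≤ s) (hst : s ≤ t) :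
    normV p.L 1 (u t) ≤ p.M1 f s / p.α₀ := by
  rw [le_div_iff₀ h.hα₀, mul_comm]
  have h1 := (mul_normV_one_le_sqrt_energy p.L α (u t)).trans
    ((Real.sqrt_le_sqrt (h.energy_le (hs.trans hst))).trans (Constants.M1_anti f h.hν.le hst))
  exact (mul_le_mul_of_nonneg_right h.le_α (normV_nonneg _ _ _)).trans h1

lemma Reference.sqrt_energy_le {β t : ℝ} (hβ : 0 ≤ β) (ht : 0 ≤ t) :
    √(energy p.L β (u t)) ≤ (1 + β / p.α₀) * p.M1 f t := by
  have h0 := h.normV_zero_le ht le_rfl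
  have h1 := h.normV_one_le ht le_rfl
  have h2 := p.M1_nonneg f t
  have h3 := h.hα₀
  have h4 := normV_nonneg p.L 0 (u t)
  have h5 := normV_nonneg p.L 1 (u t)
  refine Real.sqrt_le_iff.mpr ⟨by positivity, ?_⟩
  calc energy p.L β (u t) ≤ p.M1 f t ^ 2 + β ^ 2 * (p.M1 f t / p.α₀) ^ 2 := by
        unfold energy; gcongr
    _ ≤ p.M1 f t ^ 2 + β ^ 2 * (p.M1 f t / p.α₀) ^ 2 + 2 * (β / p.α₀) * p.M1 f t ^ 2 :=
        le_add_of_nonneg_right (by positivity)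
    _ = _ := by ring

lemma Reference.evolves {a b : ℝ} (ha : 0 ≤ a) (hab : a ≤ b) :
    Evolves p.L a b u (rate p.L p.ν α f u) :=
  h.solution.evolves h.hL hab (fun _ hx => ha.trans hx.1) (h.forcing.intervalIntegrable h.hL ha hab)

/-- The estimate uses only ‖f‖ and ‖∇u‖ ≤ M₁/α₀, that is, the last two summands of M₃; the M₂
summand is nonnegative slack. -/
lemma Reference.boundedTransport {a b : ℝ} (ha : 0 ≤ a) (hab : a ≤ b) :
    BoundedTransport p.L p.ν α f u a b (p.M3 f a) := by
  have hev := h.evolves ha hab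
  filter_upwards [hev.ae_hasDerivAt, h.forcing.ae_le] with r h1 h2 hr
  obtain ⟨hf1, hf2⟩ := h2 (ha.trans hr.1.le)
  have mu := hev.contV.1 r (Ioo_subset_Icc_self hr)
  have hh : IsField (transported p.L p.ν α f u r) :=
    (hev.isField hr (h1 hr)).add ((mu.isField.stokes p.L).smul p.ν)
  have hα₀ := h.hα₀
  have hα : 0 < α := hα₀.trans_le h.le_α
  refine ⟨hh, fun M => (normV_proj_transported_le h.hL h.gn hα M hf1 mu hh).trans ?_⟩
  have h3 := h.normV_one_le ha hr.1.le
  have h4 := normV_nonneg p.L 1 (u r)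
  have hl : 0 < lam1 p.L ^ (3 / 4 : ℝ) := Real.rpow_pos_of_pos (lam1_pos h.hL) _
  have h5 : p.c ^ 2 * normV p.L 1 (u r) ^ 2 / (α ^ 2 * lam1 p.L ^ (3 / 4 : ℝ)) ≤
      p.c ^ 2 / (p.α₀ ^ 4 * p.l1 ^ (3 / 4 : ℝ)) * p.M1 f a ^ 2 := by
    have h6 := h.le_α
    calc _ ≤ p.c ^ 2 * (p.M1 f a / p.α₀) ^ 2 / (p.α₀ ^ 2 * lam1 p.L ^ (3 / 4 : ℝ)) := by gcongr
      _ = _ := by rw [Constants.l1]; field_simp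
  have h7 : 0 ≤ p.ν / p.α₀ * p.M2 f a :=
    mul_nonneg (div_nonneg h.hν.le hα₀.le) (Real.sqrt_nonneg _)
  unfold Constants.M3
  linarith

lemma Reference.M3_nonneg (t : ℝ) : 0 ≤ p.M3 f t := by
  have := h.hα₀
  have := h.hν
  have := h.forcing.supNorm_nonneg
  have : 0 < p.l1 := lam1_pos h.hL
  have := Real.sqrt_nonneg (p.M2sq f t)
  unfold Constants.M3 Constants.M2
  positivity

lemma Reference.S_nonneg (t : ℝ) : 0 ≤ p.S f t := by
  have := h.hα₀
  have := h.hν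
  have := h.M3_nonneg t
  have := Real.sqrt_nonneg (p.M2sq f t)
  unfold Constants.S Constants.M2
  positivity

lemma Reference.M3_sq_le (t : ℝ) : p.M3 f t ^ 2 ≤ p.ν * p.S f t ^ 2 := by
  have hν := h.hν
  have h1 : 1 / √p.ν * p.M3 f t ≤ p.S f t := by
    have := Real.sqrt_nonneg (p.M2sq f t)
    have := h.hα₀
    have : 0 ≤ p.ν ^ (1 / 2 : ℝ) / p.α₀ * p.M2 f t := by unfold Constants.M2; positivity
    unfold Constants.S
    rw [Real.sqrt_eq_rpow]
    linarith
  have h2 := Real.sqrt_pos.mpr hν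
  have h3 : p.M3 f t ≤ √p.ν * p.S f t := by
    rw [one_div, inv_mul_eq_div, div_le_iff₀ h2] at h1
    linarith
  calc _ ≤ (√p.ν * p.S f t) ^ 2 := pow_le_pow_left₀ (h.M3_nonneg t) h3 2
    _ = _ := by rw [mul_pow, Real.sq_sqrt hν.le]

end reference

/-! ### One step of the algorithm -/

/-- The data of one step of the algorithm, and the conditions that do not involve the current
error. -/
structure Step (p : Constants) (f u w : ℝ → Coeff) (tn th tn1 β η : ℝ) (Nt N : ℕ) : Prop where
  start_nonneg : 0 ≤ tn
  start_le : tn ≤ th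
  lt_stop : th < tn1
  β_pos : 0 < β
  η_pos : 0 < η
  energy_pos : 0 < observedEnergy p.L p.ν Nt u th tn1
  level : Nt ≤ N
  nudge_le : η / (N : ℝ) ^ 2 ≤ p.ν * p.l1 / 2
  nudge_ge : 27 * p.c ^ 4 * p.M1 f tn ^ 4 / (8 * p.ν ^ 3 * p.α₀ ^ 4) ≤ η
  solution : IsSolution p.L p.ν β (nudgedForcing p.L β η N f u w) (Icc tn tn1) w

section step
variable {p : Constants} {f : ℝ → Coeff} {α : ℝ} {u w : ℝ → Coeff} {tn th tn1 β η : ℝ} {Nt N : ℕ}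
  (h : Reference p f α u) (hs : Step p f u w tn th tn1 β η Nt N)
include hs

/-- With division by zero equal to 0 the condition on η/N² does not exclude N = 0. The positive
observed energy does: N = 0 forces Nt = 0, and then no mode is observed. -/
lemma Step.N_pos : 0 < N := by
  rcases Nat.eq_zero_or_pos N with h0 | h0
  · exfalso
    have h1 : Nt = 0 := Nat.le_zero.mp (h0 ▸ hs.level)
    have h2 := hs.energy_pos
    have h3 : ∀ r, observed p.L p.ν 0 u r = 0 := fun r => by
      ext1 K
      refine proj_of_notMem (fun hK => ?_) _
      have := mem_modes.mp hK
      norm_num at this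
      linarith
    simp [observedEnergy, h1, h3, normV_zero] at h2
  · exact h0

include h

lemma Step.evolves : Evolves p.L tn tn1 w (rate p.L p.ν β (nudgedForcing p.L β η N f u w) w) := by
  have hle := hs.start_le.trans hs.lt_stop.le
  refine hs.solution.evolves h.hL hle subset_rfl fun K => ?_
  exact integrable_nudgedForcing h.hL hle (h.forcing.intervalIntegrable h.hL hs.start_nonneg hle)
    (h.evolves hs.start_nonneg hle).contV hs.solution.contV K

lemma Step.energy_le {r : ℝ} (hr : r ∈ Icc tn tn1) :
    energy p.L β (w r) ≤ p.M4sq f (w tn) tn β r η := by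
  have h1 := energy_nudged_le h.hL h.gn h.hν h.forcing hs.start_nonneg hr.1 (N := N)
    (U₀ := p.M1 f tn) (U₁ := p.M1 f tn / p.α₀) hs.N_pos hs.η_pos hs.nudge_le
    (h.evolves hs.start_nonneg hr.1).contV
    (fun s hs' => h.normV_zero_le hs.start_nonneg hs'.1)
    (fun s hs' => h.normV_one_le hs.start_nonneg hs'.1)
    ((hs.evolves h).mono le_rfl hr.1 hr.2)
  refine h1.trans ?_
  have h2 : 0 ≤ p.M1 f tn ^ 2 := by positivity
  have h3 : 2 * (p.M1 f tn ^ 2 + β ^ 2 * (p.M1 f tn / p.α₀) ^ 2) =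
      2 * (1 + β ^ 2 / p.α₀ ^ 2) * p.M1 f tn ^ 2 := by ring
  rw [h3]
  unfold Constants.M4sq energy
  linarith

lemma Step.normV_one_le {s r : ℝ} (hsr : s ≤ r) (hr : r ∈ Icc tn tn1) :
    normV p.L 1 (w r) ≤ p.M4 f (w tn) tn β s η / β := by
  rw [le_div_iff₀ hs.β_pos, mul_comm]
  exact (mul_normV_one_le_sqrt_energy p.L β (w r)).trans
    ((Real.sqrt_le_sqrt (hs.energy_le h hr)).trans (p.M4_anti f _ _ _ hs.η_pos.le hsr))

lemma Step.sqrt_energy_init_le : √(energy p.L β (w tn - u tn)) ≤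
    2 * ((1 + β / p.α₀) * p.M1 f tn + p.M4 f (w tn) tn β tn η) := by
  have hle := hs.start_le.trans hs.lt_stop.le
  have h0 : tn ∈ Icc tn tn1 := ⟨le_rfl, hle⟩
  have h1 := sqrt_energy_sub_le h.hL hs.β_pos.le (hs.solution.memV tn h0)
    (h.solution.memV tn hs.start_nonneg)
  have h2 := h.sqrt_energy_le hs.β_pos.le hs.start_nonneg
  have h3 := Real.sqrt_le_sqrt (hs.energy_le h h0)
  rw [Constants.M4]
  linarith

/-- The square root of `energy_diff_le` with U = M₁(t_n)/α₀, where M₃² ≤ νS² bounds the mismatch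
force. Taking the root halves the rate η/2. -/
lemma Step.sqrt_energy_diff_le {r : ℝ} (hr : r ∈ Icc tn tn1) :
    √(energy p.L β (w r - u r)) ≤ exp (-(η / 4 * (r - tn))) * √(energy p.L β (w tn - u tn))
      + √2 * (|β ^ 2 - α ^ 2| * p.S f tn / (β * √η)) := by
  have hβ := hs.β_pos
  have hη := hs.η_pos
  have hν := h.hν
  have hα₀ := h.hα₀
  have hS := h.S_nonneg tn
  have h1 := energy_diff_le h.hL h.gn h.hν hr.1 (N := N) (U := p.M1 f tn / p.α₀)
    (Hb := p.M3 f tn) hs.N_pos hs.η_pos hs.nudge_le hβ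
    (fun s hs' => h.normV_one_le hs.start_nonneg hs'.1)
    (by refine le_trans (le_of_eq ?_) hs.nudge_ge; field_simp)
    (h.evolves hs.start_nonneg hr.1) ((hs.evolves h).mono le_rfl hr.1 hr.2)
    (h.boundedTransport hs.start_nonneg hr.1)
  set G₀ := energy p.L β (w tn - u tn)
  have hG₀ : 0 ≤ G₀ := energy_nonneg _ _ _
  have h2 : 2 * (β ^ 2 - α ^ 2) ^ 2 * p.M3 f tn ^ 2 / (p.ν * β ^ 2 * η) ≤
      (√2 * (|β ^ 2 - α ^ 2| * p.S f tn / (β * √η))) ^ 2 := by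
    calc _ ≤ 2 * (β ^ 2 - α ^ 2) ^ 2 * (p.ν * p.S f tn ^ 2) / (p.ν * β ^ 2 * η) := by
          gcongr; exact h.M3_sq_le tn
      _ = _ := by
          rw [mul_pow, Real.sq_sqrt zero_le_two, div_pow, mul_pow, mul_pow, Real.sq_sqrt hη.le,
            sq_abs]
          field_simp
  have h3 : exp (-(η / 2 * (r - tn))) * G₀ = (exp (-(η / 4 * (r - tn))) * √G₀) ^ 2 := by
    rw [mul_pow, Real.sq_sqrt hG₀, ← Real.exp_nat_mul]
    congr 2
    push_cast
    ring
  set A := exp (-(η / 4 * (r - tn))) * √G₀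
  set B := √2 * (|β ^ 2 - α ^ 2| * p.S f tn / (β * √η))
  have hA : 0 ≤ A := by positivity
  have hB : 0 ≤ B := by positivity
  refine Real.sqrt_le_iff.mpr ⟨add_nonneg hA hB, ?_⟩
  have := mul_nonneg hA hB
  nlinarith

/-- The error of the parameter after one step. -/
lemma Step.abs_updatedSq_sub_le :
    |updatedSq p.L p.ν u w N β η th tn1 - α ^ 2| ≤
      2 * p.c ^ 2 * p.l1 ^ (-1 / 4 : ℝ) * p.R f (w tn) tn β th η * (√N)⁻¹ *
        ((exp (-(η / 4 * (th - tn))) * √(energy p.L β (w tn - u tn))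
          + √2 * (|β ^ 2 - α ^ 2| * p.S f tn / (β * √η))) / β) /
        √(observedEnergy p.L p.ν Nt u th tn1 / (tn1 - th)) := by
  have hth := hs.start_nonneg.trans hs.start_le
  have hle := hs.lt_stop.le
  have hη := hs.η_pos
  have hsub : ∀ r ∈ Icc th tn1, r ∈ Icc tn tn1 := fun r hr => ⟨hs.start_le.trans hr.1, hr.2⟩
  refine Bardina.abs_updatedSq_sub_le h.hL h.gn hs.lt_stop hs.N_pos hs.level hs.energy_pos
    (h.evolves hth hle) ((hs.evolves h).mono hs.start_le hle le_rfl) (h.boundedTransport hth hle)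
    (fun r hr => h.normV_one_le hth hr.1) (fun r hr => hs.normV_one_le h hr.1 (hsub r hr))
    fun r hr => ?_
  rw [le_div_iff₀ hs.β_pos, mul_comm]
  refine (mul_normV_one_le_sqrt_energy p.L β _).trans ((hs.sqrt_energy_diff_le h (hsub r hr)).trans ?_)
  gcongr
  exact hr.1

end step

end

/-! ### Contraction of the errors over one step -/

section

section step
variable {p : Constants} {f : ℝ → Coeff} {α : ℝ} {u w : ℝ → Coeff} {tn th tn1 β η : ℝ} {Nt N : ℕ}
  {ε χ : ℝ} (h : Reference p f α u) (hs : Step p f u w tn th tn1 β η Nt N) (hε : 0 < ε)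
  (hχ : 0 ≤ χ) (sc : StepConditions p f ε χ (w tn) tn th tn1 β η
    (observedEnergy p.L p.ν Nt u th tn1 / (tn1 - th)) Nt N)

/-- The amplification factor of the high modes. -/
def gain (p : Constants) (f u w : ℝ → Coeff) (tn th tn1 β η : ℝ) (Nt N : ℕ) : ℝ :=
  2 * p.c ^ 2 * p.R f (w tn) tn β th η * (√N)⁻¹ /
    (β * √(observedEnergy p.L p.ν Nt u th tn1 / (tn1 - th)))

include hs sc in
lemma Step.gain_threshold : 4 * (p.l1 ^ (-1 / 4 : ℝ) * gain p f u w tn th tn1 β η Nt N *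
    (p.S f tn / (β * √η))) ≤ ε / (4 * |p.α₁ ^ 2 - p.α₀ ^ 2| * χ + 4 * ε) := by
  have hβ := hs.β_pos
  have hη := Real.sqrt_pos.mpr hs.η_pos
  have h1 := Real.sqrt_pos.mpr (div_pos hs.energy_pos (sub_pos.mpr hs.lt_stop))
  have h2 : 0 < √(N : ℝ) := Real.sqrt_pos.mpr (by exact_mod_cast hs.N_pos)
  refine le_trans (le_of_eq ?_) sc.modes
  have e : p.ν ^ (1 / 2 : ℝ) * p.M2 f tn / p.α₀ + p.M3 f tn / p.ν ^ (1 / 2 : ℝ) = p.S f tn := by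
    unfold Constants.S; ring
  have e' : p.M1 f th / p.α₀ + p.M4 f (w tn) tn β th η / β = p.R f (w tn) tn β th η := rfl
  rw [e, e', ← Real.sqrt_eq_rpow, ← Real.sqrt_eq_rpow, ← Real.sqrt_eq_rpow, gain]
  field_simp
  ring

include h hs

lemma Step.gain_nonneg : 0 ≤ gain p f u w tn th tn1 β η Nt N := by
  have := h.hα₀
  have := hs.β_pos
  have := p.M1_nonneg f th
  have := Real.sqrt_nonneg (p.M4sq f (w tn) tn β th η)
  unfold gain Constants.R Constants.M4
  positivity

lemma Step.abs_updatedSq_sub_le_gain :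
    |updatedSq p.L p.ν u w N β η th tn1 - α ^ 2| ≤
      p.l1 ^ (-1 / 4 : ℝ) * gain p f u w tn th tn1 β η Nt N *
        (exp (-(η / 4 * (th - tn))) * √(energy p.L β (w tn - u tn))) +
      p.l1 ^ (-1 / 4 : ℝ) * gain p f u w tn th tn1 β η Nt N *
        (√2 * (|β ^ 2 - α ^ 2| * p.S f tn / (β * √η))) := by
  refine (hs.abs_updatedSq_sub_le h).trans (le_of_eq ?_)
  have := hs.β_pos
  have h1 := Real.sqrt_pos.mpr (div_pos hs.energy_pos (sub_pos.mpr hs.lt_stop))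
  unfold gain
  rw [← mul_add]
  field_simp

include sc in
-- The factor μ covers the change of weight from β to the next parameter β'. With G the initial
-- energy root, X = νλ₁^{3/4} and D = |β² - α²|, decay over the step gives at most 2·(1/8)G and the
-- mismatch at most 2·(X/16)D, hence G/4 + XD/8.
lemma Step.errNorm_le {β' : ℝ} (h1 : β' ≤ √ε + p.α₁) :
    errNorm p.L β' (w tn1) (u tn1) ≤
      (errNorm p.L β (w tn) (u tn) + p.ν * p.l1 ^ (3 / 4 : ℝ) * |β ^ 2 - α ^ 2|) / 4 := by
  have hβ := hs.β_pos
  have hη := Real.sqrt_pos.mpr hs.η_pos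
  have hle := hs.start_le.trans hs.lt_stop.le
  have k1 := hs.sqrt_energy_diff_le h (r := tn1) ⟨hle, le_rfl⟩
  have k2 := sqrt_energy_le_errNorm p.L hβ.le (w tn) (u tn)
  have k3 := errNorm_le_sqrt_energy p.L β (w tn1) (u tn1)
  have k4 := sc.decay
  have k5 := sc.nudge_ge'
  set μ := max 1 ((√ε + p.α₁) / β)
  have hμ1 : 1 ≤ μ := le_max_left _ _
  have hμ : β' ≤ μ * β := by
    have : (√ε + p.α₁) / β ≤ μ := le_max_right _ _
    rw [div_le_iff₀ hβ] at this
    exact h1.trans this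
  have k6 : errNorm p.L β' (w tn1) (u tn1) ≤ μ * errNorm p.L β (w tn1) (u tn1) := by
    unfold errNorm
    have n0 := normV_nonneg p.L 0 (w tn1 - u tn1)
    have n1 := normV_nonneg p.L 1 (w tn1 - u tn1)
    calc _ ≤ μ * normV p.L 0 (w tn1 - u tn1) + μ * β * normV p.L 1 (w tn1 - u tn1) := by
          gcongr; exact le_mul_of_one_le_left n0 hμ1
      _ = _ := by ring
  have k5' : μ * p.S f tn * (16 / β) ≤ √η * p.ν * p.l1 ^ (3 / 4 : ℝ) := by
    rw [Real.sqrt_eq_rpow η]; exact k5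
  have k7 : μ * (p.S f tn / (β * √η)) ≤ p.ν * p.l1 ^ (3 / 4 : ℝ) / 16 := by
    rw [mul_div_assoc', div_le_div_iff₀ (by positivity) (by norm_num)]
    rw [mul_div_assoc', div_le_iff₀ hβ] at k5'
    linarith
  set X := p.ν * p.l1 ^ (3 / 4 : ℝ)
  set G := √(energy p.L β (w tn - u tn))
  set D := |β ^ 2 - α ^ 2|
  have hD : 0 ≤ D := abs_nonneg _
  have hG : 0 ≤ G := Real.sqrt_nonneg _
  have hs2 : √2 ≤ 2 := Real.sqrt_le_iff.mpr (by norm_num)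
  have k4' := mul_le_mul_of_nonneg_right k4 hG
  have k7' := mul_le_mul_of_nonneg_left k7 hD
  have hμ0 : 0 ≤ μ := zero_le_one.trans hμ1
  calc _ ≤ μ * (√2 * √(energy p.L β (w tn1 - u tn1))) :=
        k6.trans (mul_le_mul_of_nonneg_left k3 hμ0)
    _ ≤ μ * (√2 * (exp (-(η / 4 * (tn1 - tn))) * G + √2 * (D * p.S f tn / (β * √η)))) := by gcongr
    _ = √2 * (μ * exp (-(η / 4 * (tn1 - tn))) * G)
        + (√2 * √2) * (D * (μ * (p.S f tn / (β * √η)))) := by ring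
    _ ≤ 2 * (1 / 8 * G) + (√2 * √2) * (D * (X / 16)) := by gcongr
    _ = 1 / 4 * G + X * D / 8 := by rw [Real.mul_self_sqrt zero_le_two]; ring
    _ ≤ _ := by
        have : 0 ≤ X * D := by
          have := h.hν
          have : 0 < p.l1 ^ (3 / 4 : ℝ) := Real.rpow_pos_of_pos (lam1_pos h.hL) _
          positivity
        linarith

include sc hε

/-- This bound uses the a priori size of w and u instead of the current error, so it does not
deteriorate with a bad initial guess. The transient contributes at most ε/4 and the mismatch ε/8. -/
lemma Step.parameter_le_eps
    (hD : |β ^ 2 - α ^ 2| * (ε / (4 * |p.α₁ ^ 2 - p.α₀ ^ 2| * χ + 4 * ε)) ≤ ε / 4) :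
    |updatedSq p.L p.ν u w N β η th tn1 - α ^ 2| ≤ ε := by
  have hl : 0 < p.l1 := lam1_pos h.hL
  have hβ := hs.β_pos
  have k0 := hs.abs_updatedSq_sub_le_gain h
  have k1 := hs.gain_threshold sc
  have k2 := hs.sqrt_energy_init_le h
  set Y := (1 + β / p.α₀) * p.M1 f tn + p.M4 f (w tn) tn β tn η
  have k3 : 4 * (p.l1 ^ (-1 / 4 : ℝ) * gain p f u w tn th tn1 β η Nt N) *
      exp (-(η / 4 * (th - tn))) * Y ≤ ε / 2 := by
    have h1 := Real.sqrt_pos.mpr (div_pos hs.energy_pos (sub_pos.mpr hs.lt_stop))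
    have h2 : 0 < √(N : ℝ) := Real.sqrt_pos.mpr (by exact_mod_cast hs.N_pos)
    have := sc.decay_modes'
    have e' : p.M1 f th / p.α₀ + p.M4 f (w tn) tn β th η / β = p.R f (w tn) tn β th η := rfl
    rw [e', ← Real.sqrt_eq_rpow, ← Real.sqrt_eq_rpow] at this
    refine le_trans (le_of_eq ?_) this
    rw [gain]
    field_simp
    ring
  have hg := hs.gain_nonneg h
  have hl14 : 0 < p.l1 ^ (-1 / 4 : ℝ) := Real.rpow_pos_of_pos hl _
  set g := p.l1 ^ (-1 / 4 : ℝ) * gain p f u w tn th tn1 β η Nt N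
  have hg' : 0 ≤ g := mul_nonneg hl14.le hg
  set e := exp (-(η / 4 * (th - tn))) with he
  set D := |β ^ 2 - α ^ 2|
  have hD0 : 0 ≤ D := abs_nonneg _
  have he0 : 0 ≤ e := (exp_pos _).le
  have b1 : g * (e * √(energy p.L β (w tn - u tn))) ≤ ε / 4 := by
    calc _ ≤ g * (e * (2 * Y)) := by gcongr
      _ = (4 * g * e * Y) / 2 := by ring
      _ ≤ _ := by linarith
  have hs2 : √2 ≤ 2 := Real.sqrt_le_iff.mpr (by norm_num)
  have b3 : g * (√2 * (D * p.S f tn / (β * √η))) ≤ ε / 8 := by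
    calc _ = √2 / 4 * (D * (4 * (g * (p.S f tn / (β * √η))))) := by ring
      _ ≤ 2 / 4 * (ε / 4) :=
        mul_le_mul (by gcongr) ((mul_le_mul_of_nonneg_left k1 hD0).trans hD)
          (by have := h.S_nonneg tn; positivity) (by positivity)
      _ = _ := by ring
  linarith

include hχ

/-- Unlike `Step.parameter_le_eps` this is proportional to the current error. Multiplication by
λ₁^{3/4} turns the factor λ₁^{-1/4} into √λ₁, which `decay_modes` cancels; the threshold ε/(… + 4ε)
≤ 1/4 handles the mismatch. -/
lemma Step.parameter_le : p.ν * p.l1 ^ (3 / 4 : ℝ) * |updatedSq p.L p.ν u w N β η th tn1 - α ^ 2| ≤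
    (errNorm p.L β (w tn) (u tn) + p.ν * p.l1 ^ (3 / 4 : ℝ) * |β ^ 2 - α ^ 2|) / 8 := by
  have hl : 0 < p.l1 := lam1_pos h.hL
  have hν := h.hν
  have hβ := hs.β_pos
  have k0 := hs.abs_updatedSq_sub_le_gain h
  have k1 := hs.gain_threshold sc
  have k2 := sqrt_energy_le_errNorm p.L hβ.le (w tn) (u tn)
  have k3 : 2 * gain p f u w tn th tn1 β η Nt N * exp (-(η / 4 * (th - tn))) ≤
      1 / (4 * p.ν * √p.l1) := by
    have h1 := Real.sqrt_pos.mpr (div_pos hs.energy_pos (sub_pos.mpr hs.lt_stop))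
    have h2 : 0 < √(N : ℝ) := Real.sqrt_pos.mpr (by exact_mod_cast hs.N_pos)
    have := sc.decay_modes
    have e' : p.M1 f th / p.α₀ + p.M4 f (w tn) tn β th η / β = p.R f (w tn) tn β th η := rfl
    rw [e', ← Real.sqrt_eq_rpow, ← Real.sqrt_eq_rpow, ← Real.sqrt_eq_rpow] at this
    refine le_trans (le_of_eq ?_) this
    rw [gain]
    field_simp
    ring
  have hg := hs.gain_nonneg h
  set g := gain p f u w tn th tn1 β η Nt N
  set e := exp (-(η / 4 * (th - tn)))
  set G := √(energy p.L β (w tn - u tn))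
  set D := |β ^ 2 - α ^ 2|
  have hD : 0 ≤ D := abs_nonneg _
  have hG : 0 ≤ G := Real.sqrt_nonneg _
  have hω : ε / (4 * |p.α₁ ^ 2 - p.α₀ ^ 2| * χ + 4 * ε) ≤ 1 / 4 := by
    have : 0 ≤ 4 * |p.α₁ ^ 2 - p.α₀ ^ 2| * χ := by positivity
    rw [div_le_div_iff₀ (by positivity) (by norm_num)]
    linarith
  have hsl := Real.sqrt_pos.mpr hl
  have b1 : p.ν * √p.l1 * (g * e) ≤ 1 / 8 := by
    rw [le_div_iff₀ (by positivity)] at k3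
    linarith
  have el : p.l1 ^ (3 / 4 : ℝ) * p.l1 ^ (-1 / 4 : ℝ) = √p.l1 := by
    rw [← Real.rpow_add hl, Real.sqrt_eq_rpow]; norm_num
  have b2 : p.ν * p.l1 ^ (3 / 4 : ℝ) * (p.l1 ^ (-1 / 4 : ℝ) * g * (e * G)) ≤ 1 / 8 * G := by
    calc _ = p.ν * (p.l1 ^ (3 / 4 : ℝ) * p.l1 ^ (-1 / 4 : ℝ)) * (g * e) * G := by ring
      _ ≤ _ := by rw [el]; gcongr
  have hs2 : √2 ≤ 2 := Real.sqrt_le_iff.mpr (by norm_num)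
  have b3 : p.l1 ^ (-1 / 4 : ℝ) * g * (√2 * (D * p.S f tn / (β * √η))) ≤ 1 / 8 * D := by
    calc _ = √2 * D / 4 * (4 * (p.l1 ^ (-1 / 4 : ℝ) * g * (p.S f tn / (β * √η)))) := by ring
      _ ≤ 2 * D / 4 * (1 / 4) :=
        mul_le_mul (by gcongr) (k1.trans hω) (by have := h.S_nonneg tn; positivity) (by positivity)
      _ = _ := by ring
  have hl34 : 0 < p.l1 ^ (3 / 4 : ℝ) := Real.rpow_pos_of_pos hl _
  have b4 := mul_le_mul_of_nonneg_left b3 (mul_pos hν hl34).le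
  have b5 := mul_le_mul_of_nonneg_left k0 (mul_pos hν hl34).le
  rw [mul_add] at b5
  linarith

end step

end

/-! ### Induction over the steps and convergence -/

section

/-- The data of a run of the algorithm. -/
structure Run (p : Constants) (f u : ℝ → Coeff) (ε : ℝ) (t th β η : ℕ → ℝ) (Nt N : ℕ → ℕ)
    (w : ℕ → ℝ → Coeff) : Prop where
  ε_pos : 0 < ε
  ε_lt : ε < p.α₀ ^ 2
  le_β : p.α₀ ≤ β 1
  β_le : β 1 ≤ p.α₁
  t_one : t 1 = 0
  times : ∀ n, 1 ≤ n → t n ≤ th n ∧ th n < t (n + 1)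
  energy_pos : ∀ n, 1 ≤ n → 0 < observedEnergy p.L p.ν (Nt n) u (th n) (t (n + 1))
  η_pos : ∀ n, 1 ≤ n → 0 < η n
  conditions : ∀ n, 1 ≤ n →
    StepConditions p f ε (if n = 1 then 1 else 0) (w n (t n)) (t n) (th n) (t (n + 1)) (β n) (η n)
      (observedEnergy p.L p.ν (Nt n) u (th n) (t (n + 1)) / (t (n + 1) - th n)) (Nt n) (N n)
  solution : ∀ n, 1 ≤ n →
    IsSolution p.L p.ν (β n) (nudgedForcing p.L (β n) (η n) (N n) f u (w n))
      (Icc (t n) (t (n + 1))) (w n)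
  restart : ∀ n, 1 ≤ n → w (n + 1) (t (n + 1)) = w n (t (n + 1))
  update : ∀ n, 1 ≤ n →
    β (n + 1) = √(updatedSq p.L p.ν u (w n) (N n) (β n) (η n) (th n) (t (n + 1)))

section run
variable {p : Constants} {f : ℝ → Coeff} {α : ℝ} {u : ℝ → Coeff} {ε : ℝ} {t th β η : ℕ → ℝ}
  {Nt N : ℕ → ℕ} {w : ℕ → ℝ → Coeff}

/-- The error at the beginning of a step. -/
def totalError (p : Constants) (α : ℝ) (u : ℝ → Coeff) (t β : ℕ → ℝ) (w : ℕ → ℝ → Coeff)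
    (n : ℕ) : ℝ :=
  errNorm p.L (β n) (w n (t n)) (u (t n)) + p.ν * p.l1 ^ (3 / 4 : ℝ) * |β n ^ 2 - α ^ 2|

variable (h : Reference p f α u) (hr : Run p f u ε t th β η Nt N w)
include hr in
lemma Run.step {n : ℕ} (hn : 1 ≤ n) (ht : 0 ≤ t n) (hβ : 0 < β n) :
    Step p f u (w n) (t n) (th n) (t (n + 1)) (β n) (η n) (Nt n) (N n) :=
  ⟨ht, (hr.times n hn).1, (hr.times n hn).2, hβ, hr.η_pos n hn, hr.energy_pos n hn,
    (hr.conditions n hn).level, (hr.conditions n hn).nudge_le, (hr.conditions n hn).nudge_ge,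
    hr.solution n hn⟩

include h hr

/-- Besides the contraction the induction carries what the next step needs: positivity of β, a
uniform lower bound α₀² - ε for β², and the hypothesis of `Step.parameter_le_eps`. -/
lemma Run.invariant (n : ℕ) : 0 ≤ t (n + 1) ∧ 0 < β (n + 1) ∧ p.α₀ ^ 2 - ε ≤ β (n + 1) ^ 2 ∧
    |β (n + 1) ^ 2 - α ^ 2| * (ε / (4 * |p.α₁ ^ 2 - p.α₀ ^ 2| *
      (if n + 1 = 1 then 1 else 0) + 4 * ε)) ≤ ε / 4 ∧
    totalError p α u t β w (n + 1) ≤ totalError p α u t β w 1 / 2 ^ n := by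
  have hε := hr.ε_pos
  have hα₀ := h.hα₀
  have hα := hα₀.trans_le h.le_α
  have hsq : p.α₀ ^ 2 ≤ α ^ 2 := pow_le_pow_left₀ hα₀.le h.le_α 2
  have hsq' : α ^ 2 ≤ p.α₁ ^ 2 := pow_le_pow_left₀ hα.le h.α_le 2
  induction n with
  | zero =>
    have h1 : p.α₀ ^ 2 ≤ β 1 ^ 2 := pow_le_pow_left₀ hα₀.le hr.le_β 2
    have h2 : β 1 ^ 2 ≤ p.α₁ ^ 2 := pow_le_pow_left₀ (hα₀.le.trans hr.le_β) hr.β_le 2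
    rw [zero_add]
    refine ⟨hr.t_one.ge, hα₀.trans_le hr.le_β, by linarith, ?_, by simp⟩
    -- Before the first update only |β₁² - α²| ≤ α₁² - α₀² is known; the summand with χ = 1 in the
    -- threshold compensates for this.
    rw [if_pos rfl, mul_one, mul_div_assoc']
    rw [abs_of_nonneg (by linarith : 0 ≤ p.α₁ ^ 2 - p.α₀ ^ 2)]
    have h3 : |β 1 ^ 2 - α ^ 2| ≤ p.α₁ ^ 2 - p.α₀ ^ 2 := by
      rw [abs_le]; constructor <;> linarith
    rw [div_le_div_iff₀ (by linarith) (by norm_num)]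
    nlinarith
  | succ n ih =>
    obtain ⟨ht, hβ, -, hD, hE⟩ := ih
    have hn : 1 ≤ n + 1 := Nat.le_add_left 1 n
    have hs := hr.step hn ht hβ
    have sc := hr.conditions (n + 1) hn
    have hχ : (0 : ℝ) ≤ if n + 1 = 1 then 1 else 0 := by split_ifs <;> norm_num
    have k1 := hs.parameter_le h hε hχ sc
    have k2 := hs.parameter_le_eps h hε sc hD
    have hup := hr.update (n + 1) hn
    have hlow : p.α₀ ^ 2 - ε ≤ updatedSq p.L p.ν u (w (n + 1)) (N (n + 1)) (β (n + 1)) (η (n + 1))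
        (th (n + 1)) (t (n + 1 + 1)) := by linarith [(abs_le.mp k2).1]
    -- The updated square is positive, so the real square root in the update, which would return 0
    -- on negative input, squares back to it.
    have hpos := (sub_pos.mpr hr.ε_lt).trans_le hlow
    have hβsq := Real.sq_sqrt hpos.le
    rw [← hup] at hβsq
    rw [← hβsq] at k1 k2 hlow
    have hβ' : 0 < β (n + 1 + 1) := by rw [hup]; exact Real.sqrt_pos.mpr hpos
    have hle : β (n + 1 + 1) ≤ √ε + p.α₁ := by
      have hα₁ := hα.le.trans h.α_le
      -- The square of the new β is at most α² + ε ≤ (√ε + α₁)², which is the bound on the new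
      -- weight required by `Step.errNorm_le`.
      refine le_of_sq_le_sq ?_ (by positivity)
      have := (abs_le.mp k2).2
      have h5 := Real.sq_sqrt hε.le
      have h6 : 0 ≤ √ε * p.α₁ := by positivity
      nlinarith
    have k3 := hs.errNorm_le h sc hle
    rw [← hr.restart (n + 1) hn] at k3
    refine ⟨ht.trans ((hr.times _ hn).1.trans (hr.times _ hn).2.le), hβ', hlow, ?_, ?_⟩
    · rw [if_neg (by omega), mul_zero, zero_add]
      have : ε / (4 * ε) = 1 / 4 := by field_simp
      rw [this]
      linarith
    -- State and parameter leave at most 1/4 + 1/8 of the total error, which is less than 1/2.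
    · have k4 : totalError p α u t β w (n + 1 + 1) ≤ totalError p α u t β w (n + 1) / 2 := by
        have h0 : 0 ≤ totalError p α u t β w (n + 1) := by
          have := h.hν
          have := Real.rpow_nonneg (lam1_nonneg p.L) (3 / 4)
          have := normV_nonneg p.L 0 (w (n + 1) (t (n + 1)) - u (t (n + 1)))
          have := normV_nonneg p.L 1 (w (n + 1) (t (n + 1)) - u (t (n + 1)))
          unfold totalError errNorm Constants.l1
          positivity
        unfold totalError at h0 ⊢
        linarith
      calc _ ≤ _ := k4
        _ ≤ (totalError p α u t β w 1 / 2 ^ n) / 2 := by gcongr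
        _ = _ := by rw [pow_succ, div_div]

/-- Convergence of the algorithm. -/
theorem Run.convergence :
    (∀ n : ℕ, 0 < β (n + 1) ∧
      |β (n + 1) ^ 2 - α ^ 2| ≤
        (p.ν⁻¹ * p.l1 ^ (-3 / 4 : ℝ) * errNorm p.L (β 1) (w 1 0) (u 0) + |β 1 ^ 2 - α ^ 2|) / 2 ^ n ∧
      errNorm p.L (β (n + 1)) (w (n + 1) (t (n + 1))) (u (t (n + 1))) ≤
        (errNorm p.L (β 1) (w 1 0) (u 0)
          + p.ν * p.l1 ^ (3 / 4 : ℝ) * |β 1 ^ 2 - α ^ 2|) / 2 ^ n) ∧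
    ∃ C : ℝ, ∀ n : ℕ, |β (n + 1) - α| ≤ C / 2 ^ n ∧
      normV p.L 1 (w (n + 1) (t (n + 1)) - u (t (n + 1))) ≤ C / 2 ^ n := by
  have hν := h.hν
  have hα₀ := h.hα₀
  have hα := hα₀.trans_le h.le_α
  have hl : 0 < p.l1 := lam1_pos h.hL
  set X := p.ν * p.l1 ^ (3 / 4 : ℝ) with hX
  have hX0 : 0 < X := mul_pos hν (Real.rpow_pos_of_pos hl _)
  have hXinv : p.ν⁻¹ * p.l1 ^ (-3 / 4 : ℝ) = X⁻¹ := by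
    rw [hX, mul_inv, ← Real.rpow_neg hl.le]; norm_num
  set T := errNorm p.L (β 1) (w 1 0) (u 0) + X * |β 1 ^ 2 - α ^ 2| with hT
  have hT1 : totalError p α u t β w 1 = T := by rw [totalError, hr.t_one]
  have err_nonneg : ∀ n, 0 ≤ errNorm p.L (β (n + 1)) (w (n + 1) (t (n + 1))) (u (t (n + 1))) :=
    fun n => add_nonneg (normV_nonneg _ _ _)
      (mul_nonneg (hr.invariant h n).2.1.le (normV_nonneg _ _ _))
  have hE : ∀ n, errNorm p.L (β (n + 1)) (w (n + 1) (t (n + 1))) (u (t (n + 1))) ≤ T / 2 ^ n :=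
    fun n => by
    have h1 := (hr.invariant h n).2.2.2.2
    rw [hT1, totalError] at h1
    have : 0 ≤ X * |β (n + 1) ^ 2 - α ^ 2| := by positivity
    linarith
  have hD : ∀ n, |β (n + 1) ^ 2 - α ^ 2| ≤ X⁻¹ * T / 2 ^ n := fun n => by
    have h1 := (hr.invariant h n).2.2.2.2
    rw [hT1, totalError] at h1
    have h2 := err_nonneg n
    rw [mul_div_assoc, inv_mul_eq_div, le_div_iff₀ hX0]
    linarith
  have hT0 : 0 ≤ T := by simpa using (err_nonneg 0).trans (hE 0)
  refine ⟨fun n => ⟨(hr.invariant h n).2.1, ?_, hE n⟩, ?_⟩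
  · refine (hD n).trans (le_of_eq ?_)
    rw [hXinv, hT, mul_add, inv_mul_cancel_left₀ hX0.ne']
  -- The weight β in the error norm is bounded below by m uniformly in n, which gives a rate for
  -- ‖∇g‖ itself. For β - α one divides β² - α² by β + α ≥ α₀.
  · set m := √(p.α₀ ^ 2 - ε) with hm
    have hm0 : 0 < m := Real.sqrt_pos.mpr (sub_pos.mpr hr.ε_lt)
    refine ⟨X⁻¹ * T / p.α₀ + T / m, fun n => ⟨?_, ?_⟩⟩
    · have hβ := (hr.invariant h n).2.1
      have h1 : |β (n + 1) - α| * p.α₀ ≤ |β (n + 1) ^ 2 - α ^ 2| := by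
        rw [sq_sub_sq, abs_mul, mul_comm, abs_of_pos (add_pos hβ hα)]
        gcongr
        linarith [h.le_α]
      rw [← le_div_iff₀ hα₀] at h1
      refine h1.trans ?_
      calc _ ≤ X⁻¹ * T / 2 ^ n / p.α₀ := by gcongr; exact hD n
        _ = X⁻¹ * T / p.α₀ / 2 ^ n := div_right_comm _ _ _
        _ ≤ _ := by gcongr; exact le_add_of_nonneg_right (by positivity)
    · have hβ := (hr.invariant h n).2.1
      have hmβ : m ≤ β (n + 1) := Real.sqrt_le_iff.mpr ⟨hβ.le, (hr.invariant h n).2.2.1⟩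
      have h1 := hE n
      rw [errNorm] at h1
      have h2 := normV_nonneg p.L 0 (w (n + 1) (t (n + 1)) - u (t (n + 1)))
      have h3 := normV_nonneg p.L 1 (w (n + 1) (t (n + 1)) - u (t (n + 1)))
      have h4 : normV p.L 1 (w (n + 1) (t (n + 1)) - u (t (n + 1))) ≤ T / 2 ^ n / m := by
        rw [le_div_iff₀ hm0, mul_comm]
        have := mul_le_mul_of_nonneg_right hmβ h3
        linarith
      refine h4.trans ?_
      rw [div_right_comm]
      gcongr
      exact le_add_of_nonneg_left (by positivity)

end run

end

/-! ### Fourier series on the torus and existence of Gagliardo–Nirenberg constants -/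

section

local instance : MeasureSpace UnitAddCircle := ⟨AddCircle.haarAddCircle⟩

variable {L : ℝ}

/-- The representative in `(0,L]³` of a point of the torus. -/
def unroll (L : ℝ) (y : UnitAddTorus (Fin 3)) : Fin 3 → ℝ :=
  L • (UnitAddTorus.measurableEquivPiIoc (0 : Fin 3 → ℝ) y).1

lemma measurableEmbedding_unroll (hL : 0 < L) : MeasurableEmbedding (unroll L) :=
  ((Homeomorph.smulOfNeZero L hL.ne').measurableEmbedding.comp (MeasurableEmbedding.subtype_coe
    (MeasurableSet.univ_pi' fun _ => measurableSet_Ioc))).comp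
    (UnitAddTorus.measurableEquivPiIoc (0 : Fin 3 → ℝ)).measurableEmbedding

/-- The torus carries Haar probability measure, hence the factor L⁻³. The half-open and closed cubes
differ by a null set. -/
lemma map_unroll (hL : 0 < L) : Measure.map (unroll L) volume =
    ENNReal.ofReal (L ^ 3)⁻¹ • volume.restrict (cube L) := by
  have hm : MeasurableSet {x : Fin 3 → ℝ | ∀ i, x i ∈ Ioc ((0 : Fin 3 → ℝ) i) ((0 : Fin 3 → ℝ) i + 1)} :=
    MeasurableSet.univ_pi' fun _ => measurableSet_Ioc
  have h1 : Measure.map (fun y => (UnitAddTorus.measurableEquivPiIoc (0 : Fin 3 → ℝ) y).1) volume =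
      volume.restrict {x : Fin 3 → ℝ | ∀ i, x i ∈ Ioc ((0 : Fin 3 → ℝ) i) ((0 : Fin 3 → ℝ) i + 1)} := by
    rw [← map_comap_subtype_coe hm, ← (UnitAddTorus.measurePreserving_equivPiIoc _).map_eq,
      Measure.map_map measurable_subtype_coe (MeasurableEquiv.measurable _)]
    rfl
  have h2 : (volume : Measure (Fin 3 → ℝ)).restrict (cube L) =
      volume.restrict (univ.pi fun _ => Ioc 0 L) :=
    Measure.restrict_congr_set Measure.univ_pi_Ioc_ae_eq_Icc.symm
  have h3 := Measure.map_addHaar_smul (volume : Measure (Fin 3 → ℝ)) hL.ne'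
  have h4 : (fun x : Fin 3 → ℝ => L • x) ⁻¹' (univ.pi fun _ => Ioc 0 L) =
      {x : Fin 3 → ℝ | ∀ i, x i ∈ Ioc ((0 : Fin 3 → ℝ) i) ((0 : Fin 3 → ℝ) i + 1)} := by
    ext x
    simp only [mem_preimage, Set.mem_pi, mem_univ, true_imp_iff, mem_Ioc, Pi.smul_apply, smul_eq_mul,
      Set.mem_ofPred_eq, Pi.zero_apply, zero_add]
    refine forall_congr' fun i => ?_
    rw [mul_pos_iff_of_pos_left hL, mul_le_iff_le_one_right hL]
  have h5 : Measure.map (unroll L) volume = Measure.map (fun x : Fin 3 → ℝ => L • x)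
      (Measure.map (fun y => (UnitAddTorus.measurableEquivPiIoc (0 : Fin 3 → ℝ) y).1) volume) := by
    exact (Measure.map_map (measurable_const_smul L)
      (measurable_subtype_coe.comp (MeasurableEquiv.measurable _))).symm
  rw [h5, h1, ← h4, ← Measure.restrict_map (measurable_const_smul L)
    (MeasurableSet.univ_pi fun _ => measurableSet_Ioc), h3, h2, Measure.restrict_smul]
  simp [abs_of_pos hL]

lemma mFourier_eq_expo (hL : 0 < L) (K : Fin 3 → ℤ) (y : UnitAddTorus (Fin 3)) :
    UnitAddTorus.mFourier K y = expo L K (unroll L y) := by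
  have h : y = fun i => (((UnitAddTorus.measurableEquivPiIoc (0 : Fin 3 → ℝ) y).1 i : ℝ) :
      UnitAddCircle) := by
    conv_lhs => rw [← (UnitAddTorus.measurableEquivPiIoc (0 : Fin 3 → ℝ)).symm_apply_apply y]
    rfl
  conv_lhs => rw [h]
  have hL' : (L : ℂ) ≠ 0 := by exact_mod_cast hL.ne'
  simp only [UnitAddTorus.mFourier, ContinuousMap.coe_mk, expo_eq_prod]
  refine Finset.prod_congr rfl fun i _ => ?_
  rw [fourier_coe_apply]
  congr 1
  simp only [unroll, Pi.smul_apply, smul_eq_mul]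
  push_cast
  field_simp

lemma Realizes.mFourierCoeff_eq (hL : 0 < L) {φ : (Fin 3 → ℝ) → EuclideanSpace ℝ (Fin 3)} {g : Coeff}
    (h : Realizes L φ g) (K : Fin 3 → ℤ) (i : Fin 3) :
    UnitAddTorus.mFourierCoeff (fun y => (φ (unroll L y) i : ℂ)) K = g K i := by
  have e : ∀ y, UnitAddTorus.mFourier (-K) y • (φ (unroll L y) i : ℂ) =
      (fun x => expo L (-K) x * (φ x i : ℂ)) (unroll L y) := fun y => by
    rw [mFourier_eq_expo hL, smul_eq_mul]
  rw [UnitAddTorus.mFourierCoeff, integral_congr_ae (Eventually.of_forall e),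
    ← (measurableEmbedding_unroll hL).integral_map fun x => expo L (-K) x * (φ x i : ℂ), map_unroll hL, integral_smul_measure, h.2,
    ENNReal.toReal_ofReal (by positivity), Complex.real_smul]
  congr 1
  · push_cast; simp
  · refine setIntegral_congr_fun (isCompact_Icc (a := (0 : Fin 3 → ℝ)) (b := fun _ => L)).measurableSet
      fun x _ => ?_
    rw [mul_comm]
    simp only [expo]
    congr 2
    simp [neg_div]

lemma Realizes.memLp_unroll (hL : 0 < L) {φ : (Fin 3 → ℝ) → EuclideanSpace ℝ (Fin 3)} {g : Coeff}
    (h : Realizes L φ g) (i : Fin 3) :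
    MemLp (fun y => (φ (unroll L y) i : ℂ)) 2 (volume : Measure (UnitAddTorus (Fin 3))) := by
  have h1 : MemLp φ 2 (Measure.map (unroll L) volume) := by
    rw [map_unroll hL]
    exact h.1.smul_measure ENNReal.ofReal_ne_top
  have h2 := (measurableEmbedding_unroll hL).memLp_map_measure_iff.mp h1
  exact (MemLp.eval_piLp h2 i).ofReal

/-- The Fourier series of an L² function converges in L², in particular along the truncations, and
therefore in measure. -/
lemma Realizes.tendstoInMeasure (hL : 0 < L) {φ : (Fin 3 → ℝ) → EuclideanSpace ℝ (Fin 3)} {g : Coeff}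
    (hg : IsField g) (h : Realizes L φ g) (i : Fin 3) :
    TendstoInMeasure (volume : Measure (UnitAddTorus (Fin 3)))
      (fun M y => spoly L M (fun K => g K i) (unroll L y)) atTop
      (fun y => (φ (unroll L y) i : ℂ)) := by
  have hm := h.memLp_unroll hL i
  have hs := UnitAddTorus.hasSum_mFourier_series_L2 (hm.toLp)
  have hc : ∀ K, UnitAddTorus.mFourierCoeff (hm.toLp : UnitAddTorus (Fin 3) → ℂ) K = g K i := by
    intro K
    rw [← h.mFourierCoeff_eq hL]
    refine integral_congr_ae ?_
    filter_upwards [hm.coeFn_toLp] with y hy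
    rw [hy]
  simp only [hc] at hs
  -- The truncations omit K = 0; inserting it makes the sets exhaust ℤ³ and adds nothing to a
  -- mean-free field.
  have ht : Tendsto (fun M => insert 0 (modes M)) atTop (atTop : Filter (Finset (Fin 3 → ℤ))) := by
    refine tendsto_atTop_finset_of_monotone
      (fun M N hMN => Finset.insert_subset_insert _ (modes_mono hMN)) fun K => ?_
    by_cases hK : K = 0
    · exact ⟨0, by simp [hK]⟩
    · obtain ⟨M, hM⟩ := (eventually_mem_modes hK).exists
      exact ⟨M, Finset.mem_insert_of_mem hM⟩
  have h1 := hs.comp ht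
  have h2 := tendstoInMeasure_of_tendsto_Lp h1
  refine h2.congr (fun M => ?_) hm.coeFn_toLp
  have h0 : (0 : Fin 3 → ℤ) ∉ modes M := fun h => (mem_modes'.mp h).1 rfl
  simp only [Function.comp]
  rw [Finset.sum_insert h0]
  simp only [hg.1, PiLp.zero_apply, zero_smul, zero_add]
  have h3 := Lp.coeFn_finsetSum (modes M)
    (fun K => g K i • UnitAddTorus.mFourierLp (d := Fin 3) 2 K)
  have h4 : ∀ᵐ y, ∀ K, (g K i • UnitAddTorus.mFourierLp (d := Fin 3) 2 K :
      Lp ℂ 2 (volume : Measure (UnitAddTorus (Fin 3)))) y = g K i * UnitAddTorus.mFourier K y := by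
    refine ae_all_iff.mpr fun K => ?_
    filter_upwards [Lp.coeFn_smul (g K i) (UnitAddTorus.mFourierLp (d := Fin 3) 2 K),
      UnitAddTorus.coeFn_mFourierLp 2 K] with y h1 h2
    rw [h1, Pi.smul_apply, h2, smul_eq_mul]
  filter_upwards [h3, h4] with y h3 h4
  rw [h3, Finset.sum_apply]
  simp only [spoly, h4, mFourier_eq_expo hL]

/-- A field is almost everywhere the limit of a sequence of its truncations. -/
lemma Realizes.exists_seq_tendsto_ae (hL : 0 < L) {φ : (Fin 3 → ℝ) → EuclideanSpace ℝ (Fin 3)}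
    {g : Coeff} (hg : IsField g) (h : Realizes L φ g) :
    ∃ M : ℕ → ℕ, ∀ᵐ x ∂(volume.restrict (cube L)),
      Tendsto (fun n => field L (M n) (proj (M n) g) x) atTop (𝓝 (φ x)) := by
  -- Almost everywhere convergent subsequences are extracted successively for the three components.
  obtain ⟨n0, s0, h0⟩ := (h.tendstoInMeasure hL hg 0).exists_seq_tendsto_ae
  obtain ⟨n1, s1, h1⟩ := ((h.tendstoInMeasure hL hg 1).comp s0.tendsto_atTop).exists_seq_tendsto_ae
  obtain ⟨n2, s2, h2⟩ := ((h.tendstoInMeasure hL hg 2).comp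
    (s0.comp s1).tendsto_atTop).exists_seq_tendsto_ae
  refine ⟨n0 ∘ n1 ∘ n2, ?_⟩
  have key : ∀ᵐ x ∂(Measure.map (unroll L) volume),
      Tendsto (fun n => field L ((n0 ∘ n1 ∘ n2) n) (proj ((n0 ∘ n1 ∘ n2) n) g) x) atTop (𝓝 (φ x)) := by
    rw [(measurableEmbedding_unroll hL).ae_map_iff]
    filter_upwards [h0, h1, h2] with y h0 h1 h2
    have a0 := h0.comp (s1.comp s2).tendsto_atTop
    have a1 := h1.comp s2.tendsto_atTop
    have e : ∀ M x, field L M (proj M g) x = field L M g x := by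
      intro M x
      simp only [field, spoly]
      congr 1
      funext i
      congr 1
      exact Finset.sum_congr rfl fun K hK => by rw [proj_of_mem hK]
    simp only [e]
    have hall : ∀ i, Tendsto (fun n => (spoly L ((n0 ∘ n1 ∘ n2) n) (fun K => g K i) (unroll L y)).re)
        atTop (𝓝 (φ (unroll L y) i)) := by
      intro i
      have : Tendsto (fun n => spoly L ((n0 ∘ n1 ∘ n2) n) (fun K => g K i) (unroll L y))
        atTop (𝓝 (φ (unroll L y) i : ℂ)) := by
        fin_cases i
        · exact a0
        · exact a1
        · exact h2
      exact (Complex.continuous_re.tendsto _).comp this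
    exact (PiLp.continuous_toLp 2 _).tendsto _ |>.comp (tendsto_pi_nhds.mpr hall)
  rw [map_unroll hL] at key
  refine (Measure.ae_ennreal_smul_measure_iff ?_).mp key
  rw [ENNReal.ofReal_ne_zero_iff]
  positivity

/-- Fatou's lemma along the almost everywhere convergent truncations extends uniform bounds to the
field itself. -/
lemma Realizes.eLpNorm_le (hL : 0 < L) {φ : (Fin 3 → ℝ) → EuclideanSpace ℝ (Fin 3)}
    {g : Coeff} (hg : IsField g) (h : Realizes L φ g) (p C : ENNReal)
    (hC : ∀ M, eLpNorm (field L M (proj M g)) p (volume.restrict (cube L)) ≤ C) :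
    eLpNorm φ p (volume.restrict (cube L)) ≤ C := by
  obtain ⟨M, hM⟩ := h.exists_seq_tendsto_ae hL hg
  refine (Lp.eLpNorm_lim_le_liminf_eLpNorm
    (fun n => (continuous_field L (M n) _).aestronglyMeasurable) φ hM).trans ?_
  exact liminf_le_of_le (by isBoundedDefault) fun b hb => (hb.exists.choose_spec).trans (hC _)

/-- Interpolation between L² and L⁴: (∫|g|³)² ≤ ∫|g|² ∫|g|⁴. The sixth power of the constant comes
out as 3 ≤ 2⁶. -/
lemma eLpNorm_three_field_le (hL : 0 < L) {M : ℕ} {d : Coeff} (hd : IsTrig M d) :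
    eLpNorm (field L M d) 3 (volume.restrict (cube L)) ≤ ENNReal.ofReal (2 * interp L d) := by
  set μ := volume.restrict (cube L)
  have hF := continuous_field L M d
  have n0 := normV_nonneg L 0 d
  have n1 := normV_nonneg L 1 d
  have ni := interp_nonneg L d
  have h2 : eLpNorm (field L M d) 2 μ = ENNReal.ofReal (normV L 0 d) := by
    have := eLpNorm_field hL hd 0 1 zero_le_one
    rw [← cube_eq] at this
    simpa using this
  have h4 := eLpNorm_four_field_le hL hd
  have h := sq_lintegral_mul_le μ hF.enorm.measurable (hF.enorm.measurable.pow_const 2)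
  simp only [← pow_succ', ← pow_mul] at h
  norm_num at h
  rw [eLpNorm_pow_eq, eLpNorm_pow_eq, eLpNorm_pow_eq] at h
  push_cast at h
  rw [h2, ← pow_mul] at h
  have e : interp L d ^ 2 = normV L 0 d * normV L 1 d := Real.sq_sqrt (by positivity)
  have hb : eLpNorm (field L M d) 3 μ ^ 6 ≤ ENNReal.ofReal (2 * interp L d) ^ 6 := by
    refine h.trans ?_
    calc _ ≤ ENNReal.ofReal (normV L 0 d) ^ 2 *
          ENNReal.ofReal √(√3 * (interp L d * normV L 1 d)) ^ 4 := by gcongr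
      _ = ENNReal.ofReal (3 * interp L d ^ 6) := by
        rw [← ENNReal.ofReal_pow n0, ← ENNReal.ofReal_pow (Real.sqrt_nonneg _),
          ← ENNReal.ofReal_mul (by positivity)]
        congr 1
        rw [show ∀ x : ℝ, x ^ 4 = (x ^ 2) ^ 2 from fun x => by ring, Real.sq_sqrt (by positivity),
          mul_pow, mul_pow, e, Real.sq_sqrt (by norm_num),
          show interp L d ^ 6 = (interp L d ^ 2) ^ 3 by ring, e]
        ring
      _ ≤ _ := by
        rw [← ENNReal.ofReal_pow (by positivity)]
        refine ENNReal.ofReal_le_ofReal ?_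
        rw [mul_pow]
        gcongr
        norm_num
  exact (ENNReal.pow_right_strictMono (by norm_num)).le_iff_le.mp hb

/-- Existence of admissible constants in the Gagliardo-Nirenberg inequalities. -/
theorem exists_isGNConstant {L : ℝ} (hL : 0 < L) : ∃ c, IsGNConstant L c := by
  -- The value 3 dominates the constants 2, 3^{1/4} and 3 obtained for L³, L⁴ and L⁶.
  refine ⟨3, by norm_num, fun g hg φ h => ?_⟩
  have n0 := normV_nonneg L 0 g
  have n1 := normV_nonneg L 1 g
  have ni := interp_nonneg L g
  refine ⟨h.eLpNorm_le hL hg.isField _ _ fun M => ?_, h.eLpNorm_le hL hg.isField _ _ fun M => ?_,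
    h.eLpNorm_le hL hg.isField _ _ fun M => ?_⟩
  · refine (eLpNorm_three_field_le hL (hg.isField.isTrig_proj M)).trans
      (ENNReal.ofReal_le_ofReal ?_)
    rw [mul_assoc, rpow_half_mul_rpow_half n0]
    have := interp_proj_le hL hg M
    rw [← interp]
    linarith
  · refine (eLpNorm_four_field_le hL (hg.isField.isTrig_proj M)).trans
      (ENNReal.ofReal_le_ofReal ?_)
    rw [mul_assoc]
    refine Real.sqrt_le_iff.mpr ⟨by positivity, ?_⟩
    rw [mul_pow, pow_two (_ * _), quarter_mul_self n0 n1, ← interp]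
    have h1 := interp_proj_le hL hg M
    have h2 := normV_proj_le hL hg M
    have h3 : √3 ≤ 3 ^ 2 := Real.sqrt_le_iff.mpr ⟨by norm_num, by norm_num⟩
    have := normV_nonneg L 1 (proj M g)
    have := interp_nonneg L (proj M g)
    gcongr
  · refine (eLpNorm_six_field_le hL (hg.isField.isTrig_proj M)).trans
      (ENNReal.ofReal_le_ofReal ?_)
    have := normV_proj_le hL hg M
    linarith

end

end Bardina

end

theorem theorem4p1 (p : Bardina.Constants) (hL : 0 < p.L) :
    -- admissible Gagliardo-Nirenberg constants exist, and `p.c` may be any of them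
    (∃ c : ℝ, Bardina.IsGNConstant p.L c) ∧
    (Bardina.IsGNConstant p.L p.c → 0 < p.ν → 0 < p.α₀ → 0 < p.MA → 0 < p.MB → 0 < p.MC →
    -- forcing and reference solution, with unknown length scale `α`
    ∀ (f : ℝ → Bardina.Coeff), Bardina.IsForcing p.L f →
    ∀ (α : ℝ), p.α₀ ≤ α → α ≤ p.α₁ →
    ∀ (u : ℝ → Bardina.Coeff), Bardina.IsSolution p.L p.ν α f (Set.Ici 0) u →
      Bardina.MemV 2 (u 0) → Bardina.normV p.L 0 (u 0) ≤ p.MA →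
      Bardina.normV p.L 1 (u 0) ≤ p.MB → Bardina.normV p.L 2 (u 0) ≤ p.MC →
    ∀ (w₀ : Bardina.Coeff), Bardina.MemV 2 w₀ →
    ∀ (ε : ℝ), 0 < ε → ε < p.α₀ ^ 2 →
    -- a run of the algorithm, steps `n = 1, 2, 3, …`; `th n` is the start of the `n`-th window
    ∀ (t th β η : ℕ → ℝ) (Nt N : ℕ → ℕ) (w : ℕ → ℝ → Bardina.Coeff),
      p.α₀ ≤ β 1 → β 1 ≤ p.α₁ →
      t 1 = 0 → (∀ n, 1 ≤ n → t n ≤ th n ∧ th n < t (n + 1)) →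
      (∀ n, 1 ≤ n → 0 < Bardina.observedEnergy p.L p.ν (Nt n) u (th n) (t (n + 1))) →
      (∀ n, 1 ≤ n → 0 < η n) →
      (∀ n, 1 ≤ n →
        Bardina.StepConditions p f ε (if n = 1 then 1 else 0) (w n (t n)) (t n) (th n) (t (n + 1))
          (β n) (η n)
          (Bardina.observedEnergy p.L p.ν (Nt n) u (th n) (t (n + 1)) / (t (n + 1) - th n))
          (Nt n) (N n)) →
      (∀ n, 1 ≤ n →
        Bardina.IsSolution p.L p.ν (β n) (Bardina.nudgedForcing p.L (β n) (η n) (N n) f u (w n))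
          (Set.Icc (t n) (t (n + 1))) (w n)) →
      w 1 (t 1) = w₀ → (∀ n, 1 ≤ n → w (n + 1) (t (n + 1)) = w n (t (n + 1))) →
      (∀ n, 1 ≤ n →
        β (n + 1) = √(Bardina.updatedSq p.L p.ν u (w n) (N n) (β n) (η n) (th n) (t (n + 1)))) →
    (∀ n : ℕ,
      0 < β (n + 1) ∧
      |β (n + 1) ^ 2 - α ^ 2| ≤
        (p.ν⁻¹ * p.l1 ^ (-3 / 4 : ℝ) * Bardina.errNorm p.L (β 1) (w 1 0) (u 0)
          + |β 1 ^ 2 - α ^ 2|) / 2 ^ n ∧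
      Bardina.errNorm p.L (β (n + 1)) (w (n + 1) (t (n + 1))) (u (t (n + 1))) ≤
        (Bardina.errNorm p.L (β 1) (w 1 0) (u 0)
          + p.ν * p.l1 ^ (3 / 4 : ℝ) * |β 1 ^ 2 - α ^ 2|) / 2 ^ n) ∧
    -- exponential convergence `β_n → α` in `ℝ` and `w_n(t_n) - u(t_n) → 0` in `V`
    ∃ C : ℝ, ∀ n : ℕ,
      |β (n + 1) - α| ≤ C / 2 ^ n ∧
      Bardina.normV p.L 1 (w (n + 1) (t (n + 1)) - u (t (n + 1))) ≤ C / 2 ^ n) := by 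
  refine ⟨Bardina.exists_isGNConstant hL, ?_⟩
  intro gn hν hα₀ _ _ _ f hf α hα hα' u hu _ hu0 hu1 _ w₀ _ ε hε hε' t th β η Nt N w hβ hβ' ht htimes
    hpos hη hcond hsol _ hrestart hupdate
  exact Bardina.Run.convergence ⟨hL, gn, hν, hα₀, hf, hα, hα', hu, hu0, hu1⟩
    ⟨hε, hε', hβ, hβ', ht, htimes, hpos, hη, hcond, hsol, hrestart, hupdate⟩
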